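/- **Setting.** There are $N=3f+1$ replicas $0,\dots,N-1$, of which at most $f$ are faulty (Byzantine). Signatures are unforgeable: faulty replicas may send arbitrary messages, but every signature of a correct replica inside a message stems from a message which that replica has sent. Hashes are collision-free. Correct replicas are connected by reliable links (every message sent between them arrives eventually), their local computation takes no time, and their timers are exact. Only finitely many events happen in bounded time. The network is asynchronous at first; the synchronous phase starts at some unknown time, and every message that a correct replica sends to a correct replica from then on arrives after a delay below $\Delta>0$, where $\Delta$ is known to the replicas. There is an arbitrary conflict relation on requests (in applications, requests of the same client always conflict). Broadcasts include the sender, whose own copy arrives at once. **Protocol (without checkpointing and garbage collection).** A slot $s=\langle co,n\rangle$ consists of its request coordinator and a sequence number. For each slot a replica keeps a view, initially $-1$. A dependency set is compact: it names for each replica at most one slot of this replica. Every correct replica follows the rules below, each as soon as it applies. 1. *Propose.* A replica $co$ that receives a correctly signed client request $r$ that it has not proposed and does not know to be committed takes its next slot $s$, computes the set $D$ of the latest known conflicting slots of all replicas, chooses a quorum $F$ of $2f$ other replicas, starts its commit timer ($9\Delta$) and broadcasts $\mathrm{DepPropose}(s,co,h(r),D,F)$ together with $r$. 2. *Accept.*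 The operation $\mathrm{wait}(d)$ blocks until $f+1$ replicas have sent a $\mathrm{DepVerify}$, or $f+1$ replicas a $\mathrm{ViewChange}$, for slot $d$, or a $\mathrm{DepPropose}$ has been accepted or a view change triggered for $d$. A follower in view $-1$ accepts the first $\mathrm{DepPropose}$ for $s$ (with valid $F$) whose dependencies and whose predecessor slot $\langle co,n-1\rangle$ pass $\mathrm{wait}$. It then starts a propose timer ($2\Delta$) and, if it is not yet running, the commit timer ($9\Delta$). Once it also has $r$, correctly signed, and if it belongs to $F$, it broadcasts a $\mathrm{DepVerify}$ with its own dependency set for $r$. When the propose timer expires, or a view change starts while it is running, it broadcasts the $\mathrm{DepPropose}$ (without $r$). A replica without $\mathrm{DepPropose}$ that has received $f+1$ $\mathrm{DepVerify}$s for $s$ also starts the commit timer. 3. *Fast path.* One matching $\mathrm{DepVerify}$ of each member of $F$ is collected, each after $\mathrm{wait}$ for its dependencies; when all are there, the propose timer stops. If every dependency in them is reported by at least $f+1$ followers, the replica has fp-verified the slot and broadcasts $\mathrm{DepCommit}$. With $2f+1$ matching $\mathrm{DepCommit}$s it *fp-commits*. 4. *Reconciliation path.* Otherwise it broadcasts $\mathrm{Prepare}$.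 With $2f+1$ matching $\mathrm{Prepare}$s of its view it is rp-prepared and broadcasts $\mathrm{Commit}$; with $2f+1$ matching $\mathrm{Commit}$s of its view it *rp-commits*. Committing stops the commit timer. 5. *View change.* When the commit timer or the view-change timer expires, the replica moves from view $v$ to $v+1$; if the $(f+1)$-highest view known from valid $\mathrm{ViewChange}$s exceeds its view, it moves to that view. It stops its timers and broadcasts $\mathrm{ViewChange}$ for the new view with its newest certificate: a reconciliation-path certificate (rp-prepared), or a fast-path certificate (fp-verified), or none. When $2f+1$ replicas are known to have reached its view or a higher one, it starts the view-change timer $\Delta_{vc}$. The coordinator $(co+\max(0,v))\bmod N$ of view $v$, itself in view $v$, with $2f+1$ valid $\mathrm{ViewChange}$s for $v$ broadcasts $\mathrm{NewView}$, with these messages and the value of a reconciliation-path certificate of the highest view, else of a fast-path certificate, else a no-op. A replica in the view change to $v$ accepts a valid $\mathrm{NewView}$ for $v$: it adopts the value, stops the view-change timer, starts the commit timer, now with $3\Delta$, and broadcasts $\mathrm{Prepare}$ for view $v$. 6. *Lagging replicas.* A replica that has moved to a new view without knowing a result for the slot, and that sees no $2f+1$ replicas in this view or a higher one for $4\Delta$,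 queries all replicas. A replica answers a query as soon as it knows the result; $f+1$ matching answers are adopted as result. 7. *Rotation.* A coordinator that learns that its slot was filled with a no-op proposes the request again in a new slot. In its $k$-th proposal of a request it uses the $k$-th quorum of a fixed sequence of quorums, in which every set of $2f$ other replicas occurs infinitely often. **Clients.** A correct client sends its signed request to some replica and, if replies from $f+1$ replicas have not been sent within its timeout, to all replicas; messages of the client to correct replicas arrive eventually. A correct replica replies only to requests that it knows to be committed. **Theorem (Agreement Liveness).** Let $\Delta_{vc}=3\Delta$ or $\Delta_{vc}=5\Delta$. In every run of this system in which at most $f$ replicas are faulty and which eventually enters a synchronous phase that lasts, every request $r$ issued by a correct client eventually commits: there is a slot with request $r$ that some correct replica fp-commits or rp-commits. -/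

import Mathlib

/-!
An egalitarian Byzantine fault-tolerant agreement protocol (without checkpointing) as a timed
transition system.  There are `3 * f + 1` replicas.  Hashes are idealised as injective: a hash of
`x` is represented by `x` itself.  Signatures are idealised as unforgeable, see `Authentic`.
-/

namespace Isos

noncomputable section

open scoped Classical

universe u

abbrev Replica (f : ℕ) := Fin (3 * f + 1)

/-- An agreement slot: its request coordinator and the coordinator-local sequence number. -/
structure Slot (f : ℕ) where
  co : Replica f
  seq : ℕ

/-- Compact dependency set: for every replica at most one sequence number, that of the latest
conflicting slot of this replica. -/
abbrev Deps (f : ℕ) := Replica f → Option ℕ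

/-- `Q` is a fast-path quorum for coordinator `i`: `2f` followers of `i`. -/
def IsQuorum {f : ℕ} (i : Replica f) (Q : Finset (Replica f)) : Prop :=
  Q.card = 2 * f ∧ i ∉ Q

/-- Parameters of a deployment. `delta` is the known bound on synchronous network delays,
`vcTimeout` the view-change timeout, `signed r` says that request `r` carries a correct client
signature, `conflict` is the application's conflict relation. `rotation i k` is the quorum that
coordinator `i` uses when it proposes a request for the `k`-th time (counted from `0`). -/
structure Params (f : ℕ) (Req : Type u) where
  delta : ℝ
  vcTimeout : ℝ
  signed : Req → Prop
  conflict : Req → Req → Prop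
  rotation : Replica f → ℕ → Finset (Replica f)

/-- The fast-path quorum is rotated through all quorums, over and over again. -/
def Params.IsRotation {f : ℕ} {Req : Type u} (P : Params f Req) : Prop :=
  (∀ i k, IsQuorum i (P.rotation i k)) ∧
    ∀ i Q, IsQuorum i Q → ∀ m, ∃ k, m ≤ k ∧ P.rotation i k = Q

/-! ### Messages -/

/-- `DepPropose`, signed by the coordinator `slot.co`. -/
structure DepPropose (f : ℕ) (Req : Type u) where
  slot : Slot f
  req : Req
  deps : Deps f
  quorum : Finset (Replica f)

/-- `DepVerify`, signed by `sender`; `dp` stands for the hash of the `DepPropose`. -/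
structure DepVerify (f : ℕ) (Req : Type u) where
  slot : Slot f
  sender : Replica f
  dp : DepPropose f Req
  deps : Deps f

/-- A family of `DepVerify`s indexed by their senders. -/
abbrev Verifies (f : ℕ) (Req : Type u) := Replica f → Option (DepVerify f Req)

/-- What is agreed on in a slot: a `DepPropose` with its `DepVerify`s, or `none`, the no-op. -/
abbrev Value (f : ℕ) (Req : Type u) := Option (DepPropose f Req × Verifies f Req)

/-- What is handed to the execution: a proposal with its final dependencies, or `none`, the
no-op. -/
abbrev Outcome (f : ℕ) (Req : Type u) := Option (DepPropose f Req × Set (Slot f))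

/-- Fast-path and reconciliation-path certificates. In `rpc`, `signers` are the senders of the
`Prepare`s for `val` in view `view` that are part of the certificate. -/
inductive Cert (f : ℕ) (Req : Type u) where
  | fpc (dp : DepPropose f Req) (dv : Verifies f Req)
  | rpc (val : Value f Req) (view : ℤ) (signers : Finset (Replica f))

structure ViewChange (f : ℕ) (Req : Type u) where
  view : ℤ
  slot : Slot f
  sender : Replica f
  cert : Option (Cert f Req)

structure NewView (f : ℕ) (Req : Type u) where
  view : ℤ
  slot : Slot f
  sender : Replica f
  val : Value f Req
  vcs : Replica f → Option (ViewChange f Req)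

/-- Messages. `depPropose dp true` is a `DepPropose` accompanied by the full request,
`depPropose dp false` is a `DepPropose` alone (as forwarded by followers). In `depCommit`,
`prepare` and `commit` the value stands for the hash of the `DepVerify`s. -/
inductive Msg (f : ℕ) (Req : Type u) where
  | request (r : Req)
  | depPropose (dp : DepPropose f Req) (withReq : Bool)
  | depVerify (dv : DepVerify f Req)
  | depCommit (s : Slot f) (sender : Replica f) (val : Value f Req)
  | prepare (view : ℤ) (s : Slot f) (sender : Replica f) (val : Value f Req)
  | commit (view : ℤ) (s : Slot f) (sender : Replica f) (val : Value f Req)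
  | viewChange (vc : ViewChange f Req)
  | newView (nv : NewView f Req)
  | queryExec (s : Slot f) (sender : Replica f)
  | exec (s : Slot f) (sender : Replica f) (dest : Replica f) (o : Outcome f Req)
  | reply (r : Req) (sender : Replica f)

/-- The replicas a message is addressed to: everything is broadcast to all replicas, except for
the answers to queries and the replies to clients. -/
def Msg.AddressedTo {f : ℕ} {Req : Type u} (m : Msg f Req) (j : Replica f) : Prop :=
  match m with
  | .exec _ _ dest _ => j = dest
  | .reply _ _ => False
  | _ => True

/-! ### Validity of messages -/

/-- Coordinator of view `v` of slot `s`: `(s.co + max 0 v) mod N`. -/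
def viewCoordinator {f : ℕ} (s : Slot f) (v : ℤ) : Replica f :=
  ⟨(s.co.val + v.toNat) % (3 * f + 1), Nat.mod_lt _ (Nat.succ_pos _)⟩

/-- Every dependency in the `DepVerify`s is reported by at least `f + 1` followers. -/
def FastMatch {f : ℕ} {Req : Type u} (v : Verifies f Req) : Prop :=
  ∀ k n, (∃ j dv, v j = some dv ∧ dv.deps k = some n) →
    ∃ K : Finset (Replica f), f + 1 ≤ K.card ∧
      ∀ j ∈ K, ∃ dv, v j = some dv ∧ dv.deps k = some n

/-- `dp` is a proposal for slot `s` with a valid quorum, and `v` consists of one matching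
`DepVerify` of every member of this quorum. -/
def Verified {f : ℕ} {Req : Type u} (s : Slot f) (dp : DepPropose f Req) (v : Verifies f Req) :
    Prop :=
  dp.slot = s ∧ IsQuorum s.co dp.quorum ∧
    (∀ j, v j ≠ none ↔ j ∈ dp.quorum) ∧
    ∀ j dv, v j = some dv → dv.slot = s ∧ dv.sender = j ∧ dv.dp = dp

def Cert.Valid {f : ℕ} {Req : Type u} (s : Slot f) : Cert f Req → Prop
  | .fpc dp dv => Verified s dp dv ∧ FastMatch dv
  | .rpc val view signers =>
      (∀ dp dv, val = some (dp, dv) → Verified s dp dv) ∧ -1 ≤ view ∧ 2 * f + 1 ≤ signers.card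

def ViewChange.Valid {f : ℕ} {Req : Type u} (vc : ViewChange f Req) : Prop :=
  0 ≤ vc.view ∧ ∀ c, vc.cert = some c → c.Valid vc.slot

/-- The result of a view change: the value of a reconciliation-path certificate of the highest
view, else that of a fast-path certificate, else the no-op. -/
def Selects {f : ℕ} {Req : Type u} (vcs : Replica f → Option (ViewChange f Req))
    (val : Value f Req) : Prop :=
  (∃ k vc view K, vcs k = some vc ∧ vc.cert = some (.rpc val view K) ∧
    ∀ k' vc' val' view' K', vcs k' = some vc' → vc'.cert = some (.rpc val' view' K') →
      view' ≤ view) ∨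
  ((∀ k vc val' view K, vcs k = some vc → vc.cert ≠ some (.rpc val' view K)) ∧
    ∃ k vc dp dv, vcs k = some vc ∧ vc.cert = some (.fpc dp dv) ∧ val = some (dp, dv)) ∨
  ((∀ k vc, vcs k = some vc → vc.cert = none) ∧ val = none)

def NewView.Valid {f : ℕ} {Req : Type u} (nv : NewView f Req) : Prop :=
  0 ≤ nv.view ∧ nv.sender = viewCoordinator nv.slot nv.view ∧
    (∃ K : Finset (Replica f), 2 * f + 1 ≤ K.card ∧ ∀ k ∈ K, nv.vcs k ≠ none) ∧
    (∀ k vc, nv.vcs k = some vc →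
      vc.sender = k ∧ vc.slot = nv.slot ∧ vc.view = nv.view ∧ vc.Valid) ∧
    Selects nv.vcs nv.val

/-! ### Local state of a replica -/

inductive Phase where
  | init | proposed | fpVerified | fpCommitted | rpVerified | rpPrepared | rpCommitted | viewChange

/-- State of a replica for one slot. A timer is `none` when it is not running, and otherwise its
expiry time. `hasReq` says that the full request of the proposal `p` is known. -/
structure SlotState (f : ℕ) (Req : Type u) where
  p : Option (DepPropose f Req)
  hasReq : Bool
  v : Verifies f Req
  phase : Phase
  view : ℤ
  cert : Option (Cert f Req)
  exec : Option (Outcome f Req)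
  proposeTimer : Option ℝ
  commitTimer : Option ℝ
  vcTimer : Option ℝ
  queryTimer : Option ℝ

def SlotState.initial (f : ℕ) (Req : Type u) : SlotState f Req where
  p := none
  hasReq := false
  v := fun _ => none
  phase := .init
  view := -1
  cert := none
  exec := none
  proposeTimer := none
  commitTimer := none
  vcTimer := none
  queryTimer := none

def SlotState.value {f : ℕ} {Req : Type u} (ss : SlotState f Req) : Value f Req :=
  ss.p.map fun dp => (dp, ss.v)

/-- The proposal with the union of the dependencies in the `DepPropose` and the `DepVerify`s. -/
def SlotState.outcome {f : ℕ} {Req : Type u} (ss : SlotState f Req) : Outcome f Req :=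
  ss.p.map fun dp =>
    (dp, {d | dp.deps d.co = some d.seq ∨ ∃ j dv, ss.v j = some dv ∧ dv.deps d.co = some d.seq})

/-- State of a replica. `own n` is the request the replica has proposed in its own slot `n`,
`attempts r` counts how often it has proposed `r`, `reproposed` are the own slots that were filled
with a no-op and whose request has already been proposed again. -/
structure LocalState (f : ℕ) (Req : Type u) where
  slots : Slot f → SlotState f Req
  sent : Set (Msg f Req)
  rcvd : Set (Msg f Req)
  nextSeq : ℕ
  own : ℕ → Option Req
  attempts : Req → ℕ
  reproposed : Set ℕ

def LocalState.initial (f : ℕ) (Req : Type u) : LocalState f Req where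
  slots := fun _ => SlotState.initial f Req
  sent := ∅
  rcvd := ∅
  nextSeq := 0
  own := fun _ => none
  attempts := fun _ => 0
  reproposed := ∅

namespace LocalState

variable {f : ℕ} {Req : Type u}

def setSlot (st : LocalState f Req) (s : Slot f) (ss : SlotState f Req) : LocalState f Req :=
  { st with slots := Function.update st.slots s ss }

/-- Replica `i` sends the messages `M`; those addressed to `i` itself arrive at once. -/
def emit (st : LocalState f Req) (i : Replica f) (M : Set (Msg f Req)) : LocalState f Req :=
  { st with
    sent := st.sent ∪ M
    rcvd := st.rcvd ∪ {m | m ∈ M ∧ m.AddressedTo i} }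

/-- `f + 1` `DepVerify`s of different replicas have been received for slot `d`. -/
def ManyVerifies (st : LocalState f Req) (d : Slot f) : Prop :=
  ∃ K : Finset (Replica f), f + 1 ≤ K.card ∧
    ∀ k ∈ K, ∃ dv, Msg.depVerify dv ∈ st.rcvd ∧ dv.slot = d ∧ dv.sender = k

/-- At least `q` replicas are known to have reached view `w` or a higher view of slot `s`. -/
def Reached (st : LocalState f Req) (s : Slot f) (w : ℤ) (q : ℕ) : Prop :=
  ∃ K : Finset (Replica f), q ≤ K.card ∧
    ∀ k ∈ K, ∃ vc, Msg.viewChange vc ∈ st.rcvd ∧ vc.Valid ∧ vc.slot = s ∧ vc.sender = k ∧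
      w ≤ vc.view

/-- The condition under which `wait` lets slot `d` pass as a dependency: `f + 1` `DepVerify`s or
`f + 1` `ViewChange`s have been received for `d`, a `DepPropose` has been accepted for `d`, or a
view change has been triggered for `d`. -/
def Accepts (st : LocalState f Req) (d : Slot f) : Prop :=
  st.ManyVerifies d ∨ st.Reached d 0 (f + 1) ∨ (st.slots d).p ≠ none ∨ 0 ≤ (st.slots d).view

def AcceptsAll (st : LocalState f Req) (D : Deps f) : Prop :=
  ∀ k n, D k = some n → st.Accepts ⟨k, n⟩

/-- Dependencies of `r` with respect to all known requests, in compact form. -/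
def conflicts (P : Params f Req) (st : LocalState f Req) (r : Req) : Deps f := fun k =>
  let S : Set ℕ := {n | (st.slots ⟨k, n⟩).hasReq = true ∧
    ∃ dp, (st.slots ⟨k, n⟩).p = some dp ∧ P.conflict dp.req r}
  if S.Nonempty then some (sSup S) else none

/-- Replica `i` proposes `r` at time `now` in its next free slot. -/
def propose (P : Params f Req) (i : Replica f) (now : ℝ) (st : LocalState f Req) (r : Req) :
    LocalState f Req :=
  let s : Slot f := ⟨i, st.nextSeq⟩
  let dp : DepPropose f Req := ⟨s, r, st.conflicts P r, P.rotation i (st.attempts r)⟩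
  ({ st with
      nextSeq := st.nextSeq + 1
      own := Function.update st.own st.nextSeq (some r)
      attempts := Function.update st.attempts r (st.attempts r + 1) }.setSlot s
    { st.slots s with
      p := some dp
      hasReq := true
      phase := .proposed
      commitTimer := some (now + 9 * P.delta) }).emit i {Msg.depPropose dp true}

/-- The newest certificate for slot `s`. -/
def newestCert (st : LocalState f Req) (s : Slot f) : Option (Cert f Req) :=
  match (st.slots s).phase with
  | .fpVerified | .fpCommitted => (st.slots s).p.map fun dp => .fpc dp (st.slots s).v
  | .rpPrepared | .rpCommitted =>
      some (.rpc (st.slots s).value (st.slots s).view (Finset.univ.filter fun k =>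
        Msg.prepare (st.slots s).view s k (st.slots s).value ∈ st.rcvd))
  | _ => (st.slots s).cert

/-- Replica `i` starts a view change to view `w` of slot `s` at time `now`. If the propose timer
is still running, the `DepPropose` is forwarded. -/
def enterView (P : Params f Req) (i : Replica f) (now : ℝ) (st : LocalState f Req) (s : Slot f)
    (w : ℤ) : LocalState f Req :=
  let ss := st.slots s
  (st.setSlot s
    { ss with
      view := w
      phase := .viewChange
      cert := st.newestCert s
      proposeTimer := none
      commitTimer := none
      vcTimer := none
      queryTimer := if ss.exec = none then some (now + 4 * P.delta) else none }).emit i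
    ({.viewChange ⟨w, s, i, st.newestCert s⟩} ∪
      {m | ss.proposeTimer ≠ none ∧ ∃ dp, ss.p = some dp ∧ m = Msg.depPropose dp false})

end LocalState

/-! ### The protocol -/

/-- `Rule P i now st st'`: at time `now`, the correct replica `i` can make the protocol step from
`st` to `st'`. Rules are executed without delay as soon as they are enabled, see `Step`. -/
inductive Rule {f : ℕ} {Req : Type u} (P : Params f Req) (i : Replica f) (now : ℝ)
    (st : LocalState f Req) : LocalState f Req → Prop
  /-- A new client request is proposed (duplicates are ignored). -/
  | propose (r : Req) (hm : Msg.request r ∈ st.rcvd) (hs : P.signed r)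
      (hnew : st.attempts r = 0)
      (hdup : ∀ s dp D, (st.slots s).exec = some (some (dp, D)) → dp.req ≠ r) :
      Rule P i now st (st.propose P i now r)
  /-- A request that was replaced by a no-op is proposed again, with the next quorum. -/
  | repropose (n : ℕ) (r : Req) (ho : st.own n = some r)
      (hnull : (st.slots ⟨i, n⟩).exec = some none) (hn : n ∉ st.reproposed) :
      Rule P i now st ({ st with reproposed := insert n st.reproposed }.propose P i now r)
  /-- A follower accepts a `DepPropose` after waiting for its dependencies and for the previous
  slot of the coordinator. -/
  | acceptPropose (dp : DepPropose f Req) (b : Bool) (hm : Msg.depPropose dp b ∈ st.rcvd)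
      (hF : IsQuorum dp.slot.co dp.quorum) (hview : (st.slots dp.slot).view = -1)
      (hp : (st.slots dp.slot).p = none) (hwait : st.AcceptsAll dp.deps)
      (hprev : ∀ n, dp.slot.seq = n + 1 → st.Accepts ⟨dp.slot.co, n⟩) :
      Rule P i now st (st.setSlot dp.slot
        { st.slots dp.slot with
          p := some dp
          proposeTimer := some (now + 2 * P.delta)
          commitTimer := some ((st.slots dp.slot).commitTimer.getD (now + 9 * P.delta)) })
  /-- A follower that also has the request determines the dependencies and, if it belongs to the
  quorum, broadcasts a `DepVerify`. -/
  | acceptRequest (dp : DepPropose f Req) (hm : Msg.depPropose dp true ∈ st.rcvd)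
      (hs : P.signed dp.req) (hview : (st.slots dp.slot).view = -1)
      (hp : (st.slots dp.slot).p = some dp) (hr : (st.slots dp.slot).hasReq = false) :
      Rule P i now st ((st.setSlot dp.slot
        { st.slots dp.slot with hasReq := true, phase := .proposed }).emit i
          {m | i ∈ dp.quorum ∧ m = .depVerify ⟨dp.slot, i, dp, st.conflicts P dp.req⟩})
  /-- The propose timer expires: the `DepPropose` is forwarded to all replicas. -/
  | proposeTimeout (s : Slot f) (dp : DepPropose f Req) (t : ℝ)
      (ht : (st.slots s).proposeTimer = some t) (hnow : t ≤ now) (hp : (st.slots s).p = some dp) :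
      Rule P i now st ((st.setSlot s { st.slots s with proposeTimer := none }).emit i
        {.depPropose dp false})
  /-- A matching `DepVerify` is accepted after waiting for its dependencies. The propose timer is
  stopped when all members of the quorum have been heard. -/
  | acceptVerify (dp : DepPropose f Req) (dv : DepVerify f Req) (hm : Msg.depVerify dv ∈ st.rcvd)
      (hslot : dv.slot = dp.slot) (hdp : dv.dp = dp) (hview : (st.slots dp.slot).view = -1)
      (hp : (st.slots dp.slot).p = some dp) (hF : dv.sender ∈ dp.quorum)
      (hv : (st.slots dp.slot).v dv.sender = none) (hwait : st.AcceptsAll dv.deps) :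
      Rule P i now st (st.setSlot dp.slot
        { st.slots dp.slot with
          v := Function.update (st.slots dp.slot).v dv.sender (some dv)
          proposeTimer :=
            if ∀ j ∈ dp.quorum, Function.update (st.slots dp.slot).v dv.sender (some dv) j ≠ none
            then none else (st.slots dp.slot).proposeTimer })
  /-- Fast path: the `DepVerify`s of the quorum match. -/
  | fpVerify (s : Slot f) (dp : DepPropose f Req) (hph : (st.slots s).phase = .proposed)
      (hp : (st.slots s).p = some dp) (hall : ∀ j ∈ dp.quorum, (st.slots s).v j ≠ none)
      (hfast : FastMatch (st.slots s).v) :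
      Rule P i now st ((st.setSlot s { st.slots s with phase := .fpVerified }).emit i
        {.depCommit s i (st.slots s).value})
  /-- Fast path: the slot commits. -/
  | fpCommit (s : Slot f) (hph : (st.slots s).phase = .fpVerified)
      (hq : ∃ K : Finset (Replica f), 2 * f + 1 ≤ K.card ∧
        ∀ k ∈ K, Msg.depCommit s k (st.slots s).value ∈ st.rcvd) :
      Rule P i now st (st.setSlot s
        { st.slots s with
          phase := .fpCommitted
          commitTimer := none
          exec := some ((st.slots s).exec.getD (st.slots s).outcome) })
  /-- The dependencies diverge: the replica switches to the reconciliation path. -/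
  | rpVerify (s : Slot f) (dp : DepPropose f Req) (hph : (st.slots s).phase = .proposed)
      (hp : (st.slots s).p = some dp) (hall : ∀ j ∈ dp.quorum, (st.slots s).v j ≠ none)
      (hslow : ¬ FastMatch (st.slots s).v) :
      Rule P i now st ((st.setSlot s { st.slots s with phase := .rpVerified }).emit i
        {.prepare (st.slots s).view s i (st.slots s).value})
  /-- Reconciliation path: prepared. -/
  | rpPrepare (s : Slot f) (hph : (st.slots s).phase = .rpVerified)
      (hq : ∃ K : Finset (Replica f), 2 * f + 1 ≤ K.card ∧
        ∀ k ∈ K, Msg.prepare (st.slots s).view s k (st.slots s).value ∈ st.rcvd) :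
      Rule P i now st ((st.setSlot s { st.slots s with phase := .rpPrepared }).emit i
        {.commit (st.slots s).view s i (st.slots s).value})
  /-- Reconciliation path: the slot commits. -/
  | rpCommit (s : Slot f) (hph : (st.slots s).phase = .rpPrepared)
      (hq : ∃ K : Finset (Replica f), 2 * f + 1 ≤ K.card ∧
        ∀ k ∈ K, Msg.commit (st.slots s).view s k (st.slots s).value ∈ st.rcvd) :
      Rule P i now st (st.setSlot s
        { st.slots s with
          phase := .rpCommitted
          commitTimer := none
          exec := some ((st.slots s).exec.getD (st.slots s).outcome) })
  /-- `f + 1` `DepVerify`s show that the slot has been started: the commit timer is started. -/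
  | startCommitTimer (s : Slot f) (hq : st.ManyVerifies s) (hview : (st.slots s).view = -1)
      (hp : (st.slots s).p = none) (ht : (st.slots s).commitTimer = none)
      (he : (st.slots s).exec = none) :
      Rule P i now st (st.setSlot s
        { st.slots s with commitTimer := some (now + 9 * P.delta) })
  /-- The commit timer expires: a view change is triggered. -/
  | commitTimeout (s : Slot f) (t : ℝ) (ht : (st.slots s).commitTimer = some t)
      (hnow : t ≤ now) :
      Rule P i now st (st.enterView P i now s ((st.slots s).view + 1))
  /-- The `f + 1`-highest known view is higher than the own one: the replica moves to it. -/
  | joinView (s : Slot f) (w : ℤ) (hw : IsGreatest {w | st.Reached s w (f + 1)} w)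
      (hlt : (st.slots s).view < w) :
      Rule P i now st (st.enterView P i now s w)
  /-- `2f + 1` replicas have reached the view: the view-change timer is started. -/
  | startVcTimer (s : Slot f) (hph : (st.slots s).phase = .viewChange)
      (ht : (st.slots s).vcTimer = none)
      (hq : st.Reached s (st.slots s).view (2 * f + 1)) :
      Rule P i now st (st.setSlot s
        { st.slots s with vcTimer := some (now + P.vcTimeout), queryTimer := none })
  /-- The view-change timer expires: the next view is tried. -/
  | vcTimeout (s : Slot f) (t : ℝ) (ht : (st.slots s).vcTimer = some t) (hnow : t ≤ now) :
      Rule P i now st (st.enterView P i now s ((st.slots s).view + 1))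
  /-- The coordinator of the view has `2f + 1` `ViewChange`s and broadcasts a `NewView`. -/
  | sendNewView (nv : NewView f Req) (hi : nv.sender = i) (hvalid : nv.Valid)
      (hph : (st.slots nv.slot).phase = .viewChange) (hview : (st.slots nv.slot).view = nv.view)
      (hvcs : ∀ k vc, nv.vcs k = some vc → Msg.viewChange vc ∈ st.rcvd)
      (honce : ∀ nv' : NewView f Req, Msg.newView nv' ∈ st.sent →
        ¬ (nv'.slot = nv.slot ∧ nv'.view = nv.view)) :
      Rule P i now st (st.emit i {.newView nv})
  /-- A valid `NewView` is accepted: the reconciliation path is resumed with its value, with a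
  commit timeout of `3Δ`. -/
  | installView (nv : NewView f Req) (hm : Msg.newView nv ∈ st.rcvd) (hvalid : nv.Valid)
      (hph : (st.slots nv.slot).phase = .viewChange) (hview : (st.slots nv.slot).view = nv.view) :
      Rule P i now st ((st.setSlot nv.slot
        { st.slots nv.slot with
          p := nv.val.map Prod.fst
          hasReq := nv.val.isSome
          v := match nv.val with
            | some (_, dv) => dv
            | none => fun _ => none
          phase := .rpVerified
          vcTimer := none
          queryTimer := none
          commitTimer := some (now + 3 * P.delta) }).emit i
        {.prepare nv.view nv.slot i nv.val})
  /-- The view change does not start in time: the replica asks for the result of the slot. -/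
  | queryTimeout (s : Slot f) (t : ℝ) (ht : (st.slots s).queryTimer = some t) (hnow : t ≤ now) :
      Rule P i now st ((st.setSlot s { st.slots s with queryTimer := none }).emit i
        {.queryExec s i})
  /-- A query is answered (as soon as the result is known). -/
  | answerQuery (s : Slot f) (k : Replica f) (o : Outcome f Req)
      (hm : Msg.queryExec s k ∈ st.rcvd) (he : (st.slots s).exec = some o)
      (honce : Msg.exec s i k o ∉ st.sent) :
      Rule P i now st (st.emit i {.exec s i k o})
  /-- `f + 1` matching answers: the replica learns the result. -/
  | learn (s : Slot f) (o : Outcome f Req) (he : (st.slots s).exec = none)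
      (hq : ∃ K : Finset (Replica f), f + 1 ≤ K.card ∧
        ∀ k ∈ K, Msg.exec s k i o ∈ st.rcvd) :
      Rule P i now st (st.setSlot s
        { st.slots s with exec := some o, commitTimer := none, queryTimer := none })

/-! ### Executions -/

/-- Local states of all replicas; the entries of faulty replicas carry no information. -/
abbrev Config (f : ℕ) (Req : Type u) := Replica f → LocalState f Req

section Executions

variable {f : ℕ} {Req : Type u}

/-- Message `m` can exist as a message signed by `k`: faulty replicas sign anything, the signature
of a correct replica exists only on messages that it has sent. -/
def Signed (faulty : Finset (Replica f)) (c : Config f Req) (k : Replica f) (m : Msg f Req) :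
    Prop :=
  k ∈ faulty ∨ m ∈ (c k).sent

/-- All signatures inside a certificate are genuine. -/
def Cert.Authentic (faulty : Finset (Replica f)) (c : Config f Req) (s : Slot f) :
    Cert f Req → Prop
  | .fpc dp dv =>
      Signed faulty c dp.slot.co (.depPropose dp true) ∧
        ∀ k d, dv k = some d → Signed faulty c d.sender (.depVerify d)
  | .rpc val view signers =>
      (∀ dp dv, val = some (dp, dv) →
        Signed faulty c dp.slot.co (.depPropose dp true) ∧
          ∀ k d, dv k = some d → Signed faulty c d.sender (.depVerify d)) ∧
        ∀ k ∈ signers, Signed faulty c k (.prepare view s k val)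

def ViewChange.Authentic (faulty : Finset (Replica f)) (c : Config f Req)
    (vc : ViewChange f Req) : Prop :=
  Signed faulty c vc.sender (.viewChange vc) ∧
    ∀ ct, vc.cert = some ct → ct.Authentic faulty c vc.slot

/-- All signatures in a message are genuine. Client requests are not restricted here: any client,
correct or not, may send any request at any time. -/
def Msg.Authentic (faulty : Finset (Replica f)) (c : Config f Req) (m : Msg f Req) : Prop :=
  match m with
  | .request _ => True
  | .depPropose dp _ => Signed faulty c dp.slot.co (.depPropose dp true)
  | .depVerify dv => Signed faulty c dv.sender m
  | .depCommit _ k _ => Signed faulty c k m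
  | .prepare _ _ k _ => Signed faulty c k m
  | .commit _ _ k _ => Signed faulty c k m
  | .viewChange vc => vc.Authentic faulty c
  | .newView nv =>
      Signed faulty c nv.sender m ∧ ∀ k vc, nv.vcs k = some vc → vc.Authentic faulty c
  | .queryExec _ k => Signed faulty c k m
  | .exec _ k _ _ => Signed faulty c k m
  | .reply _ k => Signed faulty c k m

/-- One step of the system, from configuration `c` at time `t` to `c'` at time `t'`. -/
inductive Step (P : Params f Req) (faulty : Finset (Replica f)) :
    ℝ → Config f Req → ℝ → Config f Req → Prop
  /-- A correct replica executes an enabled rule. -/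
  | act (t : ℝ) (c : Config f Req) (i : Replica f) (hi : i ∉ faulty) (st : LocalState f Req)
      (h : Rule P i t (c i) st) :
      Step P faulty t c t (Function.update c i st)
  /-- A message arrives at a correct replica. The network and the faulty replicas may let any
  message with genuine signatures arrive, at any time and any number of times. -/
  | receive (t : ℝ) (c : Config f Req) (i : Replica f) (hi : i ∉ faulty) (m : Msg f Req)
      (h : m.Authentic faulty c) :
      Step P faulty t c t (Function.update c i { c i with rcvd := insert m (c i).rcvd })
  /-- A correct replica replies to a client, which it does only for requests whose result it
  knows to be agreed on (the order of execution is not modelled). -/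
  | reply (t : ℝ) (c : Config f Req) (i : Replica f) (hi : i ∉ faulty) (s : Slot f)
      (dp : DepPropose f Req) (D : Set (Slot f))
      (h : ((c i).slots s).exec = some (some (dp, D))) :
      Step P faulty t c t (Function.update c i ((c i).emit i {.reply dp.req i}))
  /-- Time passes, while no rule of a correct replica is enabled. -/
  | delay (t t' : ℝ) (c : Config f Req) (ht : t ≤ t')
      (h : ∀ i, i ∉ faulty → ∀ x, t ≤ x → x < t' → ∀ st, ¬ Rule P i x (c i) st) :
      Step P faulty t c t' c

/-- A run of the system in which the replicas in `faulty` behave arbitrarily and all others follow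
the protocol. Only finitely many steps happen in bounded time. -/
structure Execution (P : Params f Req) (faulty : Finset (Replica f)) where
  time : ℕ → ℝ
  cfg : ℕ → Config f Req
  init : cfg 0 = fun _ => LocalState.initial f Req
  step : ∀ n, Step P faulty (time n) (cfg n) (time (n + 1)) (cfg (n + 1))
  diverges : Filter.Tendsto time Filter.atTop Filter.atTop

namespace Execution

variable {P : Params f Req} {faulty : Finset (Replica f)}

/-- Reliable point-to-point connections between correct replicas. -/
def Reliable (E : Execution P faulty) : Prop :=
  ∀ i, i ∉ faulty → ∀ j, j ∉ faulty → ∀ n, ∀ m ∈ (E.cfg n i).sent, m.AddressedTo j →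
    ∃ n', m ∈ (E.cfg n' j).rcvd

/-- From time `gst` on, the one-way network delay between correct replicas is below `Δ`. -/
def SynchronousFrom (E : Execution P faulty) (gst : ℝ) : Prop :=
  ∀ i, i ∉ faulty → ∀ j, j ∉ faulty → ∀ n m, gst ≤ E.time n →
    m ∉ (E.cfg n i).sent → m ∈ (E.cfg (n + 1) i).sent → m.AddressedTo j →
      ∃ n', E.time n' < E.time n + P.delta ∧ m ∈ (E.cfg n' j).rcvd

/-- By time `T`, replies to `r` from `f + 1` replicas have been sent. -/
def Answered (E : Execution P faulty) (r : Req) (T : ℝ) : Prop :=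
  ∃ K : Finset (Replica f), f + 1 ≤ K.card ∧
    ∀ k ∈ K, k ∉ faulty → ∃ n, E.time n ≤ T ∧ Msg.reply r k ∈ (E.cfg n k).sent

/-- A correct client issues `r`: at some time `t` it sends the signed request to some replica `i`,
and unless `f + 1` replicas have replied within the client's timeout `τ`, it then sends the request
to all replicas. Messages of the client arrive eventually. -/
def Issued (E : Execution P faulty) (r : Req) : Prop :=
  P.signed r ∧ ∃ (t τ : ℝ) (i : Replica f), 0 ≤ τ ∧
    (i ∉ faulty → ∃ n, t ≤ E.time n ∧ Msg.request r ∈ (E.cfg n i).rcvd) ∧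
    (¬ E.Answered r (t + τ) → ∀ j, j ∉ faulty →
      ∃ n, t + τ ≤ E.time n ∧ Msg.request r ∈ (E.cfg n j).rcvd)

/-- Some slot with request `r` commits: a correct replica has fp-committed or rp-committed it. -/
def Commits (E : Execution P faulty) (r : Req) : Prop :=
  ∃ n, ∃ i, i ∉ faulty ∧ ∃ s dp, ((E.cfg n i).slots s).p = some dp ∧ dp.req = r ∧
    (((E.cfg n i).slots s).phase = .fpCommitted ∨ ((E.cfg n i).slots s).phase = .rpCommitted)

end Execution

end Executions

end

end Isos

namespace Isos

noncomputable section

open scoped Classical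

universe u

variable {f : ℕ} {Req : Type u} {P : Params f Req} {faulty : Finset (Replica f)}

/-! Suppose that `r` never commits. Then no correct replica replies to it, so the client turns to
all replicas and some correct replica proposes `r`. Two facts contradict each other: this replica
proposes `r` over and over, eventually with a late proposal whose quorum consists of `2f` correct
followers (`attempts_unbounded`, `exists_good_proposal`), and such a proposal commits
(`commits_of_proposes`).

Real time enters through two lemmas. Time passes only while no rule is enabled, so the state reached
at the end of any instant enables no rule (`quiet`); every progress argument therefore says that a
replica which had not advanced would have an enabled rule. Moreover there is a time `G` after which
everything that correct replicas have sent by time `T` has arrived before `T + Δ`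
(`exists_deliver`).

Waiting for dependencies costs a bounded time: what one correct replica accepts is accepted by all
of them `3Δ` later (`accepts_spread`). The bound does not add up along chains of dependencies,
because a dependency was started earlier than the proposal that names it, and its clock has been
running since then.

For a late proposal with a correct coordinator and a correct quorum, the slot is untouched when the
proposal is made, so no commit timer expires for `9Δ`. By `3Δ` all correct replicas have accepted
the proposal, by `6Δ` they hold the same `DepVerify`s and hence choose the same path, and either
path takes less than `2Δ` more.

For the repetition, a result of a correct coordinator's slot is the no-op or its own proposal. The
latter would commit `r`, so it suffices that the coordinator learns the result of each of its slots
(`exists_exec`). No correct replica moves beyond a view with a correct coordinator that none of them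
had reached at time `G` (`view_le`), so the views of the slot become constant. A correct replica
that never learns the result then has neither a commit timer nor, in a view change, a view-change
timer running, since these would expire and change the view. Suppose that the coordinator is such a
replica; it has asked for the result. If `f + 1` correct replicas know the result, their answers
coincide and the coordinator learns it. Otherwise at least `f + 1` correct replicas never learn it.
Take one of them whose final view is lowest. In view `-1` the spread of accepted slots makes it
start a commit timer or leave that view. In a higher view the `ViewChange`s of the stuck replicas
draw all correct replicas into at least this view, so its view-change timer starts. Both are
impossible.

That the answers coincide is the safety of a slot (`exec_agree`), proved by quorum intersection: the
certificates quoted in a `NewView` carry every value, or at least every outcome, that can have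
committed before. -/

/-! ### Protocol steps seen from a single slot -/

/-- The slot a message is about; proposals are not assigned to a slot. -/
def Msg.slot? : Msg f Req → Option (Slot f)
  | .request _ => none
  | .depPropose _ _ => none
  | .depVerify dv => some dv.slot
  | .depCommit s _ _ => some s
  | .prepare _ s _ _ => some s
  | .commit _ s _ _ => some s
  | .viewChange vc => some vc.slot
  | .newView nv => some nv.slot
  | .queryExec s _ => some s
  | .exec s _ _ _ => some s
  | .reply _ _ => none

/-- The replica that signs a message. For proposals, which are also forwarded by others, it is
not defined. -/
def Msg.sender? : Msg f Req → Option (Replica f)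
  | .request _ => none
  | .depPropose _ _ => none
  | .depVerify dv => some dv.sender
  | .depCommit _ k _ => some k
  | .prepare _ _ k _ => some k
  | .commit _ _ k _ => some k
  | .viewChange vc => some vc.sender
  | .newView nv => some nv.sender
  | .queryExec _ k => some k
  | .exec _ k _ _ => some k
  | .reply _ k => some k

/-- The slot state after entering view `w`. -/
def LocalState.enterSlot (P : Params f Req) (now : ℝ) (st : LocalState f Req) (s : Slot f)
    (w : ℤ) : SlotState f Req :=
  { st.slots s with
      view := w
      phase := .viewChange
      cert := st.newestCert s
      proposeTimer := none
      commitTimer := none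
      vcTimer := none
      queryTimer := if (st.slots s).exec = none then some (now + 4 * P.delta) else none }

/-- The messages sent on entering view `w`. -/
def LocalState.enterMsgs (i : Replica f) (st : LocalState f Req) (s : Slot f) (w : ℤ) :
    Set (Msg f Req) :=
  {.viewChange ⟨w, s, i, st.newestCert s⟩} ∪
    {m | (st.slots s).proposeTimer ≠ none ∧ ∃ dp, (st.slots s).p = some dp ∧
      m = Msg.depPropose dp false}

/-- `SlotStep P i now st s ss' M`: at time `now`, replica `i` in state `st` can execute a rule
that changes the state of slot `s` to `ss'` and sends the messages `M`. -/
inductive SlotStep (P : Params f Req) (i : Replica f) (now : ℝ) (st : LocalState f Req)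
    (s : Slot f) : SlotState f Req → Set (Msg f Req) → Prop
  | propose (r : Req) (hco : s.co = i) (hseq : s.seq = st.nextSeq) :
      SlotStep P i now st s
        { st.slots s with
          p := some ⟨s, r, st.conflicts P r, P.rotation i (st.attempts r)⟩
          hasReq := true
          phase := .proposed
          commitTimer := some (now + 9 * P.delta) }
        {Msg.depPropose ⟨s, r, st.conflicts P r, P.rotation i (st.attempts r)⟩ true}
  | acceptPropose (dp : DepPropose f Req) (b : Bool) (hs : dp.slot = s)
      (hm : Msg.depPropose dp b ∈ st.rcvd)
      (hF : IsQuorum s.co dp.quorum) (hview : (st.slots s).view = -1)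
      (hp : (st.slots s).p = none) (hwait : st.AcceptsAll dp.deps)
      (hprev : ∀ n, s.seq = n + 1 → st.Accepts ⟨s.co, n⟩) :
      SlotStep P i now st s
        { st.slots s with
          p := some dp
          proposeTimer := some (now + 2 * P.delta)
          commitTimer := some ((st.slots s).commitTimer.getD (now + 9 * P.delta)) } ∅
  | acceptRequest (dp : DepPropose f Req) (hs : dp.slot = s)
      (hm : Msg.depPropose dp true ∈ st.rcvd)
      (hview : (st.slots s).view = -1)
      (hp : (st.slots s).p = some dp) (hr : (st.slots s).hasReq = false) :
      SlotStep P i now st s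
        { st.slots s with hasReq := true, phase := .proposed }
        {m | i ∈ dp.quorum ∧ m = .depVerify ⟨s, i, dp, st.conflicts P dp.req⟩}
  | proposeTimeout (dp : DepPropose f Req) (t : ℝ)
      (ht : (st.slots s).proposeTimer = some t) (hp : (st.slots s).p = some dp) :
      SlotStep P i now st s { st.slots s with proposeTimer := none } {.depPropose dp false}
  | acceptVerify (dp : DepPropose f Req) (dv : DepVerify f Req)
      (hm : Msg.depVerify dv ∈ st.rcvd) (hs : dp.slot = s)
      (hslot : dv.slot = s) (hdp : dv.dp = dp) (hview : (st.slots s).view = -1)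
      (hp : (st.slots s).p = some dp) (hF : dv.sender ∈ dp.quorum)
      (hv : (st.slots s).v dv.sender = none) (hwait : st.AcceptsAll dv.deps) :
      SlotStep P i now st s
        { st.slots s with
          v := Function.update (st.slots s).v dv.sender (some dv)
          proposeTimer :=
            if ∀ j ∈ dp.quorum, Function.update (st.slots s).v dv.sender (some dv) j ≠ none
            then none else (st.slots s).proposeTimer } ∅
  | fpVerify (dp : DepPropose f Req) (hph : (st.slots s).phase = .proposed)
      (hp : (st.slots s).p = some dp) (hall : ∀ j ∈ dp.quorum, (st.slots s).v j ≠ none)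
      (hfast : FastMatch (st.slots s).v) :
      SlotStep P i now st s { st.slots s with phase := .fpVerified }
        {.depCommit s i (st.slots s).value}
  | fpCommit (hph : (st.slots s).phase = .fpVerified)
      (hq : ∃ K : Finset (Replica f), 2 * f + 1 ≤ K.card ∧
        ∀ k ∈ K, Msg.depCommit s k (st.slots s).value ∈ st.rcvd) :
      SlotStep P i now st s
        { st.slots s with
          phase := .fpCommitted
          commitTimer := none
          exec := some ((st.slots s).exec.getD (st.slots s).outcome) } ∅
  | rpVerify (dp : DepPropose f Req) (hph : (st.slots s).phase = .proposed)
      (hp : (st.slots s).p = some dp) (hall : ∀ j ∈ dp.quorum, (st.slots s).v j ≠ none)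
      (hslow : ¬ FastMatch (st.slots s).v) :
      SlotStep P i now st s { st.slots s with phase := .rpVerified }
        {.prepare (st.slots s).view s i (st.slots s).value}
  | rpPrepare (hph : (st.slots s).phase = .rpVerified)
      (hq : ∃ K : Finset (Replica f), 2 * f + 1 ≤ K.card ∧
        ∀ k ∈ K, Msg.prepare (st.slots s).view s k (st.slots s).value ∈ st.rcvd) :
      SlotStep P i now st s { st.slots s with phase := .rpPrepared }
        {.commit (st.slots s).view s i (st.slots s).value}
  | rpCommit (hph : (st.slots s).phase = .rpPrepared)
      (hq : ∃ K : Finset (Replica f), 2 * f + 1 ≤ K.card ∧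
        ∀ k ∈ K, Msg.commit (st.slots s).view s k (st.slots s).value ∈ st.rcvd) :
      SlotStep P i now st s
        { st.slots s with
          phase := .rpCommitted
          commitTimer := none
          exec := some ((st.slots s).exec.getD (st.slots s).outcome) } ∅
  | startCommitTimer (hq : st.ManyVerifies s) (hview : (st.slots s).view = -1)
      (hp : (st.slots s).p = none) (ht : (st.slots s).commitTimer = none)
      (he : (st.slots s).exec = none) :
      SlotStep P i now st s { st.slots s with commitTimer := some (now + 9 * P.delta) } ∅
  | commitTimeout (t : ℝ) (ht : (st.slots s).commitTimer = some t) (hnow : t ≤ now) :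
      SlotStep P i now st s (st.enterSlot P now s ((st.slots s).view + 1))
        (st.enterMsgs i s ((st.slots s).view + 1))
  | joinView (w : ℤ) (hw : st.Reached s w (f + 1)) (hlt : (st.slots s).view < w) :
      SlotStep P i now st s (st.enterSlot P now s w) (st.enterMsgs i s w)
  | startVcTimer (hph : (st.slots s).phase = .viewChange)
      (ht : (st.slots s).vcTimer = none)
      (hq : st.Reached s (st.slots s).view (2 * f + 1)) :
      SlotStep P i now st s
        { st.slots s with vcTimer := some (now + P.vcTimeout), queryTimer := none } ∅
  | vcTimeout (t : ℝ) (ht : (st.slots s).vcTimer = some t) (hnow : t ≤ now) :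
      SlotStep P i now st s (st.enterSlot P now s ((st.slots s).view + 1))
        (st.enterMsgs i s ((st.slots s).view + 1))
  | sendNewView (nv : NewView f Req) (hs : nv.slot = s) (hi : nv.sender = i) (hvalid : nv.Valid)
      (hph : (st.slots s).phase = .viewChange) (hview : (st.slots s).view = nv.view)
      (hvcs : ∀ k vc, nv.vcs k = some vc → Msg.viewChange vc ∈ st.rcvd)
      (honce : ∀ nv' : NewView f Req, Msg.newView nv' ∈ st.sent →
        ¬ (nv'.slot = s ∧ nv'.view = nv.view)) :
      SlotStep P i now st s (st.slots s) {.newView nv}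
  | installView (nv : NewView f Req) (hs : nv.slot = s) (hm : Msg.newView nv ∈ st.rcvd)
      (hvalid : nv.Valid)
      (hph : (st.slots s).phase = .viewChange) (hview : (st.slots s).view = nv.view) :
      SlotStep P i now st s
        { st.slots s with
          p := nv.val.map Prod.fst
          hasReq := nv.val.isSome
          v := match nv.val with
            | some (_, dv) => dv
            | none => fun _ => none
          phase := .rpVerified
          vcTimer := none
          queryTimer := none
          commitTimer := some (now + 3 * P.delta) }
        {.prepare nv.view s i nv.val}
  | queryTimeout (t : ℝ) (ht : (st.slots s).queryTimer = some t) (hnow : t ≤ now) :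
      SlotStep P i now st s { st.slots s with queryTimer := none } {.queryExec s i}
  | answerQuery (k : Replica f) (o : Outcome f Req)
      (hm : Msg.queryExec s k ∈ st.rcvd) (he : (st.slots s).exec = some o) :
      SlotStep P i now st s (st.slots s) {.exec s i k o}
  | learn (o : Outcome f Req) (he : (st.slots s).exec = none)
      (hq : ∃ K : Finset (Replica f), f + 1 ≤ K.card ∧
        ∀ k ∈ K, Msg.exec s k i o ∈ st.rcvd) :
      SlotStep P i now st s
        { st.slots s with exec := some o, commitTimer := none, queryTimer := none } ∅

/-- The part of `st` that concerns slot `s` is changed to `ss'`, and `M` is sent. -/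
structure SlotEffect (i : Replica f) (st st' : LocalState f Req) (s : Slot f)
    (ss' : SlotState f Req) (M : Set (Msg f Req)) : Prop where
  slots : st'.slots = Function.update st.slots s ss'
  sent : st'.sent = st.sent ∪ M
  rcvd : st'.rcvd = st.rcvd ∪ {m | m ∈ M ∧ m.AddressedTo i}
  nextSeq_le : st.nextSeq ≤ st'.nextSeq
  nextSeq_lt : ∀ dp, Msg.depPropose dp true ∈ M → st'.nextSeq = st.nextSeq + 1
  nextSeq_eq : (∀ dp, Msg.depPropose dp true ∉ M) → st'.nextSeq = st.nextSeq

theorem SlotEffect.of_emit {i : Replica f} {st : LocalState f Req} (s : Slot f)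
    (ss' : SlotState f Req) (M : Set (Msg f Req)) (hM : ∀ dp, Msg.depPropose dp true ∉ M) :
    SlotEffect i st ((st.setSlot s ss').emit i M) s ss' M :=
  ⟨rfl, rfl, rfl, le_rfl, fun dp h => (hM dp h).elim, fun _ => rfl⟩

theorem SlotEffect.of_setSlot {i : Replica f} {st : LocalState f Req} (s : Slot f)
    (ss' : SlotState f Req) : SlotEffect i st (st.setSlot s ss') s ss' ∅ :=
  ⟨rfl, by simp [LocalState.setSlot], by simp [LocalState.setSlot], le_rfl, by simp,
    fun _ => rfl⟩

theorem SlotEffect.of_emit_only {i : Replica f} {st : LocalState f Req} (s : Slot f)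
    (M : Set (Msg f Req)) (hM : ∀ dp, Msg.depPropose dp true ∉ M) :
    SlotEffect i st (st.emit i M) s (st.slots s) M :=
  ⟨by simp [LocalState.emit], rfl, rfl, le_rfl, fun dp h => (hM dp h).elim, fun _ => rfl⟩

/-- Each rule concerns exactly one slot. Both ways of proposing become the same `SlotStep`, and
guards that no invariant needs are dropped, so that the invariants below can be checked by one case
analysis on the slot alone. -/
theorem Rule.slotStep {i : Replica f} {now : ℝ} {st st' : LocalState f Req}
    (h : Rule P i now st st') :
    ∃ s ss' M, SlotStep P i now st s ss' M ∧ SlotEffect i st st' s ss' M := by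
  cases h with
  | propose r =>
    exact ⟨_, _, _, .propose (s := ⟨i, st.nextSeq⟩) r rfl rfl, rfl, rfl, rfl, Nat.le_succ _,
      fun _ _ => rfl, fun h => (h _ rfl).elim⟩
  | repropose n r =>
    exact ⟨_, _, _, .propose (s := ⟨i, st.nextSeq⟩) r rfl rfl, rfl, rfl, rfl, Nat.le_succ _,
      fun _ _ => rfl, fun h => (h _ rfl).elim⟩
  | acceptPropose dp b hm hF hview hp hwait hprev =>
    exact ⟨_, _, _, .acceptPropose dp b rfl hm hF hview hp hwait hprev, .of_setSlot _ _⟩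
  | acceptRequest dp hm hs hview hp hr =>
    exact ⟨_, _, _, .acceptRequest dp rfl hm hview hp hr, .of_emit _ _ _ (by simp)⟩
  | proposeTimeout s dp t ht hnow hp =>
    exact ⟨_, _, _, .proposeTimeout dp t ht hp, .of_emit _ _ _ (by simp)⟩
  | acceptVerify dp dv hm hslot hdp hview hp hF hv hwait =>
    exact ⟨_, _, _, .acceptVerify dp dv hm rfl hslot hdp hview hp hF hv hwait, .of_setSlot _ _⟩
  | fpVerify s dp hph hp hall hfast =>
    exact ⟨_, _, _, .fpVerify dp hph hp hall hfast, .of_emit _ _ _ (by simp)⟩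
  | fpCommit s hph hq => exact ⟨_, _, _, .fpCommit hph hq, .of_setSlot _ _⟩
  | rpVerify s dp hph hp hall hslow =>
    exact ⟨_, _, _, .rpVerify dp hph hp hall hslow, .of_emit _ _ _ (by simp)⟩
  | rpPrepare s hph hq => exact ⟨_, _, _, .rpPrepare hph hq, .of_emit _ _ _ (by simp)⟩
  | rpCommit s hph hq => exact ⟨_, _, _, .rpCommit hph hq, .of_setSlot _ _⟩
  | startCommitTimer s hq hview hp ht he =>
    exact ⟨_, _, _, .startCommitTimer hq hview hp ht he, .of_setSlot _ _⟩
  | commitTimeout s t ht hnow =>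
    exact ⟨_, _, _, .commitTimeout t ht hnow, .of_emit _ _ _ (by simp)⟩
  | joinView s w hw hlt =>
    exact ⟨_, _, _, .joinView w hw.1 hlt, .of_emit _ _ _ (by simp)⟩
  | startVcTimer s hph ht hq => exact ⟨_, _, _, .startVcTimer hph ht hq, .of_setSlot _ _⟩
  | vcTimeout s t ht hnow =>
    exact ⟨_, _, _, .vcTimeout t ht hnow, .of_emit _ _ _ (by simp)⟩
  | sendNewView nv hi hvalid hph hview hvcs honce =>
    exact ⟨_, _, _, .sendNewView nv rfl hi hvalid hph hview hvcs honce,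
      .of_emit_only _ _ (by simp)⟩
  | installView nv hm hvalid hph hview =>
    exact ⟨_, _, _, .installView nv rfl hm hvalid hph hview, .of_emit _ _ _ (by simp)⟩
  | queryTimeout s t ht hnow => exact ⟨_, _, _, .queryTimeout t ht hnow, .of_emit _ _ _ (by simp)⟩
  | answerQuery s k o hm he honce =>
    exact ⟨_, _, _, .answerQuery k o hm he, .of_emit_only _ _ (by simp)⟩
  | learn s o he hq => exact ⟨_, _, _, .learn o he hq, .of_setSlot _ _⟩

/-- Every message sent in a step of slot `s` is a proposal or about slot `s`, and it is signed by
the sending replica. -/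
theorem SlotStep.msgs {i : Replica f} {now : ℝ} {st : LocalState f Req} {s : Slot f}
    {ss' : SlotState f Req} {M : Set (Msg f Req)} (h : SlotStep P i now st s ss' M)
    {m : Msg f Req} (hm : m ∈ M) :
    (∃ dp b, m = .depPropose dp b) ∨ (m.slot? = some s ∧ m.sender? = some i) := by
  cases h <;> simp only [Set.mem_singleton_iff, Set.mem_empty_iff_false, Set.mem_ofPred_eq,
    LocalState.enterMsgs, Set.mem_union] at hm <;>
    grind [Msg.slot?, Msg.sender?]

theorem SlotStep.finite {i : Replica f} {now : ℝ} {st : LocalState f Req} {s : Slot f}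
    {ss' : SlotState f Req} {M : Set (Msg f Req)} (h : SlotStep P i now st s ss' M) :
    M.Finite := by
  cases h <;> first
    | exact Set.finite_singleton _
    | exact Set.finite_empty
    | skip
  · exact Set.Subsingleton.finite fun a ha b hb => ha.2.trans hb.2.symm
  all_goals
    refine (Set.finite_singleton _).union (Set.Subsingleton.finite ?_)
    rintro a ⟨-, d, hd, rfl⟩ b ⟨-, d', hd', rfl⟩
    rw [hd] at hd'
    rw [Option.some.inj hd']

/-! ### Steps of executions -/

theorem Step.time_le {t t' : ℝ} {c c' : Config f Req} (h : Step P faulty t c t' c') : t ≤ t' := by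
  cases h <;> first | exact le_rfl | assumption

/-- The effect of a step on a single correct replica. -/
theorem Step.replica {t t' : ℝ} {c c' : Config f Req} (h : Step P faulty t c t' c')
    (i : Replica f) :
    c' i = c i ∨ (t' = t ∧ i ∉ faulty ∧ Rule P i t (c i) (c' i)) ∨
      (∃ m : Msg f Req, m.Authentic faulty c ∧
        c' i = { c i with rcvd := insert m (c i).rcvd }) ∨
      ∃ s dp D, ((c i).slots s).exec = some (some (dp, D)) ∧
        c' i = (c i).emit i {.reply dp.req i} := by
  cases h with
  | act _ j hj st hr =>
    by_cases hij : i = j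
    · subst hij; right; left; simpa using ⟨hj, hr⟩
    · left; simp [hij]
  | receive _ j hj m hm =>
    by_cases hij : i = j
    · subst hij; right; right; left; exact ⟨m, hm, by simp⟩
    · left; simp [hij]
  | reply _ j hj s dp D hx =>
    by_cases hij : i = j
    · subst hij; right; right; right; exact ⟨s, dp, D, hx, by simp⟩
    · left; simp [hij]
  | delay => left; rfl

namespace Execution

variable (E : Execution P faulty)

theorem time_mono : Monotone E.time :=
  monotone_nat_of_le_succ fun n => (E.step n).time_le

/-- What a step does to slot `s` of replica `i`: nothing, or what one of the rules prescribes. -/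
theorem slot_step (n : ℕ) (i : Replica f) (s : Slot f) :
    ((E.cfg (n + 1) i).slots s = (E.cfg n i).slots s ∧
      (E.cfg n i).sent ⊆ (E.cfg (n + 1) i).sent ∧
      (∀ m ∈ (E.cfg (n + 1) i).sent, m ∈ (E.cfg n i).sent ∨ m.slot? ≠ some s) ∧
      (E.cfg n i).rcvd ⊆ (E.cfg (n + 1) i).rcvd) ∨
    ∃ ss' M, E.time (n + 1) = E.time n ∧ i ∉ faulty ∧
      SlotStep P i (E.time n) (E.cfg n i) s ss' M ∧
      (E.cfg (n + 1) i).slots s = ss' ∧ (E.cfg (n + 1) i).sent = (E.cfg n i).sent ∪ M ∧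
      (E.cfg (n + 1) i).rcvd = (E.cfg n i).rcvd ∪ {m | m ∈ M ∧ m.AddressedTo i} := by
  rcases (E.step n).replica i with h | ⟨ht, hi, h⟩ | ⟨m, -, h⟩ | ⟨s', dp, D, -, h⟩
  · left; rw [h]; exact ⟨rfl, subset_rfl, fun m hm => .inl hm, subset_rfl⟩
  · obtain ⟨s', ss', M, hs, he⟩ := h.slotStep
    by_cases hss : s = s'
    · subst hss
      right
      exact ⟨ss', M, ht, hi, hs, by simp [he.slots], he.sent, he.rcvd⟩
    · left
      refine ⟨by simp [he.slots, hss], by simp [he.sent], fun m hm => ?_, by simp [he.rcvd]⟩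
      rw [he.sent] at hm
      refine hm.imp_right fun hm => ?_
      rcases hs.msgs hm with ⟨dp, b, rfl⟩ | ⟨h1, -⟩
      · simp [Msg.slot?]
      · rw [h1]; exact fun h => hss (Option.some.inj h).symm
  · left; rw [h]
    exact ⟨rfl, subset_rfl, fun m hm => .inl hm, Set.subset_insert _ _⟩
  · left; rw [h]
    refine ⟨rfl, Set.subset_union_left, fun m hm => hm.imp_right ?_, Set.subset_union_left⟩
    rintro rfl
    simp [Msg.slot?]

theorem sent_succ (n : ℕ) (i : Replica f) : (E.cfg n i).sent ⊆ (E.cfg (n + 1) i).sent := by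
  rcases (E.step n).replica i with h | ⟨ht, hi, h⟩ | ⟨m, -, h⟩ | ⟨s', dp, D, -, h⟩
  · rw [h]
  · obtain ⟨s', ss', M, hs, he⟩ := h.slotStep
    simp [he.sent]
  · rw [h]
  · rw [h]; exact Set.subset_union_left

theorem rcvd_succ (n : ℕ) (i : Replica f) : (E.cfg n i).rcvd ⊆ (E.cfg (n + 1) i).rcvd := by
  rcases (E.step n).replica i with h | ⟨ht, hi, h⟩ | ⟨m, -, h⟩ | ⟨s', dp, D, -, h⟩
  · rw [h]
  · obtain ⟨s', ss', M, hs, he⟩ := h.slotStep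
    simp [he.rcvd]
  · rw [h]; exact Set.subset_insert _ _
  · rw [h]; exact Set.subset_union_left

theorem sent_mono (i : Replica f) {n n' : ℕ} (h : n ≤ n') :
    (E.cfg n i).sent ⊆ (E.cfg n' i).sent :=
  monotone_nat_of_le_succ (f := fun n => (E.cfg n i).sent) (fun n => E.sent_succ n i) h

theorem rcvd_mono (i : Replica f) {n n' : ℕ} (h : n ≤ n') :
    (E.cfg n i).rcvd ⊆ (E.cfg n' i).rcvd :=
  monotone_nat_of_le_succ (f := fun n => (E.cfg n i).rcvd) (fun n => E.rcvd_succ n i) h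

theorem signed_mono {n n' : ℕ} (h : n ≤ n') {k : Replica f} {m : Msg f Req}
    (hm : Signed faulty (E.cfg n) k m) : Signed faulty (E.cfg n') k m :=
  hm.imp_right fun hm => E.sent_mono k h hm

theorem cfg_zero (i : Replica f) : E.cfg 0 i = LocalState.initial f Req := by
  rw [E.init]

/-- Finiteness allows the individual delivery deadlines to be merged into a single one in
`exists_deliver`. -/
theorem sent_finite (n : ℕ) (i : Replica f) : (E.cfg n i).sent.Finite := by
  induction n with
  | zero => simp [cfg_zero, LocalState.initial]
  | succ n ih =>
    rcases (E.step n).replica i with h | ⟨ht, hi, h⟩ | ⟨m, -, h⟩ | ⟨s', dp, D, -, h⟩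
    · rwa [h]
    · obtain ⟨s', ss', M, hs, he⟩ := h.slotStep
      rw [he.sent]; exact ih.union hs.finite
    · rwa [h]
    · rw [h]; exact ih.union (Set.finite_singleton _)

/-- Finiteness bounds the views a replica has heard of, so that there is a highest one to join. -/
theorem rcvd_finite (n : ℕ) (i : Replica f) : (E.cfg n i).rcvd.Finite := by
  induction n with
  | zero => simp [cfg_zero, LocalState.initial]
  | succ n ih =>
    rcases (E.step n).replica i with h | ⟨ht, hi, h⟩ | ⟨m, -, h⟩ | ⟨s', dp, D, -, h⟩
    · rwa [h]
    · obtain ⟨s', ss', M, hs, he⟩ := h.slotStep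
      rw [he.rcvd]; exact ih.union (hs.finite.subset fun m hm => hm.1)
    · rw [h]; exact ih.insert _
    · rw [h]
      exact ih.union ((Set.finite_singleton _).subset fun m hm => hm.1)

theorem _root_.Isos.Msg.Authentic.signed {m : Msg f Req} {c : Config f Req} {k : Replica f}
    (h : m.Authentic faulty c) (hk : m.sender? = some k) : Signed faulty c k m := by
  cases m <;> simp only [Msg.sender?, reduceCtorEq, Option.some.injEq] at hk <;> subst hk <;>
    simp only [Msg.Authentic, ViewChange.Authentic] at h <;> grind

/-- Signatures of correct replicas stem from messages they have sent. -/
theorem signed_of_rcvd {n : ℕ} {i k : Replica f} {m : Msg f Req} (hm : m ∈ (E.cfg n i).rcvd)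
    (hk : m.sender? = some k) : Signed faulty (E.cfg n) k m := by
  induction n generalizing m k with
  | zero => simp [cfg_zero, LocalState.initial] at hm
  | succ n ih =>
    rcases (E.step n).replica i with h | ⟨ht, hi, h⟩ | ⟨m', hm', h⟩ | ⟨s', dp, D, -, h⟩
    · rw [h] at hm; exact E.signed_mono n.le_succ (ih hm hk)
    · obtain ⟨s', ss', M, hs, he⟩ := h.slotStep
      rw [he.rcvd] at hm
      rcases hm with hm | ⟨hm, -⟩
      · exact E.signed_mono n.le_succ (ih hm hk)
      · rcases hs.msgs hm with ⟨dp, b, rfl⟩ | ⟨-, h2⟩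
        · simp [Msg.sender?] at hk
        · rw [h2] at hk
          obtain rfl := Option.some.inj hk
          right; rw [he.sent]; exact .inr hm
    · rw [h] at hm
      rcases hm with rfl | hm
      · exact E.signed_mono n.le_succ (hm'.signed hk)
      · exact E.signed_mono n.le_succ (ih hm hk)
    · rw [h] at hm
      rcases hm with hm | ⟨hm, -⟩
      · exact E.signed_mono n.le_succ (ih hm hk)
      · obtain rfl : m = _ := hm
        obtain rfl := Option.some.inj hk
        right; rw [h]; exact .inr rfl

/-- The form in which unforgeability is used: pick a correct member of a quorum of received
messages, and argue about its own state. -/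
theorem sent_of_rcvd {n : ℕ} {i k : Replica f} {m : Msg f Req} (hm : m ∈ (E.cfg n i).rcvd)
    (hk : m.sender? = some k) (hkf : k ∉ faulty) : m ∈ (E.cfg n k).sent :=
  (E.signed_of_rcvd hm hk).resolve_left hkf

/-! ### The state at a real time -/

/-- The last index whose time is at most `T`. -/
def idx (T : ℝ) : ℕ := Nat.find (p := fun n => T < E.time (n + 1)) <| by
  obtain ⟨n, hn⟩ := (E.diverges.eventually_gt_atTop T).exists
  exact ⟨n, hn.trans_le (E.time_mono n.le_succ)⟩

theorem lt_time_idx_succ (T : ℝ) : T < E.time (E.idx T + 1) :=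
  Nat.find_spec (p := fun n => T < E.time (n + 1)) _

theorem le_idx {T : ℝ} {n : ℕ} (h : E.time n ≤ T) : n ≤ E.idx T := by
  by_contra! hn
  exact absurd (h.trans_lt (E.lt_time_idx_succ T)) (not_lt.2 (E.time_mono hn))

theorem time_idx_le {T : ℝ} (h0 : E.time 0 ≤ T) : E.time (E.idx T) ≤ T := by
  rcases Nat.eq_zero_or_pos (E.idx T) with h | h
  · rwa [h]
  · have := Nat.find_min (p := fun n => T < E.time (n + 1)) _ (Nat.sub_lt h one_pos)
    have h' : E.idx T - 1 + 1 = E.idx T := Nat.sub_add_cancel h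
    rw [← h']
    exact not_lt.1 this

theorem idx_mono {T T' : ℝ} (h : T ≤ T') : E.idx T ≤ E.idx T' := by
  by_contra! hn
  have := Nat.find_min (p := fun n => T < E.time (n + 1)) _ hn
  exact this (h.trans_lt (E.lt_time_idx_succ T'))

theorem idx_lt {T : ℝ} (h0 : E.time 0 ≤ T) {n : ℕ} (h : T < E.time n) : E.idx T < n := by
  by_contra! hn
  exact absurd (h.trans_le (E.time_mono hn)) (not_lt.2 (E.time_idx_le h0))

/-- After all steps at a time, no rule is enabled. -/
theorem quiet {T : ℝ} (h0 : E.time 0 ≤ T) {i : Replica f} (hi : i ∉ faulty)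
    (st : LocalState f Req) : ¬ Rule P i T (E.cfg (E.idx T) i) st := by
  have h1 := E.time_idx_le h0
  have h2 := E.lt_time_idx_succ T
  have h3 := E.step (E.idx T)
  generalize E.time (E.idx T) = t at *
  generalize E.time (E.idx T + 1) = t' at *
  generalize E.cfg (E.idx T) = c at *
  generalize E.cfg (E.idx T + 1) = c' at *
  -- The time jumps strictly beyond `T` in this step, so it is a `delay`, and its guard covers the
  -- instant `T`.
  cases h3 with
  | delay _ _ _ h => exact h i hi T h1 h2 st
  | act => exact absurd h2 (not_lt.2 h1)
  | receive => exact absurd h2 (not_lt.2 h1)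
  | reply => exact absurd h2 (not_lt.2 h1)

/-- After some time, messages between correct replicas are delivered within less than `Δ`. -/
theorem exists_deliver (hdelta : 0 < P.delta) (hrel : E.Reliable) {gst : ℝ}
    (hs : E.SynchronousFrom gst) :
    ∃ G, E.time 0 ≤ G ∧ ∀ T, G ≤ T → ∃ T', T ≤ T' ∧ T' < T + P.delta ∧
      ∀ i, i ∉ faulty → ∀ j, j ∉ faulty → ∀ m ∈ (E.cfg (E.idx T) i).sent, m.AddressedTo j →
        m ∈ (E.cfg (E.idx T') j).rcvd := by
  -- a common bound for finitely many deliveries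
  have key : ∀ (N : ℕ) (Q : ℝ → Prop) (B : ℝ),
      Q B → (∀ a b, Q a → Q b → Q (max a b)) →
      (∀ i, i ∉ faulty → ∀ j, j ∉ faulty → ∀ m ∈ (E.cfg N i).sent, m.AddressedTo j →
        ∃ n', Q (E.time n') ∧ m ∈ (E.cfg n' j).rcvd) →
      ∃ T', B ≤ T' ∧ Q T' ∧
      ∀ i, i ∉ faulty → ∀ j, j ∉ faulty → ∀ m ∈ (E.cfg N i).sent, m.AddressedTo j →
        m ∈ (E.cfg (E.idx T') j).rcvd := by
    intro N Q B hB hmax h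
    let A : Set (Replica f × Replica f × Msg f Req) :=
      {x | x.1 ∉ faulty ∧ x.2.1 ∉ faulty ∧ x.2.2 ∈ (E.cfg N x.1).sent ∧ x.2.2.AddressedTo x.2.1}
    have hA : A.Finite := by
      refine Set.Finite.subset (s := Set.univ ×ˢ (Set.univ ×ˢ ⋃ i, (E.cfg N i).sent)) ?_ ?_
      · exact Set.finite_univ.prod (Set.finite_univ.prod
          (Set.finite_iUnion fun i => E.sent_finite N i))
      · rintro ⟨i, j, m⟩ ⟨-, -, h, -⟩
        exact ⟨trivial, trivial, Set.mem_iUnion.2 ⟨i, h⟩⟩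
    have : ∀ A' ⊆ A, A'.Finite → ∃ T', B ≤ T' ∧ Q T' ∧
        ∀ x ∈ A', x.2.2 ∈ (E.cfg (E.idx T') x.2.1).rcvd := by
      intro A' hA' hfin
      induction A', hfin using Set.Finite.induction_on with
      | empty => exact ⟨B, le_rfl, hB, by simp⟩
      | @insert a S ha hS ih =>
        obtain ⟨T', h1, h2, h3⟩ := ih ((Set.subset_insert _ _).trans hA')
        obtain ⟨a1, a2, a3, a4⟩ := hA' (Set.mem_insert _ _)
        obtain ⟨n', h4, h5⟩ := h _ a1 _ a2 _ a3 a4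
        refine ⟨max T' (E.time n'), h1.trans (le_max_left _ _), hmax _ _ h2 h4, ?_⟩
        rintro x (rfl | hx)
        · exact E.rcvd_mono _ (E.le_idx (le_max_right _ _)) h5
        · exact E.rcvd_mono _ (E.idx_mono (le_max_left _ _)) (h3 x hx)
    obtain ⟨T', h1, h2, h3⟩ := this A subset_rfl hA
    exact ⟨T', h1, h2, fun i hi j hj m hm ha => h3 (i, j, m) ⟨hi, hj, hm, ha⟩⟩
  -- Messages sent before the synchronous phase have no deadline. By reliability they all arrive at
  -- some time, and `G` is taken after that. The `+ 1` includes the messages sent by the last step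
  -- that starts by `gst`.
  obtain ⟨G, hG, -, hG'⟩ := key (E.idx gst + 1) (fun _ => True) (max gst (E.time 0)) trivial
    (fun _ _ _ _ => trivial)
    (fun i hi j hj m hm ha => (hrel i hi j hj _ m hm ha).imp fun n' h => ⟨trivial, h⟩)
  refine ⟨G, (le_max_right _ _).trans hG, fun T hT => ?_⟩
  obtain ⟨T', h1, h2, h3⟩ := key (E.idx T) (fun x => x < T + P.delta) T (by simpa)
    (fun a b ha hb => max_lt ha hb) (fun i hi j hj m hm ha => by
      classical
      -- Synchrony speaks about the step in which a message is first sent, so the first index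
      -- containing `m` is needed.
      have hex : ∃ n, m ∈ (E.cfg n i).sent := ⟨_, hm⟩
      set n0 := Nat.find hex with hn0
      have hspec := Nat.find_spec hex
      have hle : n0 ≤ E.idx T := Nat.find_min' hex hm
      rw [← hn0] at hspec
      rcases Nat.eq_zero_or_pos n0 with h0 | h0
      · rw [h0, cfg_zero] at hspec; simp [LocalState.initial] at hspec
      · obtain ⟨p, hp⟩ : ∃ p, n0 = p + 1 := ⟨n0 - 1, by omega⟩
        have hnot : m ∉ (E.cfg p i).sent := Nat.find_min hex (by omega)
        rw [hp] at hspec hle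
        have htime : E.time p ≤ T := (E.time_mono (p.le_succ.trans hle)).trans
          (E.time_idx_le ((le_max_right _ _).trans (hG.trans hT)))
        by_cases hg : gst ≤ E.time p
        · obtain ⟨n', h1, h2⟩ := hs i hi j hj p m hg hnot hspec ha
          exact ⟨n', by linarith, h2⟩
        -- An old message: its sending step starts before `gst`, so it has arrived by `G ≤ T`.
        · refine ⟨E.idx G, ?_, hG' i hi j hj m (E.sent_mono i ?_ hspec) ha⟩
          · have := E.time_idx_le ((le_max_right _ _).trans hG)
            show E.time _ < _
            linarith
          · have := E.le_idx (not_le.1 hg).le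
            omega)
  exact ⟨T', h1, h2, h3⟩

end Execution

/-! ### Fresh slots -/

/-- Something has happened in the slot. -/
def SlotState.Touched (ss : SlotState f Req) : Prop :=
  ss.phase ≠ .init ∨ ss.p ≠ none ∨ ss.commitTimer ≠ none ∨ ss.exec ≠ none

theorem SlotState.not_touched_initial : ¬ (SlotState.initial f Req).Touched := by
  simp [SlotState.Touched, SlotState.initial]

/-- The last field makes "nothing has happened" an equality with the initial state, so that a fresh
slot can be rewritten away. The field on the propose timer ensures that a forwarded proposal was
received before, hence is genuine. -/
structure SlotBasic (ss : SlotState f Req) (rcvd : Set (Msg f Req)) : Prop where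
  view_ge : -1 ≤ ss.view
  vc : ss.phase = .viewChange → 0 ≤ ss.view ∧ ss.proposeTimer = none
  timer : ss.proposeTimer ≠ none → ∀ dp, ss.p = some dp → ∃ b, Msg.depPropose dp b ∈ rcvd
  touched : ss = SlotState.initial f Req ∨ ss.Touched

theorem SlotBasic.step {i : Replica f} {now : ℝ} {st : LocalState f Req} {s : Slot f}
    {ss' : SlotState f Req} {M : Set (Msg f Req)} (h : SlotStep P i now st s ss' M)
    (hb : SlotBasic (st.slots s) st.rcvd) :
    SlotBasic ss' (st.rcvd ∪ {m | m ∈ M ∧ m.AddressedTo i}) := by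
  obtain ⟨h1, h2, h3, h4⟩ := hb
  have h5 : st.slots s = SlotState.initial f Req → (st.slots s).phase = .init ∧
    (st.slots s).p = none ∧ (st.slots s).commitTimer = none ∧ (st.slots s).exec = none ∧
    (st.slots s).queryTimer = none ∧ (st.slots s).proposeTimer = none ∧
    (st.slots s).vcTimer = none := by
    intro h; rw [h]; simp [SlotState.initial]
  have h6 : ∀ dp b, (Msg.depPropose dp b : Msg f Req).AddressedTo i := fun _ _ => trivial
  cases h <;> constructor
  case propose.timer => rintro - dp ⟨⟩; exact ⟨true, .inr ⟨rfl, trivial⟩⟩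
  all_goals
    simp only [SlotState.Touched, LocalState.enterSlot, Set.mem_union, Set.mem_ofPred_eq,
      Set.mem_singleton_iff] at *
    grind

/-- Each rule leaves a trace in phase, proposal, commit timer or result, or presupposes one; the
query timer, which is no trace itself, does not run in an initial slot. -/
theorem SlotStep.touched {i : Replica f} {now : ℝ} {st : LocalState f Req} {s : Slot f}
    {ss' : SlotState f Req} {M : Set (Msg f Req)} (h : SlotStep P i now st s ss' M)
    (hb : SlotBasic (st.slots s) st.rcvd) : ss'.Touched := by
  have h4 := hb.touched
  have h5 : st.slots s = SlotState.initial f Req → (st.slots s).queryTimer = none := by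
    intro h; rw [h]; simp [SlotState.initial]
  cases h <;> simp only [SlotState.Touched, LocalState.enterSlot] at * <;> grind

theorem SlotBasic.mono {ss : SlotState f Req} {rcvd rcvd' : Set (Msg f Req)}
    (h : SlotBasic ss rcvd) (hr : rcvd ⊆ rcvd') : SlotBasic ss rcvd' :=
  ⟨h.view_ge, h.vc, fun a b c => (h.timer a b c).imp fun _ h => hr h, h.touched⟩

theorem exists_correct_of_card (hfaulty : faulty.card ≤ f) {K : Finset (Replica f)}
    (hK : f + 1 ≤ K.card) : ∃ k ∈ K, k ∉ faulty := by
  by_contra! h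
  have := Finset.card_le_card (show K ⊆ faulty from h)
  omega

namespace Execution

variable (E : Execution P faulty)

theorem slotBasic (n : ℕ) (i : Replica f) (s : Slot f) :
    SlotBasic ((E.cfg n i).slots s) (E.cfg n i).rcvd := by
  induction n with
  | zero =>
    rw [cfg_zero]
    constructor <;> simp [LocalState.initial, SlotState.initial]
  | succ n ih =>
    rcases E.slot_step n i s with ⟨h1, -, -, h2⟩ | ⟨ss', M, -, -, hs, h1, -, h2⟩
    · rw [h1]; exact ih.mono h2
    · rw [h1, h2]; exact ih.step hs

theorem touched_succ {n : ℕ} {i : Replica f} {s : Slot f}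
    (h : ((E.cfg n i).slots s).Touched) : ((E.cfg (n + 1) i).slots s).Touched := by
  rcases E.slot_step n i s with ⟨h1, -, -, h2⟩ | ⟨ss', M, -, -, hs, h1, -, h2⟩
  · rwa [h1]
  · rw [h1]; exact hs.touched (E.slotBasic n i s)

theorem eq_initial_of_not_touched {n : ℕ} {i : Replica f} {s : Slot f}
    (h : ¬ ((E.cfg n i).slots s).Touched) : (E.cfg n i).slots s = SlotState.initial f Req :=
  (E.slotBasic n i s).touched.resolve_right h

/-- Messages about a slot are sent only after something has happened in the slot. -/
theorem touched_of_sent {n : ℕ} {i : Replica f} {s : Slot f} {m : Msg f Req}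
    (hm : m ∈ (E.cfg n i).sent) (hs : m.slot? = some s) : ((E.cfg n i).slots s).Touched := by
  induction n with
  | zero => simp [cfg_zero, LocalState.initial] at hm
  | succ n ih =>
    rcases E.slot_step n i s with ⟨h1, -, h3, h2⟩ | ⟨ss', M, -, -, hst, h1, h3, h2⟩
    · rw [h1]
      exact ih ((h3 m hm).resolve_right (not_not.2 hs))
    · rw [h1]; exact hst.touched (E.slotBasic n i s)

/-- The first thing that happens in a slot at correct replicas is that a proposal is made or
accepted. -/
theorem first_step (hfaulty : faulty.card ≤ f) {n : ℕ} {i : Replica f} (hi : i ∉ faulty)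
    {s : Slot f}
    (h0 : ∀ k, k ∉ faulty → (E.cfg n k).slots s = SlotState.initial f Req)
    {ss' : SlotState f Req} {M : Set (Msg f Req)}
    (h : SlotStep P i (E.time n) (E.cfg n i) s ss' M) :
    (ss'.p ≠ none ∧ ss'.view = -1) ∧
    ((s.co = i ∧ s.seq = (E.cfg n i).nextSeq ∧ ∃ dp, Msg.depPropose dp true ∈ M) ∨
      ∃ dp b, Msg.depPropose dp b ∈ (E.cfg n i).rcvd ∧ dp.slot = s) := by
  have hi0 := h0 i hi
  -- One of `f + 1` senders is correct, and it sends messages about a slot only after touching it.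
  -- This excludes every rule triggered by other replicas' messages.
  have hno : ∀ K : Finset (Replica f), f + 1 ≤ K.card → ¬ ∀ k ∈ K, ∃ m ∈ (E.cfg n i).rcvd,
      m.slot? = some s ∧ m.sender? = some k := by
    intro K hK hall
    obtain ⟨k, hk, hkf⟩ := exists_correct_of_card hfaulty hK
    obtain ⟨m, hm, hm1, hm2⟩ := hall k hk
    have := E.touched_of_sent (E.sent_of_rcvd hm hm2 hkf) hm1
    rw [h0 k hkf] at this
    exact SlotState.not_touched_initial this
  have e1 : ((E.cfg n i).slots s).phase = .init := by rw [hi0]; rfl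
  have e2 : ((E.cfg n i).slots s).p = none := by rw [hi0]; rfl
  have e3 : ((E.cfg n i).slots s).view = -1 := by rw [hi0]; rfl
  have e4 : ((E.cfg n i).slots s).commitTimer = none := by rw [hi0]; rfl
  have e5 : ((E.cfg n i).slots s).vcTimer = none := by rw [hi0]; rfl
  have e6 : ((E.cfg n i).slots s).queryTimer = none := by rw [hi0]; rfl
  have e7 : ((E.cfg n i).slots s).exec = none := by rw [hi0]; rfl
  cases h with
  | propose r hco hseq => exact ⟨⟨by simp, e3⟩, .inl ⟨hco, hseq, _, rfl⟩⟩
  | acceptPropose dp b hs hm => exact ⟨⟨by simp, e3⟩, .inr ⟨dp, b, hm, hs⟩⟩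
  | startCommitTimer hq =>
    obtain ⟨K, hK, hall⟩ := hq
    refine (hno K hK fun k hk => ?_).elim
    obtain ⟨dv, h1, h2, h3⟩ := hall k hk
    exact ⟨_, h1, by simp [Msg.slot?, h2], by simp [Msg.sender?, h3]⟩
  | joinView w hw =>
    obtain ⟨K, hK, hall⟩ := hw
    refine (hno K hK fun k hk => ?_).elim
    obtain ⟨vc, h1, -, h2, h3, -⟩ := hall k hk
    exact ⟨_, h1, by simp [Msg.slot?, h2], by simp [Msg.sender?, h3]⟩
  | learn o he hq =>
    obtain ⟨K, hK, hall⟩ := hq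
    exact (hno K hK fun k hk => ⟨_, hall k hk, rfl, rfl⟩).elim
  | _ => simp_all

/-- The proposals and slots of correct coordinators: nothing happens in a slot before its
coordinator proposes. -/
structure FreshInv (n : ℕ) : Prop where
  rcvd : ∀ k, k ∉ faulty → ∀ dp b, Msg.depPropose dp b ∈ (E.cfg n k).rcvd →
    Signed faulty (E.cfg n) dp.slot.co (.depPropose dp true)
  sent : ∀ k, ∀ dp, Msg.depPropose dp true ∈ (E.cfg n k).sent →
    dp.slot.co = k ∧ dp.slot.seq < (E.cfg n k).nextSeq
  init : ∀ k, k ∉ faulty → ∀ s : Slot f, s.co ∉ faulty → (E.cfg n s.co).nextSeq ≤ s.seq →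
    (E.cfg n k).slots s = SlotState.initial f Req

theorem nextSeq_succ (n : ℕ) (i : Replica f) :
    (E.cfg n i).nextSeq ≤ (E.cfg (n + 1) i).nextSeq := by
  rcases (E.step n).replica i with h | ⟨ht, hi, h⟩ | ⟨m, -, h⟩ | ⟨s', dp, D, -, h⟩
  · rw [h]
  · obtain ⟨s', ss', M, hs, he⟩ := h.slotStep
    exact he.nextSeq_le
  · rw [h]
  · rw [h]; exact le_rfl

/-- The three clauses support each other: the first event in a slot is a proposal or its acceptance;
an accepted proposal is signed by the coordinator; and a correct coordinator signs proposals only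
below its `nextSeq`. -/
theorem freshInv (hfaulty : faulty.card ≤ f) (n : ℕ) : E.FreshInv n := by
  induction n with
  | zero => constructor <;> simp [cfg_zero, LocalState.initial]
  | succ n ih =>
    obtain ⟨ih1, ih2, ih3⟩ := ih
    have hrep := fun i => (E.step n).replica i
    constructor
    · intro k hk dp b hm
      rcases hrep k with h | ⟨ht, hi, h⟩ | ⟨m, hauth, h⟩ | ⟨s', dp, D, -, h⟩
      · rw [h] at hm; exact E.signed_mono n.le_succ (ih1 k hk dp b hm)
      · obtain ⟨s', ss', M, hs, he⟩ := h.slotStep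
        rw [he.rcvd] at hm
        rcases hm with hm | ⟨hm, -⟩
        · exact E.signed_mono n.le_succ (ih1 k hk dp b hm)
        · have hT := (E.slotBasic n k s').timer
          have hfwd : ((E.cfg n k).slots s').proposeTimer ≠ none →
              ((E.cfg n k).slots s').p = some dp →
              Signed faulty (E.cfg (n + 1)) dp.slot.co (.depPropose dp true) := fun h1 h2 => by
            obtain ⟨b', hb'⟩ := hT h1 dp h2
            exact E.signed_mono n.le_succ (ih1 k hk dp b' hb')
          cases hs with
          | propose r hco hseq =>
            obtain ⟨rfl, rfl⟩ : dp = _ ∧ b = true := by simpa using hm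
            right
            simp only [hco]
            rw [he.sent]; exact .inr rfl
          | _ =>
            simp only [Set.mem_singleton_iff, Set.mem_empty_iff_false, Set.mem_ofPred_eq,
              LocalState.enterMsgs, Set.mem_union] at hm <;> grind
      · rw [h] at hm
        rcases hm with rfl | hm
        · exact E.signed_mono n.le_succ hauth
        · exact E.signed_mono n.le_succ (ih1 k hk dp b hm)
      · rw [h] at hm
        rcases hm with hm | ⟨hm, -⟩
        · exact E.signed_mono n.le_succ (ih1 k hk _ b hm)
        · simp at hm
    · intro k dp hm
      have hold : Msg.depPropose dp true ∈ (E.cfg n k).sent →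
          dp.slot.co = k ∧ dp.slot.seq < (E.cfg (n + 1) k).nextSeq := fun h =>
        ⟨(ih2 k dp h).1, (ih2 k dp h).2.trans_le (E.nextSeq_succ n k)⟩
      rcases hrep k with h | ⟨ht, hi, h⟩ | ⟨m, hauth, h⟩ | ⟨s', dp, D, -, h⟩
      · rw [h] at hm; exact hold hm
      · obtain ⟨s', ss', M, hs, he⟩ := h.slotStep
        rw [he.sent] at hm
        rcases hm with hm | hm
        · exact hold hm
        · rw [he.nextSeq_lt dp hm]
          cases hs with
          | propose r hco hseq =>
            obtain rfl : dp = _ := by simpa using hm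
            exact ⟨hco, by simp [hseq]⟩
          | _ => simp [LocalState.enterMsgs] at hm
      · rw [h] at hm; exact hold hm
      · rw [h] at hm
        rcases hm with hm | hm
        · exact hold hm
        · simp at hm
    · intro k hk s hs hq
      have hq' := (E.nextSeq_succ n s.co).trans hq
      have h0 := fun k hk => ih3 k hk s hs hq'
      rcases hrep k with h | ⟨ht, hi, h⟩ | ⟨m, hauth, h⟩ | ⟨s', dp, D, -, h⟩
      · rw [h]; exact h0 k hk
      · obtain ⟨s', ss', M, hst, he⟩ := h.slotStep
        by_cases hss : s = s'
        · subst hss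
          exfalso
          -- Proposing would push `nextSeq` beyond the slot, and an accepted proposal would have
          -- been sent with a sequence number below it.
          rcases (E.first_step hfaulty hk h0 hst).2 with ⟨h1, h2, dp, h3⟩ | ⟨dp, b, h1, h2⟩
          · have := he.nextSeq_lt dp h3
            rw [h1] at hq; omega
          · have := ih1 k hk dp b h1
            rw [h2] at this
            have := (ih2 _ dp (this.resolve_left hs)).2
            rw [h2] at this; omega
        · rw [he.slots, Function.update_of_ne hss]; exact h0 k hk
      · rw [h]; exact h0 k hk
      · rw [h]; exact h0 k hk

end Execution

/-! ### Local invariants of a slot -/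

/-- How phase, view, proposal and `DepVerify`s of a slot fit together. -/
structure ShapeInv (s : Slot f) (ss : SlotState f Req) (rcvd : Set (Msg f Req)) : Prop where
  no_p : ss.view = -1 → ss.p = none → ss.phase = .init ∧ ∀ j, ss.v j = none
  hasReq : ss.view = -1 → (ss.hasReq = true ↔ ss.phase ≠ .init)
  p_spec : ss.view = -1 → ∀ dp, ss.p = some dp → dp.slot = s ∧ IsQuorum s.co dp.quorum ∧
    ∃ b, Msg.depPropose dp b ∈ rcvd
  v_spec : ss.view = -1 → ∀ j dv, ss.v j = some dv → dv.slot = s ∧ dv.sender = j ∧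
    ss.p = some dv.dp ∧ j ∈ dv.dp.quorum ∧ Msg.depVerify dv ∈ rcvd
  phase_of_nonneg : 0 ≤ ss.view → ss.phase = .viewChange ∨ ss.phase = .rpVerified ∨
    ss.phase = .rpPrepared ∨ ss.phase = .rpCommitted
  fast : ss.phase = .fpVerified ∨ ss.phase = .fpCommitted → ss.view = -1 ∧
    (∃ dp, ss.p = some dp ∧ ∀ j ∈ dp.quorum, ss.v j ≠ none) ∧ FastMatch ss.v
  slow : ss.view = -1 → ss.phase = .rpVerified ∨ ss.phase = .rpPrepared ∨
    ss.phase = .rpCommitted → (∃ dp, ss.p = some dp ∧ ∀ j ∈ dp.quorum, ss.v j ≠ none) ∧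
      ¬ FastMatch ss.v
  installed : 0 ≤ ss.view → ss.phase ≠ .viewChange → ∃ nv : NewView f Req,
    Msg.newView nv ∈ rcvd ∧ nv.Valid ∧ nv.slot = s ∧ nv.view = ss.view ∧ nv.val = ss.value
  prepared : ss.phase = .rpPrepared ∨ ss.phase = .rpCommitted →
    ∃ K : Finset (Replica f), 2 * f + 1 ≤ K.card ∧
      ∀ k ∈ K, Msg.prepare ss.view s k ss.value ∈ rcvd
  committed : ss.phase = .rpCommitted → ∃ K : Finset (Replica f), 2 * f + 1 ≤ K.card ∧
    ∀ k ∈ K, Msg.commit ss.view s k ss.value ∈ rcvd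
  fpCommitted : ss.phase = .fpCommitted → ∃ K : Finset (Replica f), 2 * f + 1 ≤ K.card ∧
    ∀ k ∈ K, Msg.depCommit s k ss.value ∈ rcvd

theorem ShapeInv.mono {s : Slot f} {ss : SlotState f Req} {rcvd rcvd' : Set (Msg f Req)}
    (h : ShapeInv s ss rcvd) (hr : rcvd ⊆ rcvd') : ShapeInv s ss rcvd' := by
  obtain ⟨h1, h2, h3, h4, h5, h6, h7, h8, h9, h10, h11⟩ := h
  refine ⟨h1, h2, ?_, ?_, h5, h6, h7, ?_, ?_, ?_, ?_⟩ <;> grind -ring -linarith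

theorem ShapeInv.initial (s : Slot f) : ShapeInv s (SlotState.initial f Req) ∅ := by
  constructor <;> simp [SlotState.initial]

/-- Proposal and `DepVerify`s are stored separately on installation; reassembling them yields the
value in the `Prepare` that is sent. -/
theorem installed_value (val : Value f Req) :
    Option.map (fun dp => (dp, match val with
            | some (_, dv) => dv
            | none => fun _ => none)) (val.map Prod.fst) = val := by
  rcases val with _ | ⟨dp, dv⟩ <;> rfl

-- Freshness is needed since proposing overwrites a slot without looking at it. The delicate case
-- otherwise is `acceptVerify`, which changes the value of the slot while messages about that value
-- may exist.
set_option maxHeartbeats 2000000 in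
theorem ShapeInv.step (hrot : ∀ i k, IsQuorum i (P.rotation i k)) {i : Replica f} {now : ℝ}
    {st : LocalState f Req} {s : Slot f} {ss' : SlotState f Req} {M : Set (Msg f Req)}
    (h : SlotStep P i now st s ss' M)
    (hfresh : s.co = i → s.seq = st.nextSeq → st.slots s = SlotState.initial f Req)
    (hb : SlotBasic (st.slots s) st.rcvd) (hs : ShapeInv s (st.slots s) st.rcvd) :
    ShapeInv s ss' (st.rcvd ∪ {m | m ∈ M ∧ m.AddressedTo i}) := by
  have hs' := hs.mono (Set.subset_union_left (t := {m | m ∈ M ∧ m.AddressedTo i}))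
  have hb1 := hb.view_ge
  have hb2 := hb.vc
  have hr : st.rcvd ⊆ st.rcvd ∪ {m | m ∈ M ∧ m.AddressedTo i} := Set.subset_union_left
  cases h
  case propose r hco hseq =>
    have e := hfresh hco hseq
    subst hco
    rw [e]
    constructor <;> simp [SlotState.initial, hrot]
    exact .inr (.inr trivial)
  case acceptVerify dp dv hm hs hslot hdp hview hp hF hv hwait =>
    have hu : ∀ j, Function.update (st.slots s).v dv.sender (some dv) j =
      if j = dv.sender then some dv else (st.slots s).v j := fun j => Function.update_apply _ _ _ _
    generalize Function.update (st.slots s).v dv.sender (some dv) = v' at hu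
    obtain ⟨h1, h2, h3, h4, h5, h6, h7, h8, h9, h10, h11⟩ := hs'
    -- Phases in which the value is already fixed require all places of the quorum to be filled, but
    -- the place of `dv.sender` is vacant.
    have hph : ¬ ((st.slots s).phase = .fpVerified ∨ (st.slots s).phase = .fpCommitted) := by
      grind -ring -linarith
    have hph' : ¬ ((st.slots s).phase = .rpVerified ∨ (st.slots s).phase = .rpPrepared ∨
        (st.slots s).phase = .rpCommitted) := by grind
    refine ⟨by grind, h2, h3, ?_, h5, by grind, by grind, by grind, by grind, by grind, by grind⟩
    intro hv1 j dv1
    dsimp only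
    rw [hu]
    split <;> grind -ring -linarith
  case installView nv h1 h2 h3 h4 h5 =>
    have := installed_value nv.val
    have := h3.1
    obtain ⟨h1, h2, h3, h4, h5, h6, h7, h8, h9, h10, h11⟩ := hs'
    constructor <;> simp only [SlotState.value] at * <;> grind -ring -linarith
  all_goals
    obtain ⟨h1, h2, h3, h4, h5, h6, h7, h8, h9, h10, h11⟩ := hs'
    constructor
    case' no_p => try exact h1
    case' hasReq => try exact h2
    case' p_spec => try exact h3
    case' v_spec => try exact h4
    case' phase_of_nonneg => try exact h5
    case' fast => try exact h6
    case' slow => try exact h7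
    case' installed => try exact h8
    case' prepared => try exact h9
    case' committed => try exact h10
    case' fpCommitted => try exact h11
    all_goals
      simp only [SlotState.value, LocalState.enterSlot] at *
      grind -ring -linarith

/-- What the messages sent by replica `i` about slot `s` say about its state. -/
structure MsgInv (i : Replica f) (s : Slot f) (ss : SlotState f Req) (sent : Set (Msg f Req)) :
    Prop where
  dv_spec : ∀ dv, Msg.depVerify dv ∈ sent → dv.slot = s → dv.sender = i ∧
    (ss.view = -1 → ss.hasReq = true ∧ ss.p = some dv.dp)
  dv_sent : ss.view = -1 → ss.hasReq = true → s.co ≠ i → ∀ dp, ss.p = some dp →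
    i ∈ dp.quorum → ∃ D, Msg.depVerify ⟨s, i, dp, D⟩ ∈ sent
  dv_uniq : ∀ dv dv', Msg.depVerify dv ∈ sent → Msg.depVerify dv' ∈ sent → dv.slot = s →
    dv'.slot = s → dv = dv'
  dc_spec : ∀ k val, Msg.depCommit s k val ∈ sent → k = i ∧
    (ss.view = -1 → (ss.phase = .fpVerified ∨ ss.phase = .fpCommitted) ∧ val = ss.value)
  dc_sent : ss.phase = .fpVerified ∨ ss.phase = .fpCommitted →
    Msg.depCommit s i ss.value ∈ sent
  dc_uniq : ∀ k val k' val', Msg.depCommit s k val ∈ sent → Msg.depCommit s k' val' ∈ sent →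
    val = val'
  pr_spec : ∀ w k val, Msg.prepare w s k val ∈ sent → k = i ∧ w ≤ ss.view ∧ (w = ss.view →
    (ss.phase = .rpVerified ∨ ss.phase = .rpPrepared ∨ ss.phase = .rpCommitted) ∧
      val = ss.value)
  pr_sent : ss.phase = .rpVerified ∨ ss.phase = .rpPrepared ∨ ss.phase = .rpCommitted →
    Msg.prepare ss.view s i ss.value ∈ sent
  pr_uniq : ∀ w k val k' val', Msg.prepare w s k val ∈ sent → Msg.prepare w s k' val' ∈ sent →
    val = val'
  co_spec : ∀ w k val, Msg.commit w s k val ∈ sent → k = i ∧ w ≤ ss.view ∧ (w = ss.view →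
    (ss.phase = .rpPrepared ∨ ss.phase = .rpCommitted) ∧ val = ss.value)
  co_sent : ss.phase = .rpPrepared ∨ ss.phase = .rpCommitted →
    Msg.commit ss.view s i ss.value ∈ sent
  pr_dc : ∀ k val k' val', Msg.prepare (-1) s k val ∈ sent → Msg.depCommit s k' val' ∉ sent
  vc_spec : ∀ vc, Msg.viewChange vc ∈ sent → vc.slot = s → vc.sender = i ∧ 0 ≤ vc.view ∧
    vc.view ≤ ss.view
  vc_sent : 0 ≤ ss.view → ∃ ct, Msg.viewChange ⟨ss.view, s, i, ct⟩ ∈ sent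
  nv_spec : ∀ nv, Msg.newView nv ∈ sent → nv.slot = s → nv.sender = i ∧ nv.Valid
  nv_uniq : ∀ nv nv', Msg.newView nv ∈ sent → Msg.newView nv' ∈ sent → nv.slot = s →
    nv'.slot = s → nv.view = nv'.view → nv = nv'
  exec_spec : ∀ k l o, Msg.exec s k l o ∈ sent → k = i ∧ ss.exec = some o

set_option maxHeartbeats 1000000 in
theorem MsgInv.mono {i : Replica f} {s : Slot f} {ss : SlotState f Req}
    {sent sent' : Set (Msg f Req)} (h : MsgInv i s ss sent) (hsub : sent ⊆ sent')
    (hnew : ∀ m ∈ sent', m ∈ sent ∨ m.slot? ≠ some s) : MsgInv i s ss sent' := by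
  have hold : ∀ m ∈ sent', m.slot? = some s → m ∈ sent := fun m hm hs =>
    (hnew m hm).resolve_right (not_not.2 hs)
  have hold1 : ∀ dv, Msg.depVerify dv ∈ sent' → dv.slot = s → Msg.depVerify dv ∈ sent :=
    fun dv h1 h2 => hold _ h1 (by simp [Msg.slot?, h2])
  have hold2 : ∀ k v, Msg.depCommit s k v ∈ sent' → Msg.depCommit s k v ∈ sent :=
    fun k v h1 => hold _ h1 rfl
  have hold3 : ∀ w k v, Msg.prepare w s k v ∈ sent' → Msg.prepare w s k v ∈ sent :=
    fun w k v h1 => hold _ h1 rfl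
  have hold4 : ∀ w k v, Msg.commit w s k v ∈ sent' → Msg.commit w s k v ∈ sent :=
    fun w k v h1 => hold _ h1 rfl
  have hold5 : ∀ vc, Msg.viewChange vc ∈ sent' → vc.slot = s → Msg.viewChange vc ∈ sent :=
    fun vc h1 h2 => hold _ h1 (by simp [Msg.slot?, h2])
  have hold6 : ∀ nv, Msg.newView nv ∈ sent' → nv.slot = s → Msg.newView nv ∈ sent :=
    fun vc h1 h2 => hold _ h1 (by simp [Msg.slot?, h2])
  have hold7 : ∀ k l o, Msg.exec s k l o ∈ sent' → Msg.exec s k l o ∈ sent :=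
    fun k l o h1 => hold _ h1 rfl
  obtain ⟨h1, h2, h3, h4, h5, h6, h7, h8, h9, h10, h11, h12, h13, h14, h15, h16, h17⟩ := h
  clear hold hnew
  constructor <;> grind -ring -linarith

theorem MsgInv.initial (i : Replica f) (s : Slot f) :
    MsgInv i s (SlotState.initial f Req) ∅ := by
  constructor <;> simp [SlotState.initial]

set_option maxHeartbeats 4000000 in
theorem MsgInv.step {i : Replica f} {now : ℝ}
    {st : LocalState f Req} {s : Slot f} {ss' : SlotState f Req} {M : Set (Msg f Req)}
    (h : SlotStep P i now st s ss' M)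
    (hfresh : s.co = i → s.seq = st.nextSeq → st.slots s = SlotState.initial f Req)
    (ht : ∀ m ∈ st.sent, m.slot? = some s → (st.slots s).Touched)
    (hb : SlotBasic (st.slots s) st.rcvd) (hs : ShapeInv s (st.slots s) st.rcvd)
    (hm : MsgInv i s (st.slots s) st.sent) :
    MsgInv i s ss' (st.sent ∪ M) := by
  have hb1 := hb.view_ge
  have hb2 := hb.vc
  have hs1 := hs.phase_of_nonneg
  have hs2 := hs.hasReq
  have hs3 := hs.fast
  have hs4 := hs.no_p
  have hs5 := hs.slow
  clear hb hs
  cases h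
  case propose r hco hseq =>
    have e := hfresh hco hseq
    rw [e] at ht
    -- The slot is fresh, so no earlier message about it can conflict with the overwritten state.
    have hno : ∀ m ∈ st.sent, m.slot? ≠ some s := fun m hm hs =>
      SlotState.not_touched_initial (ht m hm hs)
    rw [e]
    have : MsgInv i s (SlotState.initial f Req) (st.sent ∪ {Msg.depPropose
        ⟨s, r, st.conflicts P r, P.rotation i (st.attempts r)⟩ true}) := by
      refine (MsgInv.initial i s).mono (Set.empty_subset _) fun m hm => .inr ?_
      rcases hm with hm | rfl
      · exact hno m hm
      · simp [Msg.slot?]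
    obtain ⟨h1, h2, h3, h4, h5, h6, h7, h8, h9, h10, h11, h12, h13, h14, h15, h16, h17⟩ := this
    have hno' : ∀ m ∈ (st.sent ∪ {Msg.depPropose
        ⟨s, r, st.conflicts P r, P.rotation i (st.attempts r)⟩ true}), m.slot? ≠ some s := by
      rintro m (hm | rfl)
      · exact hno m hm
      · simp [Msg.slot?]
    refine ⟨fun dv h h' => (hno' _ h (by simp [Msg.slot?, h'])).elim,
      fun _ _ h => (h hco).elim, h3, fun k val h => (hno' _ h rfl).elim, by simp, h6,
      fun w k val h => (hno' _ h rfl).elim, by simp, h9, fun w k val h => (hno' _ h rfl).elim,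
      by simp, h12, h13, h14, h15, h16, fun k l o h => (hno' _ h rfl).elim⟩
  all_goals clear hfresh ht
  case acceptVerify dp dv _ hs hslot hdp hview hp hF hv _ =>
    have hph : ¬ ((st.slots s).phase = .fpVerified ∨ (st.slots s).phase = .fpCommitted) := by
      grind -ring -linarith
    have hph' : ¬ ((st.slots s).phase = .rpVerified ∨ (st.slots s).phase = .rpPrepared ∨
        (st.slots s).phase = .rpCommitted) := by grind -ring -linarith
    obtain ⟨h1, h2, h3, h4, h5, h6, h7, h8, h9, h10, h11, h12, h13, h14, h15, h16, h17⟩ := hm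
    simp only [Set.union_empty]
    clear hs1 hs2 hs3 hs4 hs5
    exact ⟨h1, h2, h3, fun k val h => ⟨(h4 k val h).1, fun h' => (hph ((h4 k val h).2 h').1).elim⟩,
      fun h => (hph h).elim, h6,
      fun w k val h => ⟨(h7 w k val h).1, (h7 w k val h).2.1,
        fun h' => (hph' ((h7 w k val h).2.2 h').1).elim⟩,
      fun h => (hph' h).elim, h9,
      fun w k val h => ⟨(h10 w k val h).1, (h10 w k val h).2.1,
        fun h' => (hph' (.inr ((h10 w k val h).2.2 h').1)).elim⟩,
      fun h => (hph' (.inr h)).elim, h12, h13, h14, h15, h16, h17⟩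
  all_goals clear hs3 hs5
  case' installView nv _ _ hvalid _ _ =>
    have := installed_value nv.val
    have := hvalid.1
  case acceptRequest dp hs hmm hview hp hr =>
    obtain ⟨h1, h2, h3, h4, h5, h6, h7, h8, h9, h10, h11, h12, h13, h14, h15, h16, h17⟩ := hm
    simp only [SlotState.value] at h4 h5 h7 h8 h10 h11
    constructor <;> simp only [SlotState.value, Set.mem_union, Set.mem_ofPred_eq,
      reduceCtorEq, and_false, or_false]
    case dv_sent =>
      intro _ _ _ dp' hdp' hi
      obtain rfl : dp = dp' := by simpa [hp] using hdp'
      exact ⟨_, .inr ⟨hi, rfl⟩⟩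
    all_goals grind -ring -linarith
  all_goals
    obtain ⟨h1, h2, h3, h4, h5, h6, h7, h8, h9, h10, h11, h12, h13, h14, h15, h16, h17⟩ := hm
    simp only [SlotState.value] at h4 h5 h7 h8 h10 h11
    constructor <;> simp only [SlotState.value, LocalState.enterSlot, LocalState.enterMsgs,
      Set.mem_union, Set.mem_singleton_iff, Set.mem_ofPred_eq, Set.union_empty, reduceCtorEq,
      and_false, exists_false, or_false]
    case' dv_spec => try exact h1
    case' dv_sent => try exact h2
    case' dv_uniq => try exact h3
    case' dc_spec => try exact h4
    case' dc_sent => try exact h5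
    case' dc_uniq => try exact h6
    case' pr_spec => try exact h7
    case' pr_sent => try exact h8
    case' pr_uniq => try exact h9
    case' co_spec => try exact h10
    case' co_sent => try exact h11
    case' pr_dc => try exact h12
    case' vc_spec => try exact h13
    case' vc_sent => try exact h14
    case' nv_spec => try exact h15
    case' nv_uniq => try exact h16
    case' exec_spec => try exact h17
    all_goals grind -ring -linarith

/-! ### Certificates -/

theorem LocalState.newestCert_fast {st : LocalState f Req} {s : Slot f}
    (h : (st.slots s).phase = .fpVerified ∨ (st.slots s).phase = .fpCommitted) :
    st.newestCert s = (st.slots s).p.map fun dp => .fpc dp (st.slots s).v := by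
  rcases h with h | h <;> simp [LocalState.newestCert, h]

theorem LocalState.newestCert_prepared {st : LocalState f Req} {s : Slot f}
    (h : (st.slots s).phase = .rpPrepared ∨ (st.slots s).phase = .rpCommitted) :
    st.newestCert s = some (.rpc (st.slots s).value (st.slots s).view (Finset.univ.filter fun k =>
        Msg.prepare (st.slots s).view s k (st.slots s).value ∈ st.rcvd)) := by
  rcases h with h | h <;> simp [LocalState.newestCert, h]

theorem LocalState.newestCert_other {st : LocalState f Req} {s : Slot f}
    (h1 : ¬ ((st.slots s).phase = .fpVerified ∨ (st.slots s).phase = .fpCommitted))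
    (h2 : ¬ ((st.slots s).phase = .rpPrepared ∨ (st.slots s).phase = .rpCommitted)) :
    st.newestCert s = (st.slots s).cert := by
  unfold LocalState.newestCert
  split <;> simp_all

/-- The newest certificate is a reconciliation-path certificate of view `u`. -/
def SlotState.NewestRp (ss : SlotState f Req) (u : ℤ) : Prop :=
  ((ss.phase = .rpPrepared ∨ ss.phase = .rpCommitted) ∧ u = ss.view) ∨
    (¬ (ss.phase = .rpPrepared ∨ ss.phase = .rpCommitted) ∧
      ∃ val K, ss.cert = some (.rpc val u K))

/-- There is a certificate for the slot. -/
def SlotState.HasCert (ss : SlotState f Req) : Prop :=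
  ss.phase = .fpVerified ∨ ss.phase = .fpCommitted ∨ ss.phase = .rpPrepared ∨
    ss.phase = .rpCommitted ∨ ss.cert ≠ none

/-- The selected value of a valid `NewView` stems from its certificates. -/
theorem NewView.Valid.val_verified {nv : NewView f Req} (h : nv.Valid) {dp : DepPropose f Req}
    {dv : Verifies f Req} (hv : nv.val = some (dp, dv)) : Verified nv.slot dp dv := by
  obtain ⟨-, -, -, h4, h5⟩ := h
  rcases h5 with ⟨k, vc, view, K, h1, h2, -⟩ | ⟨-, k, vc, dp', dv', h1, h2, h3⟩ | ⟨-, h3⟩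
  · have h6 := (h4 k vc h1).2.2.2.2 _ h2
    rw [(h4 k vc h1).2.1] at h6
    exact h6.1 dp dv hv
  · have h6 := (h4 k vc h1).2.2.2.2 _ h2
    rw [(h4 k vc h1).2.1] at h6
    rw [hv] at h3
    obtain ⟨rfl, rfl⟩ := Prod.mk.inj (Option.some.inj h3)
    exact h6.1
  · rw [hv] at h3; simp at h3

theorem ShapeInv.verified {s : Slot f} {ss : SlotState f Req} {rcvd : Set (Msg f Req)}
    (h : ShapeInv s ss rcvd) (hview : ss.view = -1) {dp : DepPropose f Req}
    (hp : ss.p = some dp) (hall : ∀ j ∈ dp.quorum, ss.v j ≠ none) : Verified s dp ss.v := by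
  obtain ⟨h1, h2, -⟩ := h.p_spec hview dp hp
  have h3 := h.v_spec hview
  refine ⟨h1, h2, fun j => ⟨fun hj => ?_, hall j⟩, fun j dv hj => ?_⟩
  · obtain ⟨dv, hdv⟩ := Option.ne_none_iff_exists'.1 hj
    have := h3 j dv hdv
    rw [hp, Option.some.injEq] at this
    rw [this.2.2.1]; exact this.2.2.2.1
  · have := h3 j dv hj
    rw [hp, Option.some.injEq] at this
    exact ⟨this.1, this.2.1, this.2.2.1.symm⟩

/-- In view `-1` the replica has collected the `DepVerify`s itself; in a later view the value stems
from a valid certificate in the installed `NewView`. -/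
theorem ShapeInv.value_verified {s : Slot f} {ss : SlotState f Req} {rcvd : Set (Msg f Req)}
    (h : ShapeInv s ss rcvd) (hb : SlotBasic ss rcvd)
    (hph : ss.phase = .rpVerified ∨ ss.phase = .rpPrepared ∨ ss.phase = .rpCommitted)
    {dp : DepPropose f Req} {dv : Verifies f Req} (hv : ss.value = some (dp, dv)) :
    Verified s dp dv := by
  rcases (show ss.view = -1 ∨ 0 ≤ ss.view by have := hb.view_ge; omega) with hview | hview
  · obtain ⟨⟨dp', h1, h2⟩, -⟩ := h.slow hview hph
    simp only [SlotState.value, h1, Option.map_some, Option.some.injEq, Prod.mk.injEq] at hv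
    obtain ⟨rfl, rfl⟩ := hv
    exact h.verified hview h1 h2
  · obtain ⟨nv, -, h2, h3, -, h5⟩ := h.installed hview (by grind)
    rw [hv] at h5
    rw [← h3]; exact h2.val_verified h5

theorem LocalState.newestCert_valid {st : LocalState f Req} {s : Slot f}
    (hb : SlotBasic (st.slots s) st.rcvd) (hs : ShapeInv s (st.slots s) st.rcvd)
    (hc : ∀ ct, (st.slots s).cert = some ct → ct.Valid s) {ct : Cert f Req}
    (hct : st.newestCert s = some ct) : ct.Valid s := by
  by_cases h1 : (st.slots s).phase = .fpVerified ∨ (st.slots s).phase = .fpCommitted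
  · rw [newestCert_fast h1] at hct
    obtain ⟨hview, ⟨dp, hp, hall⟩, hf⟩ := hs.fast h1
    rw [hp] at hct
    obtain rfl := Option.some.inj hct
    exact ⟨hs.verified hview hp hall, hf⟩
  by_cases h2 : (st.slots s).phase = .rpPrepared ∨ (st.slots s).phase = .rpCommitted
  · rw [newestCert_prepared h2] at hct
    obtain rfl := Option.some.inj hct
    refine ⟨fun dp dv hv => hs.value_verified hb (.inr h2) hv, hb.view_ge, ?_⟩
    obtain ⟨K, hK, hall⟩ := hs.prepared h2
    exact hK.trans (Finset.card_le_card fun k hk => by simpa using hall k hk)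
  · rw [newestCert_other h1 h2] at hct
    exact hc ct hct

/-- How the certificates of a replica reflect the messages it has sent. -/
structure CertInv (s : Slot f) (ss : SlotState f Req) (sent : Set (Msg f Req)) : Prop where
  none : ss.view = -1 → ss.cert = none
  valid : ∀ ct, ss.cert = some ct → ct.Valid s
  commit : ∀ w k val, Msg.commit w s k val ∈ sent → ∃ u, w ≤ u ∧ ss.NewestRp u
  commit_vc : ∀ w k val vc, Msg.commit w s k val ∈ sent → Msg.viewChange vc ∈ sent →
    vc.slot = s → w < vc.view → ∃ val' u K, vc.cert = some (.rpc val' u K) ∧ w ≤ u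
  depCommit : ∀ k val, Msg.depCommit s k val ∈ sent → ss.HasCert
  depCommit_vc : ∀ k val vc, Msg.depCommit s k val ∈ sent → Msg.viewChange vc ∈ sent →
    vc.slot = s → vc.cert ≠ Option.none
  depCommit_spec : ∀ k val, Msg.depCommit s k val ∈ sent → ∃ dp dv, val = some (dp, dv) ∧
    Verified s dp dv ∧ FastMatch dv
  vc_valid : ∀ vc, Msg.viewChange vc ∈ sent → vc.slot = s → vc.Valid

theorem CertInv.of_sent {s : Slot f} {ss : SlotState f Req}
    {sent sent' : Set (Msg f Req)} (h : CertInv s ss sent)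
    (hco : ∀ w k val, Msg.commit w s k val ∈ sent' → Msg.commit w s k val ∈ sent)
    (hdc : ∀ k val, Msg.depCommit s k val ∈ sent' → Msg.depCommit s k val ∈ sent)
    (hvc : ∀ vc, Msg.viewChange vc ∈ sent' → vc.slot = s → Msg.viewChange vc ∈ sent) :
    CertInv s ss sent' :=
  ⟨h.none, h.valid, fun w k val h1 => h.commit w k val (hco _ _ _ h1),
    fun w k val vc h1 h2 h3 => h.commit_vc w k val vc (hco _ _ _ h1) (hvc _ h2 h3) h3,
    fun k val h1 => h.depCommit k val (hdc _ _ h1),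
    fun k val vc h1 h2 h3 => h.depCommit_vc k val vc (hdc _ _ h1) (hvc _ h2 h3) h3,
    fun k val h1 => h.depCommit_spec k val (hdc _ _ h1),
    fun vc h1 h2 => h.vc_valid vc (hvc _ h1 h2) h2⟩

theorem CertInv.mono {s : Slot f} {ss : SlotState f Req}
    {sent sent' : Set (Msg f Req)} (h : CertInv s ss sent)
    (hnew : ∀ m ∈ sent', m ∈ sent ∨ m.slot? ≠ some s) : CertInv s ss sent' := by
  have hold : ∀ m ∈ sent', m.slot? = some s → m ∈ sent := fun m hm hs =>
    (hnew m hm).resolve_right (not_not.2 hs)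
  exact h.of_sent (fun w k val h1 => hold _ h1 rfl) (fun k val h1 => hold _ h1 rfl)
    (fun vc h1 h2 => hold _ h1 (by simp [Msg.slot?, h2]))

theorem CertInv.initial (s : Slot f) : CertInv s (SlotState.initial f Req) ∅ := by
  constructor <;> simp [SlotState.initial]

/-- Certificate invariants only depend on view, phase, and certificate. -/
theorem CertInv.congr {s : Slot f} {ss ss' : SlotState f Req} {sent : Set (Msg f Req)}
    (h : CertInv s ss sent) (h1 : ss'.view = ss.view) (h2 : ss'.phase = ss.phase)
    (h3 : ss'.cert = ss.cert) : CertInv s ss' sent := by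
  obtain ⟨a1, a2, a3, a4, a5, a6, a7, a8⟩ := h
  refine ⟨?_, ?_, ?_, a4, ?_, a6, a7, a8⟩ <;>
    simpa only [SlotState.NewestRp, SlotState.HasCert, h1, h2, h3]

/-- Entering a view keeps the certificate invariants. -/
theorem CertInv.enter {i : Replica f} {now : ℝ} {st : LocalState f Req} {s : Slot f} {w : ℤ}
    (hb : SlotBasic (st.slots s) st.rcvd) (hs : ShapeInv s (st.slots s) st.rcvd)
    (hc : CertInv s (st.slots s) st.sent) (hw : (st.slots s).view < w) :
    CertInv s (st.enterSlot P now s w) (st.sent ∪ st.enterMsgs i s w) := by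
  have hge := hb.view_ge
  -- A fast-path certificate never replaces a reconciliation-path certificate: the fast phases occur
  -- only in view `-1`, where no certificate is stored yet.
  have hrp : ∀ u, (st.slots s).NewestRp u → ∃ val K, st.newestCert s = some (.rpc val u K) := by
    rintro u (⟨h1, rfl⟩ | ⟨h1, val, K, h2⟩)
    · exact ⟨_, _, LocalState.newestCert_prepared h1⟩
    · by_cases h3 : (st.slots s).phase = .fpVerified ∨ (st.slots s).phase = .fpCommitted
      · have := hc.none (hs.fast h3).1
        rw [h2] at this; simp at this
      · exact ⟨val, K, by rw [LocalState.newestCert_other h3 h1, h2]⟩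
  have hhas : (st.slots s).HasCert → st.newestCert s ≠ Option.none := by
    intro h
    by_cases h3 : (st.slots s).phase = .fpVerified ∨ (st.slots s).phase = .fpCommitted
    · obtain ⟨dp, hdp, -⟩ := (hs.fast h3).2.1
      rw [LocalState.newestCert_fast h3, hdp]; simp
    by_cases h4 : (st.slots s).phase = .rpPrepared ∨ (st.slots s).phase = .rpCommitted
    · rw [LocalState.newestCert_prepared h4]; simp
    · rw [LocalState.newestCert_other h3 h4]
      unfold SlotState.HasCert at h; tauto
  have hval := fun ct => LocalState.newestCert_valid hb hs hc.valid (ct := ct)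
  have hvc : ∀ vc, Msg.viewChange vc ∈ st.sent ∪ st.enterMsgs i s w → vc.slot = s →
      Msg.viewChange vc ∈ st.sent ∨ vc = ⟨w, s, i, st.newestCert s⟩ := by
    rintro vc (h | h | ⟨-, dp, -, h⟩) -
    · exact .inl h
    · exact .inr (by simpa using h)
    · simp at h
  have hco : ∀ w' k val, Msg.commit w' s k val ∈ st.sent ∪ st.enterMsgs i s w →
      Msg.commit w' s k val ∈ st.sent := by
    rintro w' k val (h | h | ⟨-, dp, -, h⟩)
    · exact h
    · simp at h
    · simp at h
  have hdc : ∀ k val, Msg.depCommit s k val ∈ st.sent ∪ st.enterMsgs i s w →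
      Msg.depCommit s k val ∈ st.sent := by
    rintro k val (h | h | ⟨-, dp, -, h⟩)
    · exact h
    · simp at h
    · simp at h
  refine ⟨fun h => ?_, fun ct h => hval ct h, fun w' k val h => ?_,
    fun w' k val vc h h1 h2 h3 => ?_,
    fun k val h => ?_, fun k val vc h h1 h2 => ?_,
    fun k val h => hc.depCommit_spec k val (hdc _ _ h),
    fun vc h h1 => ?_⟩
  · simp only [LocalState.enterSlot] at h; omega
  · obtain ⟨u, h1, h2⟩ := hc.commit w' k val (hco _ _ _ h)
    obtain ⟨val', K, h3⟩ := hrp u h2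
    exact ⟨u, h1, .inr ⟨by simp [LocalState.enterSlot], val', K, h3⟩⟩
  · rcases hvc vc h1 h2 with h4 | rfl
    · exact hc.commit_vc w' k val vc (hco _ _ _ h) h4 h2 h3
    · obtain ⟨u, h1, h2⟩ := hc.commit w' k val (hco _ _ _ h)
      obtain ⟨val', K, h3⟩ := hrp u h2
      exact ⟨val', u, K, h3, h1⟩
  · exact .inr (.inr (.inr (.inr (hhas (hc.depCommit k val (hdc _ _ h))))))
  · rcases hvc vc h1 h2 with h4 | rfl
    · exact hc.depCommit_vc k val vc (hdc _ _ h) h4 h2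
    · exact hhas (hc.depCommit k val (hdc _ _ h))
  · rcases hvc vc h h1 with h4 | rfl
    · exact hc.vc_valid vc h4 h1
    · exact ⟨by simp only; omega, fun ct hct => hval ct hct⟩

/-- A certificate is first implicit in the phase and becomes explicit when a view is entered.
Installing a view starts from phase `viewChange`, where the newest certificate is the stored one,
and keeps it stored. -/
theorem CertInv.step {i : Replica f} {now : ℝ}
    {st : LocalState f Req} {s : Slot f} {ss' : SlotState f Req} {M : Set (Msg f Req)}
    (h : SlotStep P i now st s ss' M)
    (hfresh : s.co = i → s.seq = st.nextSeq → st.slots s = SlotState.initial f Req)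
    (ht : ∀ m ∈ st.sent, m.slot? = some s → (st.slots s).Touched)
    (hb : SlotBasic (st.slots s) st.rcvd) (hs : ShapeInv s (st.slots s) st.rcvd)
    (hm : MsgInv i s (st.slots s) st.sent) (hc : CertInv s (st.slots s) st.sent) :
    CertInv s ss' (st.sent ∪ M) := by
  have hge := hb.view_ge
  have hview_of : ∀ ph, (st.slots s).phase = ph → ph ≠ .viewChange → ph ≠ .rpVerified →
      ph ≠ .rpPrepared → ph ≠ .rpCommitted → (st.slots s).view = -1 := by
    intro ph h1 h2 h3 h4 h5
    by_contra hne
    have := hs.phase_of_nonneg (by omega)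
    grind
  -- without a reconciliation-path certificate, no commit has been sent
  have hno : (st.slots s).view = -1 → (st.slots s).phase ≠ .rpPrepared →
      (st.slots s).phase ≠ .rpCommitted → ∀ w k val, Msg.commit w s k val ∉ st.sent := by
    intro h1 h2 h3 w k val h4
    obtain ⟨u, -, ⟨h5, -⟩ | ⟨-, val, K, h5⟩⟩ := hc.commit w k val h4
    · tauto
    · rw [hc.none h1] at h5; simp at h5
  cases h
  case propose r hco hseq =>
    have e := hfresh hco hseq
    rw [e] at ht hc ⊢
    have hno : ∀ m ∈ st.sent ∪ {Msg.depPropose ⟨s, r, st.conflicts P r,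
        P.rotation i (st.attempts r)⟩ true}, m.slot? ≠ some s := by
      rintro m (hm | rfl) hs
      · exact SlotState.not_touched_initial (ht m hm hs)
      · simp [Msg.slot?] at hs
    exact ⟨fun _ => rfl, by simp [SlotState.initial], fun w k val h => (hno _ h rfl).elim,
      fun w k val vc h => (hno _ h rfl).elim, fun k val h => (hno _ h rfl).elim,
      fun k val vc h => (hno _ h rfl).elim, fun k val h => (hno _ h rfl).elim,
      fun vc h h1 => (hno _ h (by simp [Msg.slot?, h1])).elim⟩
  case commitTimeout t ht hnow => exact CertInv.enter hb hs hc (by omega)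
  case vcTimeout t ht hnow => exact CertInv.enter hb hs hc (by omega)
  case joinView w hw hlt => exact CertInv.enter hb hs hc hlt
  case acceptPropose => rw [Set.union_empty]; exact hc.congr rfl rfl rfl
  case acceptVerify => rw [Set.union_empty]; exact hc.congr rfl rfl rfl
  case startCommitTimer => rw [Set.union_empty]; exact hc.congr rfl rfl rfl
  case startVcTimer => rw [Set.union_empty]; exact hc.congr rfl rfl rfl
  case learn => rw [Set.union_empty]; exact hc.congr rfl rfl rfl
  case queryTimeout =>
    refine CertInv.congr (hc.of_sent ?_ ?_ ?_) rfl rfl rfl <;> simp +contextual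
  case proposeTimeout =>
    refine CertInv.congr (hc.of_sent ?_ ?_ ?_) rfl rfl rfl <;> simp +contextual
  case sendNewView => refine hc.of_sent ?_ ?_ ?_ <;> simp +contextual
  case answerQuery => refine hc.of_sent ?_ ?_ ?_ <;> simp +contextual
  case rpPrepare hph hq =>
    obtain ⟨a1, a2, a3, a4, a5, a6, a7, a8⟩ := hc
    have hvcs := hm.vc_spec
    have hcs := hm.co_spec
    refine ⟨a1, a2, ?_, ?_, ?_, ?_, ?_, ?_⟩
    · rintro w k val (h | h)
      · exact ⟨_, (hcs w k val h).2.1, .inl ⟨.inl rfl, rfl⟩⟩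
      · obtain ⟨rfl, -⟩ : w = _ ∧ _ := by simpa using h
        exact ⟨_, le_rfl, .inl ⟨.inl rfl, rfl⟩⟩
    · rintro w k val vc (h | h) (h' | h') h1 h2
      · exact a4 w k val vc h h' h1 h2
      · simp at h'
      · obtain ⟨rfl, -⟩ : w = _ ∧ _ := by simpa using h
        have := (hvcs vc h' h1).2.2
        omega
      · simp at h'
    · exact fun k val h => .inr (.inr (.inl rfl))
    · simpa using a6
    · simpa using a7
    · simpa using a8
  case fpVerify dp hph hp hall hfast =>
    have hv1 := hview_of _ hph (by simp) (by simp) (by simp) (by simp)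
    have hno' := hno hv1 (by simp [hph]) (by simp [hph])
    obtain ⟨a1, a2, a3, a4, a5, a6, a7, a8⟩ := hc
    have hvcs := hm.vc_spec
    refine ⟨a1, a2, ?_, ?_, ?_, ?_, ?_, ?_⟩
    · rintro w k val (h | h)
      · exact (hno' _ _ _ h).elim
      · simp at h
    · rintro w k val vc (h | h)
      · exact (hno' _ _ _ h).elim
      · simp at h
    · exact fun k val h => .inl rfl
    · rintro k val vc - (h' | h') h1
      · have := hvcs vc h' h1; omega
      · simp at h'
    · rintro k val (h | h)
      · exact a7 k val h
      · obtain ⟨-, rfl⟩ : _ ∧ val = _ := by simpa using h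
        exact ⟨dp, (st.slots s).v, by simp [SlotState.value, hp], hs.verified hv1 hp hall, hfast⟩
    · simpa using a8
  case acceptRequest dp hs' hmm hview hp hr =>
    have hphase : (st.slots s).phase = .init := by
      by_contra h; have := (hs.hasReq hview).2 h; simp [hr] at this
    have hno' := hno hview (by simp [hphase]) (by simp [hphase])
    obtain ⟨a1, a2, a3, a4, a5, a6, a7, a8⟩ := hc
    refine ⟨a1, a2, ?_, ?_, ?_, ?_, ?_, ?_⟩
    · rintro w k val (h | ⟨-, h⟩)
      · exact (hno' _ _ _ h).elim
      · simp at h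
    · rintro w k val vc (h | ⟨-, h⟩)
      · exact (hno' _ _ _ h).elim
      · simp at h
    · rintro k val (h | ⟨-, h⟩)
      · have := a5 k val h
        simp only [SlotState.HasCert, hphase, a1 hview] at this
        simp at this
      · simp at h
    · simpa using a6
    · simpa using a7
    · simpa using a8
  case fpCommit hph hq =>
    rw [Set.union_empty]
    have hv1 := hview_of _ hph (by simp) (by simp) (by simp) (by simp)
    have hno' := hno hv1 (by simp [hph]) (by simp [hph])
    obtain ⟨a1, a2, a3, a4, a5, a6, a7, a8⟩ := hc
    exact ⟨a1, a2, fun w k val h => (hno' _ _ _ h).elim, a4, fun k val h => .inr (.inl rfl),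
      a6, a7, a8⟩
  case rpCommit hph hq =>
    rw [Set.union_empty]
    obtain ⟨a1, a2, a3, a4, a5, a6, a7, a8⟩ := hc
    refine ⟨a1, a2, fun w k val h => ⟨_, (hm.co_spec w k val h).2.1, .inl ⟨.inr rfl, rfl⟩⟩, a4,
      fun k val h => .inr (.inr (.inr (.inl rfl))), a6, a7, a8⟩
  case rpVerify dp hph hp hall hslow =>
    have hv1 := hview_of _ hph (by simp) (by simp) (by simp) (by simp)
    have hno' := hno hv1 (by simp [hph]) (by simp [hph])
    obtain ⟨a1, a2, a3, a4, a5, a6, a7, a8⟩ := hc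
    refine ⟨a1, a2, ?_, ?_, ?_, ?_, ?_, ?_⟩
    · rintro w k val (h | h)
      · exact (hno' _ _ _ h).elim
      · simp at h
    · simpa using a4
    · rintro k val (h | h)
      · have := a5 k val h
        simp only [SlotState.HasCert, hph, a1 hv1] at this
        simp at this
      · simp at h
    · simpa using a6
    · simpa using a7
    · simpa using a8
  case installView nv _ _ hvalid hph hview =>
    obtain ⟨a1, a2, a3, a4, a5, a6, a7, a8⟩ := hc
    refine ⟨a1, a2, ?_, ?_, ?_, ?_, ?_, ?_⟩
    · rintro w k val (h | h)
      · obtain ⟨u, h1, h2⟩ := a3 w k val h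
        refine ⟨u, h1, .inr ⟨by simp, ?_⟩⟩
        simpa [SlotState.NewestRp, hph] using h2
      · simp at h
    · simpa using a4
    · rintro k val (h | h)
      · have := a5 k val h
        simpa [SlotState.HasCert, hph] using this
      · simp at h
    · simpa using a6
    · simpa using a7
    · simpa using a8

/-! ### Authenticity -/

theorem Cert.Authentic.mono {c c' : Config f Req}
    (h : ∀ k m, Signed faulty c k m → Signed faulty c' k m) {s : Slot f} {ct : Cert f Req}
    (hc : ct.Authentic faulty c s) : ct.Authentic faulty c' s := by
  cases ct with
  | fpc dp dv => exact ⟨h _ _ hc.1, fun k d hd => h _ _ (hc.2 k d hd)⟩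
  | rpc val view K =>
    exact ⟨fun dp dv hv => ⟨h _ _ (hc.1 dp dv hv).1,
      fun k d hd => h _ _ ((hc.1 dp dv hv).2 k d hd)⟩,
      fun k hk => h _ _ (hc.2 k hk)⟩

theorem ViewChange.Authentic.mono {c c' : Config f Req}
    (h : ∀ k m, Signed faulty c k m → Signed faulty c' k m) {vc : ViewChange f Req}
    (hc : vc.Authentic faulty c) : vc.Authentic faulty c' :=
  ⟨h _ _ hc.1, fun ct hct => (hc.2 ct hct).mono h⟩

theorem Msg.Authentic.mono {c c' : Config f Req}
    (h : ∀ k m, Signed faulty c k m → Signed faulty c' k m) {m : Msg f Req}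
    (hm : m.Authentic faulty c) : m.Authentic faulty c' := by
  cases m with
  | request => trivial
  | viewChange vc => exact ViewChange.Authentic.mono h hm
  | newView nv => exact ⟨h _ _ hm.1, fun k vc hk => (hm.2 k vc hk).mono h⟩
  | _ => exact h _ _ hm

/-- Proposal, `DepVerify`s, and certificate of a slot have genuine signatures. -/
structure SlotAuth (faulty : Finset (Replica f)) (c : Config f Req) (s : Slot f)
    (ss : SlotState f Req) : Prop where
  p : ∀ dp, ss.p = some dp → Signed faulty c dp.slot.co (.depPropose dp true)
  v : ∀ j d, ss.v j = some d → Signed faulty c d.sender (.depVerify d)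
  cert : ∀ ct, ss.cert = some ct → ct.Authentic faulty c s

theorem SlotAuth.mono {c c' : Config f Req}
    (h : ∀ k m, Signed faulty c k m → Signed faulty c' k m) {s : Slot f} {ss : SlotState f Req}
    (hs : SlotAuth faulty c s ss) : SlotAuth faulty c' s ss :=
  ⟨fun dp hp => h _ _ (hs.p dp hp), fun j d hd => h _ _ (hs.v j d hd),
    fun ct hct => (hs.cert ct hct).mono h⟩

theorem SlotAuth.newestCert {c : Config f Req} {st : LocalState f Req} {s : Slot f}
    (hr : ∀ m ∈ st.rcvd, m.Authentic faulty c) (hs : SlotAuth faulty c s (st.slots s))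
    {ct : Cert f Req} (hct : st.newestCert s = some ct) : ct.Authentic faulty c s := by
  by_cases h1 : (st.slots s).phase = .fpVerified ∨ (st.slots s).phase = .fpCommitted
  · rw [LocalState.newestCert_fast h1] at hct
    obtain ⟨dp, hp, rfl⟩ := Option.map_eq_some_iff.1 hct
    exact ⟨hs.p dp hp, hs.v⟩
  by_cases h2 : (st.slots s).phase = .rpPrepared ∨ (st.slots s).phase = .rpCommitted
  · rw [LocalState.newestCert_prepared h2] at hct
    obtain rfl := Option.some.inj hct
    refine ⟨fun dp dv hv => ?_, fun k hk => ?_⟩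
    · obtain ⟨dp', hp, h3⟩ := Option.map_eq_some_iff.1 hv
      obtain ⟨rfl, rfl⟩ := Prod.mk.inj h3
      exact ⟨hs.p _ hp, hs.v⟩
    · exact hr _ (Finset.mem_filter.1 hk).2
  · rw [LocalState.newestCert_other h1 h2] at hct
    exact hs.cert ct hct

/-- The signature of the view's coordinator is worth nothing if it is faulty; the signatures behind
the value come from the quoted certificate that it was selected from. -/
theorem NewView.val_authentic {c : Config f Req} {nv : NewView f Req} (hv : nv.Valid)
    (ha : (Msg.newView nv).Authentic faulty c) {dp : DepPropose f Req} {dv : Verifies f Req}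
    (hval : nv.val = some (dp, dv)) : Signed faulty c dp.slot.co (.depPropose dp true) ∧
      ∀ j d, dv j = some d → Signed faulty c d.sender (.depVerify d) := by
  obtain ⟨-, -, -, -, h5⟩ := hv
  rcases h5 with ⟨k, vc, view, K, h1, h2, -⟩ | ⟨-, k, vc, dp', dv', h1, h2, h3⟩ | ⟨-, h3⟩
  · exact ((ha.2 k vc h1).2 _ h2).1 dp dv hval
  · rw [hval] at h3
    obtain ⟨rfl, rfl⟩ := Prod.mk.inj (Option.some.inj h3)
    exact (ha.2 k vc h1).2 _ h2
  · rw [hval] at h3; simp at h3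

theorem SlotAuth.step {c : Config f Req} {i : Replica f} {now : ℝ} {st : LocalState f Req}
    {s : Slot f} {ss' : SlotState f Req} {M : Set (Msg f Req)} (h : SlotStep P i now st s ss' M)
    (hr : ∀ m ∈ st.rcvd, m.Authentic faulty c) (hs : SlotAuth faulty c s (st.slots s))
    (hM : ∀ m ∈ M, Signed faulty c i m) : SlotAuth faulty c s ss' := by
  cases h
  case propose r hco hseq =>
    refine ⟨?_, hs.v, hs.cert⟩
    rintro dp ⟨⟩
    have := hM _ rfl
    subst hco
    exact this
  case acceptPropose dp b hs' hm hF hview hp hwait hprev =>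
    refine ⟨?_, hs.v, hs.cert⟩
    rintro dp ⟨⟩
    exact hr _ hm
  case acceptVerify dp dv hm hs' hslot hdp hview hp hF hv hwait =>
    refine ⟨hs.p, fun j d hd => ?_, hs.cert⟩
    dsimp only at hd
    rw [Function.update_apply] at hd
    split at hd
    · obtain rfl := Option.some.inj hd
      exact hr _ hm
    · exact hs.v j d hd
  case commitTimeout => exact ⟨hs.p, hs.v, fun ct hct => hs.newestCert hr hct⟩
  case vcTimeout => exact ⟨hs.p, hs.v, fun ct hct => hs.newestCert hr hct⟩
  case joinView => exact ⟨hs.p, hs.v, fun ct hct => hs.newestCert hr hct⟩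
  case installView nv h1 hm hvalid hph hview =>
    refine ⟨fun dp hp => ?_, fun j d hd => ?_, hs.cert⟩
    · obtain ⟨⟨dp', dv⟩, h2, rfl⟩ := Option.map_eq_some_iff.1 hp
      exact (NewView.val_authentic hvalid (hr _ hm) h2).1
    · dsimp only at hd
      rcases hval : nv.val with _ | ⟨dp', dv⟩
      · simp [hval] at hd
      · rw [hval] at hd
        exact (NewView.val_authentic hvalid (hr _ hm) hval).2 j d hd
  all_goals exact ⟨hs.p, hs.v, hs.cert⟩

theorem SlotStep.authentic {c : Config f Req} {i : Replica f} {now : ℝ} {st : LocalState f Req}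
    {s : Slot f} {ss' : SlotState f Req} {M : Set (Msg f Req)} (h : SlotStep P i now st s ss' M)
    (hr : ∀ m ∈ st.rcvd, m.Authentic faulty c) (hs : SlotAuth faulty c s (st.slots s))
    (hM : ∀ m ∈ M, Signed faulty c i m) {m : Msg f Req} (hm : m ∈ M) : m.Authentic faulty c := by
  have hsig := hM m hm
  cases h
  case propose r hco hseq => obtain rfl := hm; subst hco; exact hsig
  case proposeTimeout dp t ht hp => obtain rfl := hm; exact hs.p _ hp
  case acceptRequest => obtain ⟨-, rfl⟩ := hm; exact hsig
  case fpVerify => obtain rfl := hm; exact hsig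
  case rpVerify => obtain rfl := hm; exact hsig
  case rpPrepare => obtain rfl := hm; exact hsig
  case queryTimeout => obtain rfl := hm; exact hsig
  case answerQuery => obtain rfl := hm; exact hsig
  case installView => obtain rfl := hm; exact hsig
  case sendNewView nv h1 h2 hvalid hph hview hvcs honce =>
    obtain rfl := hm
    exact ⟨h2 ▸ hsig, fun k vc hk => hr _ (hvcs k vc hk)⟩
  case commitTimeout =>
    rcases hm with rfl | ⟨-, dp, hp, rfl⟩
    · exact ⟨hsig, fun ct hct => hs.newestCert hr hct⟩
    · exact hs.p _ hp
  case vcTimeout =>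
    rcases hm with rfl | ⟨-, dp, hp, rfl⟩
    · exact ⟨hsig, fun ct hct => hs.newestCert hr hct⟩
    · exact hs.p _ hp
  case joinView =>
    rcases hm with rfl | ⟨-, dp, hp, rfl⟩
    · exact ⟨hsig, fun ct hct => hs.newestCert hr hct⟩
    · exact hs.p _ hp
  all_goals exact hm.elim

namespace Execution

variable (E : Execution P faulty)

/-- Certificates travel through faulty replicas. Agreement later needs the quorums nested inside
them, so authenticity is tracked for received messages and stored data together. -/
theorem slotAuth (n : ℕ) (i : Replica f) :
    (∀ m ∈ (E.cfg n i).rcvd, m.Authentic faulty (E.cfg n)) ∧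
      ∀ s, SlotAuth faulty (E.cfg n) s ((E.cfg n i).slots s) := by
  induction n with
  | zero =>
    rw [cfg_zero]
    refine ⟨by simp [LocalState.initial], fun s => ⟨?_, ?_, ?_⟩⟩ <;>
      simp [LocalState.initial, SlotState.initial]
  | succ n ih =>
    have hmono : ∀ k m, Signed faulty (E.cfg n) k m → Signed faulty (E.cfg (n + 1)) k m :=
      fun k m => E.signed_mono n.le_succ
    have ih1 : ∀ m ∈ (E.cfg n i).rcvd, m.Authentic faulty (E.cfg (n + 1)) :=
      fun m hm => (ih.1 m hm).mono hmono
    have ih2 : ∀ s, SlotAuth faulty (E.cfg (n + 1)) s ((E.cfg n i).slots s) :=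
      fun s => (ih.2 s).mono hmono
    rcases (E.step n).replica i with h | ⟨ht, hi, h⟩ | ⟨m, hm, h⟩ | ⟨s', dp, D, -, h⟩
    · rw [h]; exact ⟨ih1, ih2⟩
    · obtain ⟨s', ss', M, hs, he⟩ := h.slotStep
      have hM : ∀ m ∈ M, Signed faulty (E.cfg (n + 1)) i m := fun m hm => by
        right; rw [he.sent]; exact .inr hm
      refine ⟨fun m hm => ?_, fun s => ?_⟩
      · rw [he.rcvd] at hm
        rcases hm with hm | ⟨hm, -⟩
        · exact ih1 m hm
        · exact hs.authentic ih1 (ih2 s') hM hm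
      · rw [he.slots, Function.update_apply]
        split
        · next hss => subst hss; exact SlotAuth.step hs ih1 (ih2 s) hM
        · exact ih2 s
    · refine ⟨fun m' hm' => ?_, fun s => ?_⟩
      · rw [h] at hm'
        rcases hm' with rfl | hm'
        · exact hm.mono hmono
        · exact ih1 m' hm'
      · rw [h]; exact ih2 s
    · refine ⟨fun m' hm' => ?_, fun s => ?_⟩
      · rw [h] at hm'
        rcases hm' with hm' | ⟨rfl, -⟩
        · exact ih1 m' hm'
        · right; rw [h]; exact .inr rfl
      · rw [h]; exact ih2 s

/-! ### The local invariants hold in executions -/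

theorem fresh (hfaulty : faulty.card ≤ f) {n : ℕ} {i : Replica f} (hi : i ∉ faulty) {s : Slot f} :
    s.co = i → s.seq = (E.cfg n i).nextSeq →
      (E.cfg n i).slots s = SlotState.initial f Req := by
  rintro rfl h
  exact (E.freshInv hfaulty n).init _ hi s hi h.ge

variable (hrot : P.IsRotation) (hfaulty : faulty.card ≤ f)

include hrot hfaulty

theorem shapeInv (n : ℕ) (i : Replica f) (s : Slot f) :
    ShapeInv s ((E.cfg n i).slots s) (E.cfg n i).rcvd := by
  induction n with
  | zero => rw [cfg_zero]; exact ShapeInv.initial s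
  | succ n ih =>
    rcases E.slot_step n i s with ⟨h1, -, -, h2⟩ | ⟨ss', M, -, hi, hs, h1, -, h2⟩
    · rw [h1]; exact ih.mono h2
    · rw [h1, h2]; exact ih.step hrot.1 hs (E.fresh hfaulty hi) (E.slotBasic n i s)

theorem msgInv (n : ℕ) (i : Replica f) (s : Slot f) :
    MsgInv i s ((E.cfg n i).slots s) (E.cfg n i).sent := by
  induction n with
  | zero => rw [cfg_zero]; exact MsgInv.initial i s
  | succ n ih =>
    rcases E.slot_step n i s with ⟨h1, h3, h4, h2⟩ | ⟨ss', M, -, hi, hs, h1, h3, h2⟩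
    · rw [h1]; exact ih.mono h3 h4
    · rw [h1, h3]
      exact ih.step hs (E.fresh hfaulty hi) (fun m hm h => E.touched_of_sent hm h)
        (E.slotBasic n i s) (E.shapeInv hrot hfaulty n i s)

theorem certInv (n : ℕ) (i : Replica f) (s : Slot f) :
    CertInv s ((E.cfg n i).slots s) (E.cfg n i).sent := by
  induction n with
  | zero => rw [cfg_zero]; exact CertInv.initial s
  | succ n ih =>
    rcases E.slot_step n i s with ⟨h1, h3, h4, h2⟩ | ⟨ss', M, -, hi, hs, h1, h3, h2⟩
    · rw [h1]; exact ih.mono h4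
    · rw [h1, h3]
      exact ih.step hs (E.fresh hfaulty hi) (fun m hm h => E.touched_of_sent hm h)
        (E.slotBasic n i s) (E.shapeInv hrot hfaulty n i s) (E.msgInv hrot hfaulty n i s)

end Execution

/-! ### Agreement within a slot -/

/-- Two sets of `2f + 1` among `3f + 1` replicas share at least `f + 1`, more than can be faulty. -/
theorem exists_correct_inter (hfaulty : faulty.card ≤ f) {K K' : Finset (Replica f)}
    (hK : 2 * f + 1 ≤ K.card) (hK' : 2 * f + 1 ≤ K'.card) : ∃ k ∈ K, k ∈ K' ∧ k ∉ faulty := by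
  have h1 := Finset.card_union_add_card_inter K K'
  have h2 := Finset.card_le_univ (K ∪ K')
  rw [Fintype.card_fin] at h2
  obtain ⟨k, hk, hkf⟩ := exists_correct_of_card hfaulty (K := K ∩ K') (by omega)
  exact ⟨k, (Finset.mem_inter.1 hk).1, (Finset.mem_inter.1 hk).2, hkf⟩

/-- Messages `g k` from `2f + 1` replicas `k` exist. -/
def Quorate (faulty : Finset (Replica f)) (c : Config f Req) (g : Replica f → Msg f Req) : Prop :=
  ∃ K : Finset (Replica f), 2 * f + 1 ≤ K.card ∧ ∀ k ∈ K, Signed faulty c k (g k)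

theorem Quorate.exists_correct (hfaulty : faulty.card ≤ f) {c : Config f Req}
    {g : Replica f → Msg f Req} (h : Quorate faulty c g) : ∃ k ∉ faulty, g k ∈ (c k).sent := by
  obtain ⟨K, hK, hall⟩ := h
  obtain ⟨k, hk, hkf⟩ := exists_correct_of_card hfaulty (K := K) (by omega)
  exact ⟨k, hkf, (hall k hk).resolve_left hkf⟩

theorem Quorate.exists_inter (hfaulty : faulty.card ≤ f) {c c' : Config f Req}
    {g g' : Replica f → Msg f Req} (h : Quorate faulty c g) (h' : Quorate faulty c' g') :
    ∃ k ∉ faulty, g k ∈ (c k).sent ∧ g' k ∈ (c' k).sent := by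
  obtain ⟨K, hK, hall⟩ := h
  obtain ⟨K', hK', hall'⟩ := h'
  obtain ⟨k, hk, hk', hkf⟩ := exists_correct_inter hfaulty hK hK'
  exact ⟨k, hkf, (hall k hk).resolve_left hkf, (hall' k hk').resolve_left hkf⟩

/-- The outcome that belongs to a value. -/
def Value.outcome (val : Value f Req) : Outcome f Req :=
  Option.map (fun x : DepPropose f Req × Verifies f Req =>
    (x.1, {d | x.1.deps d.co = some d.seq ∨ ∃ j dv, x.2 j = some dv ∧
      dv.deps d.co = some d.seq})) val

theorem SlotState.outcome_eq (ss : SlotState f Req) : ss.outcome = Value.outcome ss.value := by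
  unfold SlotState.outcome Value.outcome SlotState.value
  cases ss.p <;> rfl

namespace Execution

variable (E : Execution P faulty)

theorem quorate_of_rcvd {n : ℕ} {i : Replica f} {g : Replica f → Msg f Req}
    (hg : ∀ k, (g k).sender? = some k)
    (h : ∃ K : Finset (Replica f), 2 * f + 1 ≤ K.card ∧ ∀ k ∈ K, g k ∈ (E.cfg n i).rcvd) :
    Quorate faulty (E.cfg n) g := by
  obtain ⟨K, hK, hall⟩ := h
  exact ⟨K, hK, fun k hk => E.signed_of_rcvd (hall k hk) (hg k)⟩

theorem quorate_mono {n n' : ℕ} (h : n ≤ n') {g : Replica f → Msg f Req}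
    (hg : Quorate faulty (E.cfg n) g) : Quorate faulty (E.cfg n') g := by
  obtain ⟨K, hK, hall⟩ := hg
  exact ⟨K, hK, fun k hk => E.signed_mono h (hall k hk)⟩

/-- A correct coordinator makes only one proposal for a slot. -/
theorem propose_unique (hfaulty : faulty.card ≤ f) {n : ℕ} {k : Replica f}
    {dp dp' : DepPropose f Req} (h : Msg.depPropose dp true ∈ (E.cfg n k).sent)
    (h' : Msg.depPropose dp' true ∈ (E.cfg n k).sent) (hs : dp.slot = dp'.slot) : dp = dp' := by
  induction n with
  | zero => simp [cfg_zero, LocalState.initial] at h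
  | succ n ih =>
    have hseq := fun dp => (E.freshInv hfaulty n).sent k dp
    rcases (E.step n).replica k with h1 | ⟨ht, hi, h1⟩ | ⟨m, hm, h1⟩ | ⟨s', dp, D, -, h1⟩
    · rw [h1] at h h'; exact ih h h'
    · obtain ⟨s', ss', M, hst, he⟩ := h1.slotStep
      rw [he.sent] at h h'
      have hnew : ∀ dp, Msg.depPropose dp true ∈ M →
          dp.slot.seq = (E.cfg n k).nextSeq ∧
          ∀ dp', Msg.depPropose dp' true ∈ M → dp = dp' := by
        intro dp hdp
        cases hst with
        | propose r hco hsq =>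
          obtain rfl : dp = _ := by simpa using hdp
          exact ⟨hsq, fun dp' h => by simpa using h.symm⟩
        | _ => simp [LocalState.enterMsgs] at hdp
      rcases h with h | h <;> rcases h' with h' | h'
      · exact ih h h'
      · have h2 := (hnew _ h').1
        have h3 := (hseq _ h).2
        rw [hs] at h3; omega
      · have h2 := (hnew _ h).1
        have h3 := (hseq _ h').2
        rw [hs] at h2; omega
      · exact (hnew _ h).2 _ h'
    · rw [h1] at h h'; exact ih h h'
    · rw [h1] at h h'
      rcases h with h | h
      · rcases h' with h' | h'
        · exact ih h h'
        · simp at h'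
      · simp at h

variable (hrot : P.IsRotation) (hfaulty : faulty.card ≤ f)

include hrot hfaulty

/-- Two fast-path certificates for a slot have the same outcome. -/
theorem fast_outcome_unique {n : ℕ} {s : Slot f} {dp dp' : DepPropose f Req}
    {v v' : Verifies f Req} (h1 : Verified s dp v) (h1' : Verified s dp' v') (h2 : FastMatch v)
    (h2' : FastMatch v') (h3 : Signed faulty (E.cfg n) dp.slot.co (.depPropose dp true))
    (h3' : Signed faulty (E.cfg n) dp'.slot.co (.depPropose dp' true))
    (h4 : ∀ j d, v j = some d → Signed faulty (E.cfg n) d.sender (.depVerify d))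
    (h4' : ∀ j d, v' j = some d → Signed faulty (E.cfg n) d.sender (.depVerify d)) :
    Value.outcome (some (dp, v)) = Value.outcome (some (dp', v')) := by
  have key : ∀ j, j ∉ faulty → ∀ d d', v j = some d → v' j = some d' → d = d' := by
    intro j hj d d' hd hd'
    obtain ⟨a1, a2, a3⟩ := h1.2.2.2 j d hd
    obtain ⟨b1, b2, b3⟩ := h1'.2.2.2 j d' hd'
    have e := h4 j d hd
    have e' := h4' j d' hd'
    rw [a2] at e; rw [b2] at e'
    exact (E.msgInv hrot hfaulty n j s).dv_uniq d d' (e.resolve_left hj) (e'.resolve_left hj) a1 b1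
  -- A correct coordinator proposes once per slot. If it is faulty, at most `f - 1` followers are,
  -- while two quorums of `2f` among the `3f` followers share at least `f`. So a correct follower
  -- has verified both proposals, and it does so only once per slot.
  have hdp : dp = dp' := by
    by_cases hco : s.co ∈ faulty
    · have hcard : faulty.card < (dp.quorum ∩ dp'.quorum).card + 1 := by
        have c1 := h1.2.1.1
        have c2 := h1'.2.1.1
        have c3 := Finset.card_union_add_card_inter dp.quorum dp'.quorum
        have c4 : (dp.quorum ∪ dp'.quorum).card < (Finset.univ : Finset (Replica f)).card := by
          refine Finset.card_lt_card (Finset.ssubset_univ_iff.2 fun h => ?_)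
          have := h ▸ Finset.mem_univ s.co
          rcases Finset.mem_union.1 this with h | h
          · exact h1.2.1.2 h
          · exact h1'.2.1.2 h
        rw [Finset.card_univ, Fintype.card_fin] at c4
        omega
      have hex : ∃ j ∈ dp.quorum ∩ dp'.quorum, j ∉ faulty := by
        by_contra! h
        have hsub : insert s.co (dp.quorum ∩ dp'.quorum) ⊆ faulty := by
          intro j hj
          rcases Finset.mem_insert.1 hj with rfl | hj
          · exact hco
          · exact h j hj
        have h5 := Finset.card_le_card hsub
        rw [Finset.card_insert_of_notMem
          (fun h => h1.2.1.2 (Finset.mem_inter.1 h).1)] at h5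
        omega
      obtain ⟨j, hj, hjf⟩ := hex
      obtain ⟨hj1, hj2⟩ := Finset.mem_inter.1 hj
      obtain ⟨d, hd⟩ := Option.ne_none_iff_exists'.1 ((h1.2.2.1 j).2 hj1)
      obtain ⟨d', hd'⟩ := Option.ne_none_iff_exists'.1 ((h1'.2.2.1 j).2 hj2)
      rw [← (h1.2.2.2 j d hd).2.2, ← (h1'.2.2.2 j d' hd').2.2, key j hjf d d' hd hd']
    · rw [h1.1] at h3; rw [h1'.1] at h3'
      exact E.propose_unique hfaulty (h3.resolve_left hco) (h3'.resolve_left hco)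
        (h1.1.trans h1'.1.symm)
  subst hdp
  -- Faulty followers may sign different `DepVerify`s, so the families need not agree. But each
  -- dependency is reported by `f + 1` followers, hence by a correct one, whose single `DepVerify`
  -- is in both families. This is why outcomes are compared instead of values.
  have hsub : ∀ (v v' : Verifies f Req), Verified s dp v → Verified s dp v' → FastMatch v →
      (∀ j, j ∉ faulty → ∀ d d', v j = some d → v' j = some d' → d = d') →
      ∀ d : Slot f, (∃ j dv, v j = some dv ∧ dv.deps d.co = some d.seq) →
        ∃ j dv, v' j = some dv ∧ dv.deps d.co = some d.seq := by
    intro v v' h1 h1' h2 key d hd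
    obtain ⟨K, hK, hall⟩ := h2 _ _ hd
    obtain ⟨j, hj, hjf⟩ := exists_correct_of_card hfaulty hK
    obtain ⟨dv, hdv, hdep⟩ := hall j hj
    obtain ⟨dv', hdv'⟩ := Option.ne_none_iff_exists'.1
      ((h1'.2.2.1 j).2 ((h1.2.2.1 j).1 (by simp [hdv])))
    exact ⟨j, dv', hdv', key j hjf dv dv' hdv hdv' ▸ hdep⟩
  simp only [Value.outcome, Option.map_some, Option.some.injEq, Prod.mk.injEq, true_and]
  ext d
  exact or_congr_right ⟨hsub v v' h1 h1' h2 key d,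
    hsub v' v h1' h1 h2' (fun j hj d d' h h' => (key j hj d' d h' h).symm) d⟩

/-- A new `Prepare` for a view `≥ 0` stems from a `NewView`. -/
theorem new_prepare {n : ℕ} {k : Replica f} {s : Slot f} {w : ℤ} {k' : Replica f}
    {val : Value f Req} (h : Msg.prepare w s k' val ∈ (E.cfg (n + 1) k).sent)
    (hn : Msg.prepare w s k' val ∉ (E.cfg n k).sent) (hw : 0 ≤ w) :
    ∃ nv : NewView f Req, Msg.newView nv ∈ (E.cfg n k).rcvd ∧ nv.Valid ∧ nv.slot = s ∧
      nv.view = w ∧ nv.val = val := by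
  rcases E.slot_step n k s with ⟨-, -, h4, -⟩ | ⟨ss', M, -, hi, hs, -, h3, -⟩
  · exact ((h4 _ h).elim hn fun h => h rfl).elim
  · rw [h3] at h
    have h := h.resolve_left hn
    cases hs with
    | rpVerify dp hph hp hall hslow =>
      obtain ⟨rfl, -⟩ : w = _ ∧ _ := by simpa using h
      have := (E.shapeInv hrot hfaulty n k s).phase_of_nonneg hw
      simp [hph] at this
    | installView nv h1 h2 hvalid h4 h5 =>
      obtain ⟨rfl, -, rfl⟩ : w = _ ∧ _ ∧ val = _ := by simpa using h
      exact ⟨nv, h2, hvalid, h1, rfl, rfl⟩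
    | _ => simp [LocalState.enterMsgs] at h

-- A correct replica sends `Commit` only when rp-prepared, so a single one of its `Commit`s is
-- evidence of a whole quorum of `Prepare`s.
omit hrot hfaulty in
theorem commit_prepared {n : ℕ} {k : Replica f} {s : Slot f} {w : ℤ} {k' : Replica f}
    {val : Value f Req} (h : Msg.commit w s k' val ∈ (E.cfg n k).sent) :
    -1 ≤ w ∧ Quorate faulty (E.cfg n) fun k => .prepare w s k val := by
  induction n with
  | zero => simp [cfg_zero, LocalState.initial] at h
  | succ n ih =>
    by_cases hn : Msg.commit w s k' val ∈ (E.cfg n k).sent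
    · exact ⟨(ih hn).1, E.quorate_mono n.le_succ (ih hn).2⟩
    rcases E.slot_step n k s with ⟨-, -, h4, -⟩ | ⟨ss', M, -, hi, hs, -, h3, -⟩
    · exact ((h4 _ h).elim hn fun h => h rfl).elim
    · rw [h3] at h
      have h := h.resolve_left hn
      cases hs with
      | rpPrepare hph hq =>
        obtain ⟨rfl, -, rfl⟩ : w = _ ∧ _ ∧ val = _ := by simpa using h
        exact ⟨(E.slotBasic n k s).view_ge,
          E.quorate_mono n.le_succ (E.quorate_of_rcvd (fun _ => rfl) hq)⟩
      | _ => simp [LocalState.enterMsgs] at h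

omit hrot hfaulty in
theorem depCommit_auth {n : ℕ} {k : Replica f} {s : Slot f} {k' : Replica f}
    {dp : DepPropose f Req} {v : Verifies f Req}
    (h : Msg.depCommit s k' (some (dp, v)) ∈ (E.cfg n k).sent) :
    Signed faulty (E.cfg n) dp.slot.co (.depPropose dp true) ∧
      ∀ j d, v j = some d → Signed faulty (E.cfg n) d.sender (.depVerify d) := by
  induction n with
  | zero => simp [cfg_zero, LocalState.initial] at h
  | succ n ih =>
    by_cases hn : Msg.depCommit s k' (some (dp, v)) ∈ (E.cfg n k).sent
    · exact ⟨E.signed_mono n.le_succ (ih hn).1,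
        fun j d hd => E.signed_mono n.le_succ ((ih hn).2 j d hd)⟩
    rcases E.slot_step n k s with ⟨-, -, h4, -⟩ | ⟨ss', M, -, hi, hs, -, h3, -⟩
    · exact ((h4 _ h).elim hn fun h => h rfl).elim
    · rw [h3] at h
      have h := h.resolve_left hn
      cases hs with
      | fpVerify dp' hph hp hall hfast =>
        obtain ⟨-, h5⟩ : _ ∧ some (dp, v) = ((E.cfg n k).slots s).value := by simpa using h
        simp only [SlotState.value, hp, Option.map_some, Option.some.injEq, Prod.mk.injEq] at h5
        obtain ⟨rfl, rfl⟩ := h5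
        have := (E.slotAuth n k).2 s
        exact ⟨E.signed_mono n.le_succ (this.p _ hp),
          fun j d hd => E.signed_mono n.le_succ (this.v j d hd)⟩
      | _ => simp [LocalState.enterMsgs] at h

/-- A correct replica common to both quorums sends only one `Prepare` per view. -/
theorem prepared_unique {n n' : ℕ} {s : Slot f} {w : ℤ} {val val' : Value f Req}
    (h : Quorate faulty (E.cfg n) fun k => .prepare w s k val)
    (h' : Quorate faulty (E.cfg n') fun k => .prepare w s k val') : val = val' := by
  obtain ⟨k, hk, h1, h2⟩ := h.exists_inter hfaulty h'
  exact (E.msgInv hrot hfaulty (max n n') k s).pr_uniq w k val k val'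
    (E.sent_mono k (le_max_left _ _) h1) (E.sent_mono k (le_max_right _ _) h2)

omit hrot hfaulty in
/-- Reconciliation-path certificates in authentic messages stem from a quorum of `Prepare`s. -/
theorem quorate_of_cert {n : ℕ} {nv : NewView f Req} (hv : nv.Valid)
    (ha : (Msg.newView nv).Authentic faulty (E.cfg n)) {k : Replica f} {vc : ViewChange f Req}
    (hk : nv.vcs k = some vc) {val : Value f Req} {u : ℤ} {K : Finset (Replica f)}
    (hc : vc.cert = some (.rpc val u K)) :
    -1 ≤ u ∧ Quorate faulty (E.cfg n) fun k => .prepare u nv.slot k val := by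
  obtain ⟨h1, h2, h3, h4⟩ := hv.2.2.2.1 k vc hk
  have h5 := h4.2 _ hc
  have h6 := ((ha.2 k vc hk).2 _ hc).2
  rw [h2] at h6
  exact ⟨h5.2.1, K, h5.2.2, h6⟩

omit hrot in
/-- A quorum of messages that all members have sent at some time and the `ViewChange`s of a
`NewView` have a correct replica in common. -/
theorem exists_viewChange_inter {n N : ℕ} {nv : NewView f Req} (hv : nv.Valid)
    (ha : (Msg.newView nv).Authentic faulty (E.cfg n)) {g : Replica f → Msg f Req}
    (h : Quorate faulty (E.cfg N) g) : ∃ k ∉ faulty, ∃ vc, nv.vcs k = some vc ∧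
      vc.slot = nv.slot ∧ vc.view = nv.view ∧ Msg.viewChange vc ∈ (E.cfg (max n N) k).sent ∧
      g k ∈ (E.cfg (max n N) k).sent := by
  obtain ⟨K, hK, hall⟩ := h
  obtain ⟨K', hK', hall'⟩ := hv.2.2.1
  obtain ⟨k, hk, hk', hkf⟩ := exists_correct_inter hfaulty hK hK'
  obtain ⟨vc, hvc⟩ := Option.ne_none_iff_exists'.1 (hall' k hk')
  obtain ⟨h1, h2, h3, -⟩ := hv.2.2.2.1 k vc hvc
  have h4 := (ha.2 k vc hvc).1
  rw [h1] at h4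
  exact ⟨k, hkf, vc, hvc, h2, h3, E.sent_mono k (le_max_left _ _) (h4.resolve_left hkf),
    E.sent_mono k (le_max_right _ _) ((hall k hk).resolve_left hkf)⟩

/-- Once a value can rp-commit in some view, only this value is prepared in higher views. -/
theorem prepare_of_commit {N : ℕ} {s : Slot f} {w : ℤ} {val : Value f Req}
    (h : Quorate faulty (E.cfg N) fun k => .commit w s k val) {n : ℕ} {k : Replica f} {w' : ℤ}
    {val' : Value f Req} (h' : Msg.prepare w' s k val' ∈ (E.cfg n k).sent)
    (hw : w < w') : val' = val := by
  obtain ⟨k0, -, h0⟩ := h.exists_correct hfaulty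
  have hprep := E.commit_prepared h0
  -- The induction is on the moment of sending: the `NewView` behind a `Prepare` quotes certificates
  -- whose `Prepare`s were sent strictly earlier.
  induction n generalizing k w' val' with
  | zero => simp [cfg_zero, LocalState.initial] at h'
  | succ n ih =>
    by_cases hn : Msg.prepare w' s k val' ∈ (E.cfg n k).sent
    · exact ih hn hw
    obtain ⟨nv, h1, h2, rfl, rfl, rfl⟩ := E.new_prepare hrot hfaulty h' hn (by omega)
    have ha := (E.slotAuth n k).1 _ h1
    obtain ⟨k1, hk1, vc, h3, h4, h5, h6, h7⟩ :=
      E.exists_viewChange_inter hfaulty h2 ha h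
    obtain ⟨val1, u, K1, h8, h9⟩ := (E.certInv hrot hfaulty (max n N) k1 nv.slot).commit_vc
      w k1 val vc h7 h6 h4 (by omega)
    rcases h2.2.2.2.2 with ⟨k2, vc2, u2, K2, h10, h11, h12⟩ | ⟨h10, -⟩ | ⟨h10, -⟩
    -- The common correct replica reports a certificate of view at least `w`, so the selected one
    -- has view `u2 ≥ w`. For `u2 = w`, two `Prepare` quorums of one view meet; for `u2 > w`, the
    -- induction hypothesis applies.
    · have h13 := h12 _ _ _ _ _ h3 h8
      obtain ⟨-, h14⟩ := E.quorate_of_cert h2 ha h10 h11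
      rcases (h9.trans h13).eq_or_lt with rfl | hlt
      · exact E.prepared_unique hrot hfaulty h14 hprep.2
      · obtain ⟨k3, -, h15⟩ := h14.exists_correct hfaulty
        exact ih h15 hlt
    · exact (h10 _ _ _ _ _ h3 h8).elim
    · have := h10 _ _ h3; rw [h8] at this; simp at this

/-- Once a value can fp-commit, only values with its outcome are prepared in view changes. -/
theorem prepare_of_depCommit {N : ℕ} {s : Slot f} {val : Value f Req}
    (h : Quorate faulty (E.cfg N) fun k => .depCommit s k val) {n : ℕ} {k : Replica f} {w' : ℤ}
    {val' : Value f Req} (h' : Msg.prepare w' s k val' ∈ (E.cfg n k).sent)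
    (hw : 0 ≤ w') : Value.outcome val' = Value.outcome val := by
  obtain ⟨k0, -, h0⟩ := h.exists_correct hfaulty
  obtain ⟨dp, v, rfl, hver, hfast⟩ := (E.certInv hrot hfaulty N k0 s).depCommit_spec _ _ h0
  have hauth := E.depCommit_auth h0
  induction n generalizing k w' val' with
  | zero => simp [cfg_zero, LocalState.initial] at h'
  | succ n ih =>
    by_cases hn : Msg.prepare w' s k val' ∈ (E.cfg n k).sent
    · exact ih hn hw
    obtain ⟨nv, h1, h2, rfl, rfl, rfl⟩ := E.new_prepare hrot hfaulty h' hn hw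
    have ha := (E.slotAuth n k).1 _ h1
    obtain ⟨k1, hk1, vc, h3, h4, h5, h6, h7⟩ :=
      E.exists_viewChange_inter hfaulty h2 ha h
    have h8 := (E.certInv hrot hfaulty (max n N) k1 nv.slot).depCommit_vc _ _ vc h7 h6 h4
    rcases h2.2.2.2.2 with ⟨k2, vc2, u2, K2, h10, h11, h12⟩ | ⟨-, k2, vc2, dp2, v2, h10, h11, h12⟩
      | ⟨h10, -⟩
    · obtain ⟨h13, h14⟩ := E.quorate_of_cert h2 ha h10 h11
      rcases h13.eq_or_lt with rfl | hlt
      · obtain ⟨k3, hk3, h15, h16⟩ := h14.exists_inter hfaulty h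
        exact ((E.msgInv hrot hfaulty (max n N) k3 nv.slot).pr_dc _ _ _ _
          (E.sent_mono _ (le_max_left _ _) h15) (E.sent_mono _ (le_max_right _ _) h16)).elim
      · obtain ⟨k3, -, h15⟩ := h14.exists_correct hfaulty
        exact ih h15 (by omega)
    · obtain ⟨b1, b2, b3, b4⟩ := h2.2.2.2.1 k2 vc2 h10
      have h13 := b4.2 _ h11
      have h14 := (ha.2 k2 vc2 h10).2 _ h11
      rw [b2] at h13
      rw [h12]
      exact E.fast_outcome_unique hrot hfaulty (n := max n N) h13.1 hver h13.2 hfast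
        (E.signed_mono (le_max_left _ _) h14.1) (E.signed_mono (le_max_right _ _) hauth.1)
        (fun j d hd => E.signed_mono (le_max_left _ _) (h14.2 j d hd))
        (fun j d hd => E.signed_mono (le_max_right _ _) (hauth.2 j d hd))
    · exact (h8 (h10 _ _ h3)).elim

omit hrot hfaulty in
/-- Enough messages exist for some replica to commit the slot with outcome `o`. -/
def Decided (n : ℕ) (s : Slot f) (o : Outcome f Req) : Prop :=
  (∃ val, o = Value.outcome val ∧ Quorate faulty (E.cfg n) fun k => .depCommit s k val) ∨
    ∃ w val, o = Value.outcome val ∧ Quorate faulty (E.cfg n) fun k => .commit w s k val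

/-- Two fast commits share a correct replica with a single `DepCommit`. Two reconciliation commits
are compared by view. A fast commit excludes a `Prepare` quorum in view `-1` and fixes the outcome
of every later `Prepare`. -/
theorem decided_unique {n n' : ℕ} {s : Slot f} {o o' : Outcome f Req} (h : E.Decided n s o)
    (h' : E.Decided n' s o') : o = o' := by
  have hmixed : ∀ {n n' : ℕ} {val : Value f Req} {w : ℤ} {val' : Value f Req},
      (Quorate faulty (E.cfg n) fun k => .depCommit s k val) →
      (Quorate faulty (E.cfg n') fun k => .commit w s k val') →
      Value.outcome val = Value.outcome val' := by
    intro n n' val w val' h h'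
    obtain ⟨k, -, hk⟩ := h'.exists_correct hfaulty
    obtain ⟨h1, h2⟩ := E.commit_prepared hk
    rcases h1.eq_or_lt with rfl | h1
    · obtain ⟨k3, hk3, h15, h16⟩ := h2.exists_inter hfaulty h
      exact ((E.msgInv hrot hfaulty (max n' n) k3 s).pr_dc _ _ _ _
        (E.sent_mono _ (le_max_left _ _) h15) (E.sent_mono _ (le_max_right _ _) h16)).elim
    · obtain ⟨k', -, hk'⟩ := h2.exists_correct hfaulty
      exact (E.prepare_of_depCommit hrot hfaulty h hk' (by omega)).symm
  have hrp : ∀ {n n' : ℕ} {val : Value f Req} {w w' : ℤ} {val' : Value f Req},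
      (Quorate faulty (E.cfg n) fun k => .commit w s k val) →
      (Quorate faulty (E.cfg n') fun k => .commit w' s k val') → w ≤ w' → val' = val := by
    intro n n' val w w' val' h h' hw
    obtain ⟨k, -, hk⟩ := h.exists_correct hfaulty
    obtain ⟨k', -, hk'⟩ := h'.exists_correct hfaulty
    have h1 := E.commit_prepared hk
    have h2 := E.commit_prepared hk'
    rcases hw.eq_or_lt with rfl | hw
    · exact E.prepared_unique hrot hfaulty h2.2 h1.2
    · obtain ⟨k3, -, hk3⟩ := h2.2.exists_correct hfaulty
      exact E.prepare_of_commit hrot hfaulty h hk3 hw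
  rcases h with ⟨val, rfl, h⟩ | ⟨w, val, rfl, h⟩ <;>
    rcases h' with ⟨val', rfl, h'⟩ | ⟨w', val', rfl, h'⟩
  · obtain ⟨k, hk, h1, h2⟩ := h.exists_inter hfaulty h'
    rw [(E.msgInv hrot hfaulty (max n n') k s).dc_uniq k val k val'
      (E.sent_mono k (le_max_left _ _) h1) (E.sent_mono k (le_max_right _ _) h2)]
  · exact hmixed h h'
  · exact (hmixed h' h).symm
  · rcases le_total w w' with hw | hw
    · rw [hrp h h' hw]
    · rw [hrp h' h hw]

/-- Results stem from commits of correct replicas. -/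
theorem committed_of_exec {n : ℕ} {i : Replica f} (hi : i ∉ faulty) {s : Slot f}
    {o : Outcome f Req} (h : ((E.cfg n i).slots s).exec = some o) :
    ∃ n' i', i' ∉ faulty ∧ (((E.cfg n' i').slots s).phase = .fpCommitted ∨
      ((E.cfg n' i').slots s).phase = .rpCommitted) ∧ ((E.cfg n' i').slots s).outcome = o := by
  induction n generalizing i with
  | zero => simp [cfg_zero, LocalState.initial, SlotState.initial] at h
  | succ n ih =>
    rcases E.slot_step n i s with ⟨h1, -, -, -⟩ | ⟨ss', M, -, -, hs, h1, h3, -⟩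
    · rw [h1] at h; exact ih hi h
    · rcases hex : ((E.cfg n i).slots s).exec with _ | o'
      · have h2 := h
        rw [h1] at h2
        cases hs with
        | fpCommit hph hq =>
          rw [hex] at h2
          refine ⟨n + 1, i, hi, .inl (by rw [h1]), ?_⟩
          rw [h1]; exact Option.some.inj h2
        | rpCommit hph hq =>
          rw [hex] at h2
          refine ⟨n + 1, i, hi, .inr (by rw [h1]), ?_⟩
          rw [h1]; exact Option.some.inj h2
        | learn o' he hq =>
          obtain rfl : o' = o := Option.some.inj h2
          obtain ⟨K, hK, hall⟩ := hq
          -- One of the matching answers is from a correct replica, which had the result earlier.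
          obtain ⟨k, hk, hkf⟩ := exists_correct_of_card hfaulty hK
          have := E.sent_of_rcvd (hall k hk) rfl hkf
          exact ih hkf ((E.msgInv hrot hfaulty n k s).exec_spec _ _ _ this).2
        | _ => simp [LocalState.enterSlot, hex] at h2
      · suffices o' = o by subst this; exact ih hi hex
        rw [h1] at h
        cases hs <;> simp [LocalState.enterSlot, hex] at h <;> first | exact h | skip
        simp_all

/-- Every result goes back to a commit and thus to a quorum that decides the slot. Liveness needs
this safety property so that the answers to a query match. -/
theorem exec_agree {n n' : ℕ} {i i' : Replica f} (hi : i ∉ faulty) (hi' : i' ∉ faulty)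
    {s : Slot f} {o o' : Outcome f Req} (h : ((E.cfg n i).slots s).exec = some o)
    (h' : ((E.cfg n' i').slots s).exec = some o') : o = o' := by
  have key : ∀ {n : ℕ} {i : Replica f} {o : Outcome f Req}, i ∉ faulty →
      ((E.cfg n i).slots s).exec = some o → ∃ N, E.Decided N s o := by
    intro n i o hi h
    obtain ⟨N, k, hk, h1, h2⟩ := E.committed_of_exec hrot hfaulty hi h
    rw [SlotState.outcome_eq] at h2
    refine ⟨N, ?_⟩
    rcases h1 with h1 | h1
    · exact .inl ⟨_, h2.symm, E.quorate_of_rcvd (fun _ => rfl)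
        ((E.shapeInv hrot hfaulty N k s).fpCommitted h1)⟩
    · exact .inr ⟨_, _, h2.symm, E.quorate_of_rcvd (fun _ => rfl)
        ((E.shapeInv hrot hfaulty N k s).committed h1)⟩
  obtain ⟨N, hN⟩ := key hi h
  obtain ⟨N', hN'⟩ := key hi' h'
  exact E.decided_unique hrot hfaulty hN hN'

/-- Turns the goal into knowledge: it is enough that some correct replica ever has a result with
this request. -/
theorem commits_of_exec {n : ℕ} {i : Replica f} (hi : i ∉ faulty) {s : Slot f}
    {dp : DepPropose f Req} {D : Set (Slot f)}
    (h : ((E.cfg n i).slots s).exec = some (some (dp, D))) : E.Commits dp.req := by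
  obtain ⟨N, k, hk, h1, h2⟩ := E.committed_of_exec hrot hfaulty hi h
  obtain ⟨dp', h3, h4⟩ := Option.map_eq_some_iff.1 h2
  obtain ⟨rfl, -⟩ := Prod.mk.inj h4
  exact ⟨N, k, hk, s, dp', h3, rfl, h1⟩

end Execution

/-! ### Accepted slots -/

namespace Execution

variable (E : Execution P faulty)

theorem view_succ (n : ℕ) (i : Replica f) (s : Slot f) :
    ((E.cfg n i).slots s).view ≤ ((E.cfg (n + 1) i).slots s).view := by
  rcases E.slot_step n i s with ⟨h1, -⟩ | ⟨ss', M, -, -, hs, h1, -, -⟩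
  · rw [h1]
  · rw [h1]
    cases hs <;> simp only [LocalState.enterSlot, le_refl] <;> omega

theorem view_mono (i : Replica f) (s : Slot f) {n n' : ℕ} (h : n ≤ n') :
    ((E.cfg n i).slots s).view ≤ ((E.cfg n' i).slots s).view :=
  monotone_nat_of_le_succ (f := fun n => ((E.cfg n i).slots s).view)
    (fun n => E.view_succ n i s) h

theorem _root_.Isos.LocalState.ManyVerifies.mono {st st' : LocalState f Req} {d : Slot f}
    (h : st.ManyVerifies d) (hr : st.rcvd ⊆ st'.rcvd) : st'.ManyVerifies d := by
  obtain ⟨K, hK, hall⟩ := h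
  exact ⟨K, hK, fun k hk => (hall k hk).imp fun dv hdv => ⟨hr hdv.1, hdv.2⟩⟩

theorem _root_.Isos.LocalState.Reached.mono {st st' : LocalState f Req} {d : Slot f} {w w' : ℤ}
    {q q' : ℕ} (h : st.Reached d w q) (hr : st.rcvd ⊆ st'.rcvd) (hw : w' ≤ w) (hq : q' ≤ q) :
    st'.Reached d w' q' := by
  obtain ⟨K, hK, hall⟩ := h
  refine ⟨K, hq.trans hK, fun k hk => (hall k hk).imp fun vc hvc => ?_⟩
  exact ⟨hr hvc.1, hvc.2.1, hvc.2.2.1, hvc.2.2.2.1, hw.trans hvc.2.2.2.2⟩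

/-- Neither alternative alone suffices in general: installing a no-op erases the proposal, but it
happens only in a view `≥ 0`. -/
theorem started_succ {n : ℕ} {i : Replica f} {s : Slot f}
    (h : ((E.cfg n i).slots s).p ≠ none ∨ 0 ≤ ((E.cfg n i).slots s).view) :
    ((E.cfg (n + 1) i).slots s).p ≠ none ∨ 0 ≤ ((E.cfg (n + 1) i).slots s).view := by
  rcases h with h | h
  · rcases E.slot_step n i s with ⟨h1, -⟩ | ⟨ss', M, -, -, hs, h1, -, -⟩
    · rw [h1]; exact .inl h
    · have hvc := (E.slotBasic n i s).vc
      rw [h1]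
      cases hs <;> first | exact .inl h | skip
      · simp
      · simp
      · rename_i hph _; exact .inr (hvc hph).1
  · exact .inr (h.trans (E.view_succ n i s))

theorem accepts_mono {n n' : ℕ} (hn : n ≤ n') {i : Replica f} {d : Slot f}
    (h : (E.cfg n i).Accepts d) : (E.cfg n' i).Accepts d := by
  rcases h with h | h | h
  · exact .inl (h.mono (E.rcvd_mono i hn))
  · exact .inr (.inl (h.mono (E.rcvd_mono i hn) le_rfl le_rfl))
  · refine .inr (.inr ?_)
    induction hn with
    | refl => exact h
    | step _ ih => exact E.started_succ ih

/-- Only finitely many slots are in use. -/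
theorem finite_slots (n : ℕ) (i : Replica f) :
    {s | (E.cfg n i).slots s ≠ SlotState.initial f Req}.Finite := by
  induction n with
  | zero => simp [cfg_zero, LocalState.initial]
  | succ n ih =>
    rcases (E.step n).replica i with h | ⟨ht, hi, h⟩ | ⟨m, -, h⟩ | ⟨s', dp, D, -, h⟩
    · rwa [h]
    · obtain ⟨s', ss', M, hs, he⟩ := h.slotStep
      refine (ih.insert s').subset fun s hs => ?_
      by_cases hss : s = s'
      · exact .inl hss
      · right
        simpa [he.slots, hss] using hs
    · rwa [h]
    · rwa [h]

/-- The dependencies that a replica determines are slots it has accepted. -/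
theorem conflicts_spec {n : ℕ} {i : Replica f} {r : Req} {k : Replica f} {q : ℕ}
    (h : (E.cfg n i).conflicts P r k = some q) : ((E.cfg n i).slots ⟨k, q⟩).p ≠ none := by
  unfold LocalState.conflicts at h
  dsimp only at h
  split at h
  · next hne =>
    -- Boundedness makes the supremum in `conflicts` an attained maximum; for an unbounded set of
    -- naturals `sSup` would be the default `0`.
    have hfin : {q | ((E.cfg n i).slots ⟨k, q⟩).hasReq = true ∧
        ∃ dp, ((E.cfg n i).slots ⟨k, q⟩).p = some dp ∧ P.conflict dp.req r}.Finite := by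
      refine ((E.finite_slots n i).image Slot.seq).subset ?_
      rintro q ⟨h1, -⟩
      refine ⟨⟨k, q⟩, fun h => ?_, rfl⟩
      rw [h] at h1
      simp [SlotState.initial] at h1
    obtain ⟨-, dp, hdp, -⟩ := Nat.sSup_mem hne hfin.bddAbove
    rw [Option.some.inj h] at hdp
    simp [hdp]
  · simp at h

theorem accepts_conflicts {n : ℕ} {i : Replica f} {r : Req} :
    (E.cfg n i).AcceptsAll ((E.cfg n i).conflicts P r) :=
  fun _ _ h => .inr (.inr (.inl (E.conflicts_spec h)))

/-- A coordinator has accepted all of its previous slots. -/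
theorem own_started (n : ℕ) (i : Replica f) (q : ℕ) (hq : q < (E.cfg n i).nextSeq) :
    ((E.cfg n i).slots ⟨i, q⟩).p ≠ none ∨ 0 ≤ ((E.cfg n i).slots ⟨i, q⟩).view := by
  induction n with
  | zero => simp [cfg_zero, LocalState.initial] at hq
  | succ n ih =>
    by_cases hq' : q < (E.cfg n i).nextSeq
    · exact E.started_succ (ih hq')
    rcases (E.step n).replica i with h | ⟨ht, hi, h⟩ | ⟨m, -, h⟩ | ⟨s', dp, D, -, h⟩
    · rw [h] at hq; exact (hq' hq).elim
    · obtain ⟨s', ss', M, hs, he⟩ := h.slotStep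
      by_cases hM : ∃ dp, Msg.depPropose dp true ∈ M
      · obtain ⟨dp, hdp⟩ := hM
        have h1 := he.nextSeq_lt dp hdp
        rw [he.slots]
        cases hs with
        | propose r hco hseq =>
          have : s' = ⟨i, q⟩ := by
            have : s'.seq = q := by omega
            subst hco this; rfl
          subst this
          simp
        | _ => simp [LocalState.enterMsgs] at hdp
      · push Not at hM
        rw [he.nextSeq_eq hM] at hq; exact (hq' hq).elim
    · rw [h] at hq; exact (hq' hq).elim
    · rw [h] at hq; exact (hq' hq).elim

/-! ### Timely delivery and the spread of accepted slots -/

/-- From time `G` on, messages between correct replicas are delivered within less than `Δ`. -/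
def Delivers (G : ℝ) : Prop :=
  E.time 0 ≤ G ∧ ∀ T, G ≤ T → ∃ T', T ≤ T' ∧ T' < T + P.delta ∧
    ∀ i, i ∉ faulty → ∀ j, j ∉ faulty → ∀ m ∈ (E.cfg (E.idx T) i).sent, m.AddressedTo j →
      m ∈ (E.cfg (E.idx T') j).rcvd

variable {E}

theorem Delivers.rcvd {G : ℝ} (hG : E.Delivers G) {i j : Replica f} (hi : i ∉ faulty)
    (hj : j ∉ faulty) {n : ℕ} {m : Msg f Req} (hm : m ∈ (E.cfg n i).sent) (ha : m.AddressedTo j)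
    {T : ℝ} (hT1 : E.time n + P.delta ≤ T) (hT2 : G + P.delta ≤ T) :
    m ∈ (E.cfg (E.idx T) j).rcvd := by
  obtain ⟨T', h1, h2, h3⟩ := hG.2 (max (E.time n) G) (le_max_right _ _)
  refine E.rcvd_mono j (E.idx_mono ?_)
    (h3 i hi j hj m (E.sent_mono i (E.le_idx (le_max_left _ _)) hm) ha)
  rcases max_cases (E.time n) G with ⟨h, -⟩ | ⟨h, -⟩ <;> rw [h] at h2 <;> linarith

variable (E)

variable (hrot : P.IsRotation) (hfaulty : faulty.card ≤ f)

include hrot hfaulty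

omit hrot in
/-- Whatever happens in a slot at correct replicas starts with a proposal in view `-1`. -/
theorem exists_origin {n : ℕ} {k : Replica f} (hk : k ∉ faulty) {d : Slot f}
    (h : ((E.cfg n k).slots d).Touched) : ∃ m ≤ n, ∃ k' ∉ faulty,
      ((E.cfg m k').slots d).p ≠ none ∧ ((E.cfg m k').slots d).view = -1 := by
  induction n generalizing k with
  | zero => rw [cfg_zero] at h; exact (SlotState.not_touched_initial h).elim
  | succ n ih =>
    by_cases hold : ∃ j ∉ faulty, ((E.cfg n j).slots d).Touched
    · obtain ⟨j, hj, hjt⟩ := hold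
      obtain ⟨m, hm, h⟩ := ih hj hjt
      exact ⟨m, hm.trans n.le_succ, h⟩
    · push Not at hold
      have h0 : ∀ j, j ∉ faulty → (E.cfg n j).slots d = SlotState.initial f Req :=
        fun j hj => E.eq_initial_of_not_touched (hold j hj)
      rcases E.slot_step n k d with ⟨h1, -⟩ | ⟨ss', M, -, -, hs, h1, -, -⟩
      · rw [h1] at h; exact (hold k hk h).elim
      · refine ⟨n + 1, le_rfl, k, hk, ?_⟩
        rw [h1]
        exact (E.first_step hfaulty hk h0 hs).1

/-- Counts of `f + 1` messages include one from a correct replica, so faulty replicas alone cannot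
make a slot pass `wait`. -/
theorem touched_of_accepts {n : ℕ} {i : Replica f} (hi : i ∉ faulty) {d : Slot f}
    (h : (E.cfg n i).Accepts d) : ∃ k ∉ faulty, ((E.cfg n k).slots d).Touched := by
  rcases h with ⟨K, hK, hall⟩ | ⟨K, hK, hall⟩ | h | h
  · obtain ⟨k, hk, hkf⟩ := exists_correct_of_card hfaulty hK
    obtain ⟨dv, h1, h2, h3⟩ := hall k hk
    exact ⟨k, hkf, E.touched_of_sent (E.sent_of_rcvd h1 (by simp [Msg.sender?, h3]) hkf)
      (by simp [Msg.slot?, h2])⟩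
  · obtain ⟨k, hk, hkf⟩ := exists_correct_of_card hfaulty hK
    obtain ⟨vc, h1, -, h2, h3, -⟩ := hall k hk
    exact ⟨k, hkf, E.touched_of_sent (E.sent_of_rcvd h1 (by simp [Msg.sender?, h3]) hkf)
      (by simp [Msg.slot?, h2])⟩
  · exact ⟨i, hi, .inr (.inl h)⟩
  · refine ⟨i, hi, .inl fun h' => ?_⟩
    have := (E.shapeInv hrot hfaulty n i d).phase_of_nonneg h
    simp [h'] at this

omit hrot hfaulty in
/-- How a replica comes to know the proposal of a slot in view `-1`. -/
theorem accept_step {n : ℕ} {k : Replica f} {d : Slot f}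
    (h : ((E.cfg n k).slots d).p = none) (h' : ((E.cfg (n + 1) k).slots d).p ≠ none)
    (hv : ((E.cfg (n + 1) k).slots d).view = -1) :
    ∃ dp, ((E.cfg (n + 1) k).slots d).p = some dp ∧
      (E.cfg n k).AcceptsAll dp.deps ∧
      (∀ q, d.seq = q + 1 → (E.cfg n k).Accepts ⟨d.co, q⟩) ∧
      (Msg.depPropose dp true ∈ (E.cfg (n + 1) k).sent ∨
        ((E.cfg (n + 1) k).slots d).proposeTimer = some (E.time n + 2 * P.delta)) := by
  rcases E.slot_step n k d with ⟨h1, -⟩ | ⟨ss', M, -, -, hs, h1, h2, -⟩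
  · rw [h1] at h'; exact (h' h).elim
  · rw [h1] at h' hv ⊢
    rw [h2]
    have hvc := (E.slotBasic n k d).vc
    cases hs with
    | propose r hco hseq =>
      refine ⟨_, rfl, E.accepts_conflicts, fun q hq => ?_, .inl (.inr rfl)⟩
      rw [hco]
      exact .inr (.inr (E.own_started n k q (by omega)))
    | acceptPropose dp b hs' hm hF hview hp hwait hprev =>
      exact ⟨dp, rfl, hwait, hprev, .inr rfl⟩
    | installView nv _ _ _ hph hview =>
      have := (hvc hph).1
      dsimp only at hv
      omega
    | _ => exact (h' h).elim

/-- A replica that has accepted a proposal forwards it when the propose timer expires, unless it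
has received all `DepVerify`s. -/
theorem forward {n : ℕ} {k : Replica f} (hk : k ∉ faulty) {d : Slot f} {dp : DepPropose f Req}
    {t : ℝ} (hp : ((E.cfg n k).slots d).p = some dp) (hv : ((E.cfg n k).slots d).view = -1)
    (ht : ((E.cfg n k).slots d).proposeTimer = some t) {T : ℝ} (h0 : E.time 0 ≤ T)
    (hT : t ≤ T) (hnT : E.time n ≤ T) :
    Msg.depPropose dp false ∈ (E.cfg (E.idx T) k).sent ∨
      ∀ j ∈ dp.quorum, ∃ dv, Msg.depVerify dv ∈ (E.cfg (E.idx T) k).rcvd ∧ dv.slot = d ∧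
        dv.sender = j := by
  have key : ∀ m, n ≤ m → (((E.cfg m k).slots d).p = some dp ∧ ((E.cfg m k).slots d).view = -1 ∧
      ((E.cfg m k).slots d).proposeTimer = some t) ∨
      Msg.depPropose dp false ∈ (E.cfg m k).sent ∨
      ∀ j ∈ dp.quorum, ∃ dv, Msg.depVerify dv ∈ (E.cfg m k).rcvd ∧ dv.slot = d ∧
        dv.sender = j := by
    intro m hm
    induction hm with
    | refl => exact .inl ⟨hp, hv, ht⟩
    | @step m hm ih =>
      rcases ih with ⟨hp, hv, ht⟩ | h | h
      · have hshape := E.shapeInv hrot hfaulty (m + 1) k d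
        have hfresh := E.fresh hfaulty hk (n := m) (s := d)
        have hvc := (E.slotBasic m k d).vc
        rcases E.slot_step m k d with ⟨h1, -⟩ | ⟨ss', M, -, -, hs, h1, h2, -⟩
        · rw [h1]; exact .inl ⟨hp, hv, ht⟩
        · have hfwd : (∀ x ∈ (E.cfg m k).enterMsgs k d (((E.cfg m k).slots d).view + 1), x ∈ M) ∨
              (∃ w, ∀ m' ∈ (E.cfg m k).enterMsgs k d w, m' ∈ M) →
              Msg.depPropose dp false ∈ (E.cfg (m + 1) k).sent := by
            intro h
            rw [h2]
            right
            have hmem : ∀ w, Msg.depPropose dp false ∈ (E.cfg m k).enterMsgs k d w :=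
              fun w => .inr ⟨by simp [ht], dp, hp, rfl⟩
            rcases h with h | ⟨w, h⟩
            · exact h _ (hmem _)
            · exact h _ (hmem _)
          rw [h1] at hshape ⊢
          cases hs with
          | propose r hco hseq => rw [hfresh hco hseq] at hp; simp [SlotState.initial] at hp
          | acceptPropose _ _ _ _ _ _ hp' => rw [hp] at hp'; simp at hp'
          | acceptVerify dp' dv _ _ _ _ _ hp' =>
            obtain rfl : dp = dp' := by rw [hp] at hp'; exact Option.some.inj hp'
            by_cases hall : ∀ j ∈ dp.quorum,
                Function.update ((E.cfg m k).slots d).v dv.sender (some dv) j ≠ none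
            · right; right
              intro j hj
              obtain ⟨d', hd'⟩ := Option.ne_none_iff_exists'.1 (hall j hj)
              obtain ⟨a1, a2, -, -, a3⟩ := hshape.v_spec hv j d' hd'
              exact ⟨d', a3, a1, a2⟩
            · left
              exact ⟨hp, hv, by simp only [if_neg hall]; exact ht⟩
          | proposeTimeout dp' _ _ hp' =>
            obtain rfl : dp = dp' := by rw [hp] at hp'; exact Option.some.inj hp'
            right; left; rw [h2]; exact .inr rfl
          | commitTimeout => exact .inr (.inl (hfwd (.inl fun _ h => h)))
          | vcTimeout => exact .inr (.inl (hfwd (.inl fun _ h => h)))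
          | joinView w => exact .inr (.inl (hfwd (.inr ⟨w, fun _ h => h⟩)))
          | installView nv _ _ _ hph => have := (hvc hph).1; omega
          | _ => exact .inl ⟨hp, hv, ht⟩
      · exact .inr (.inl (E.sent_succ m k h))
      · exact .inr (.inr fun j hj => (h j hj).imp fun dv h => ⟨E.rcvd_succ m k h.1, h.2⟩)
  refine (key _ (E.le_idx hnT)).resolve_left ?_
  rintro ⟨hp, hv, ht⟩
  exact E.quiet h0 hk _ (.proposeTimeout d dp t ht hT hp)

/-- The `3Δ` are `2Δ` for the propose timer and `Δ` for delivering the forwarded proposal.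
Dependencies and the predecessor slot passed `wait` before the proposal was accepted, so they
originate at a smaller index, and strong induction on `m` gives them the same deadline `T`. -/
theorem accepts_spread_aux {G : ℝ} (hdelta : 0 < P.delta) (hG : E.Delivers G) (m : ℕ) :
    ∀ k ∉ faulty, ∀ d, ((E.cfg m k).slots d).p ≠ none → ((E.cfg m k).slots d).view = -1 →
      ∀ j ∉ faulty, ∀ T, E.time m + 3 * P.delta ≤ T → G + 3 * P.delta ≤ T →
        (E.cfg (E.idx T) j).Accepts d := by
  induction m using Nat.strong_induction_on with
  | _ m ih =>
    intro k hk d hp hv j hj T hT1 hT2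
    obtain _ | m := m
    · rw [cfg_zero] at hp; simp [LocalState.initial, SlotState.initial] at hp
    by_cases hp' : ((E.cfg m k).slots d).p = none
    swap
    -- The proposal was known one step earlier, still in view `-1`; only the step of first
    -- acceptance is of interest.
    · have h1 := E.view_succ m k d
      have h2 := (E.slotBasic m k d).view_ge
      exact ih m (by omega) k hk d hp' (by omega) j hj T
        (by have := E.time_mono m.le_succ; linarith) hT2
    obtain ⟨dp, h1, hdeps, hprev, hsent⟩ := E.accept_step hp' hp hv
    obtain ⟨hslot, hF, b, hrcv⟩ := (E.shapeInv hrot hfaulty (m + 1) k d).p_spec hv dp h1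
    have hT0 : E.time 0 ≤ T := by have := hG.1; linarith
    have hmt := E.time_mono m.le_succ
    -- earlier accepted slots are accepted by `j`
    have hearlier : ∀ e, (E.cfg m k).Accepts e → (E.cfg (E.idx T) j).Accepts e := by
      intro e he
      obtain ⟨k1, hk1, h2⟩ := E.touched_of_accepts hrot hfaulty hk he
      obtain ⟨m', hm', k2, hk2, h3, h4⟩ := E.exists_origin hfaulty hk1 h2
      exact ih m' (by omega) k2 hk2 e h3 h4 j hj T
        (by have := E.time_mono (show m' ≤ m + 1 by omega); linarith) hT2
    by_contra hacc
    have hacc' : ((E.cfg (E.idx T) j).slots d).p = none ∧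
        ((E.cfg (E.idx T) j).slots d).view = -1 := by
      have h2 := (E.slotBasic (E.idx T) j d).view_ge
      unfold LocalState.Accepts at hacc
      push Not at hacc
      exact ⟨hacc.2.2.1, by omega⟩
    have hno : ∀ b, Msg.depPropose dp b ∉ (E.cfg (E.idx T) j).rcvd := by
      intro b hb
      subst hslot
      exact E.quiet hT0 hj _ (.acceptPropose dp b hb hF hacc'.2 hacc'.1
        (fun k' q h => hearlier _ (hdeps k' q h)) (fun q h => hearlier _ (hprev q h)))
    rcases hsent with hsent | htimer
    · exact hno true (hG.rcvd hk hj hsent trivial (by linarith) (by linarith))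
    -- The last `Δ` before `T` is reserved for delivery; the propose timer has expired before it.
    · have hT' : E.time 0 ≤ T - P.delta := by have := hG.1; linarith
      rcases E.forward hrot hfaulty hk h1 hv htimer hT' (by linarith) (by linarith) with h2 | h2
      · refine hno false (hG.rcvd hk hj h2 trivial ?_ (by linarith))
        have := E.time_idx_le hT'; linarith
      -- The timer was stopped by a complete set of `DepVerify`s. With a faulty coordinator at most
      -- `f - 1` of the `2f` members are faulty, so `f + 1` correct `DepVerify`s reach `j`. A
      -- correct coordinator has sent the proposal to `j` itself.
      · by_cases hco : d.co ∈ faulty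
        · refine hacc (.inl ⟨dp.quorum.filter (· ∉ faulty), ?_, fun j' hj' => ?_⟩)
          · have c1 := Finset.card_filter_add_card_filter_not (s := dp.quorum) (· ∉ faulty)
            have c2 : insert d.co (dp.quorum.filter fun a => ¬ a ∉ faulty) ⊆ faulty := by
              intro a ha
              rcases Finset.mem_insert.1 ha with rfl | ha
              · exact hco
              · simpa using (Finset.mem_filter.1 ha).2
            have c3 := Finset.card_le_card c2
            rw [Finset.card_insert_of_notMem
              (fun h => hF.2 (Finset.mem_filter.1 h).1)] at c3
            have c4 := hF.1
            omega
          · obtain ⟨hj1, hj2⟩ := Finset.mem_filter.1 hj'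
            obtain ⟨dv, h3, h4, h5⟩ := h2 j' hj1
            refine ⟨dv, ?_, h4, h5⟩
            have h6 := E.sent_of_rcvd h3 (by simp [Msg.sender?, h5]) hj2
            refine hG.rcvd hj2 hj h6 trivial ?_ (by linarith)
            have := E.time_idx_le hT'; linarith
        · have h3 := (E.freshInv hfaulty (m + 1)).rcvd k hk dp b hrcv
          rw [hslot] at h3
          exact hno true (hG.rcvd hco hj (h3.resolve_left hco) trivial (by linarith) (by linarith))

/-- A slot accepted by a correct replica is accepted by all correct replicas `3Δ` later. -/
theorem accepts_spread {G : ℝ} (hdelta : 0 < P.delta) (hG : E.Delivers G) {n : ℕ} {i : Replica f}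
    (hi : i ∉ faulty) {d : Slot f} (h : (E.cfg n i).Accepts d) {j : Replica f} (hj : j ∉ faulty)
    {T : ℝ} (hT1 : E.time n + 3 * P.delta ≤ T) (hT2 : G + 3 * P.delta ≤ T) :
    (E.cfg (E.idx T) j).Accepts d := by
  obtain ⟨k1, hk1, h2⟩ := E.touched_of_accepts hrot hfaulty hi h
  obtain ⟨m', hm', k2, hk2, h3, h4⟩ := E.exists_origin hfaulty hk1 h2
  exact E.accepts_spread_aux hrot hfaulty hdelta hG m' k2 hk2 d h3 h4 j hj T
    (by have := E.time_mono hm'; linarith) hT2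

end Execution

/-! ### Timers -/

/-- Which timers of a slot are running. -/
structure TimerInv (i : Replica f) (s : Slot f) (ss : SlotState f Req) (sent : Set (Msg f Req)) :
    Prop where
  commit_neg : ss.view = -1 → ss.p ≠ none → ss.exec = none → ss.commitTimer ≠ none
  commit_nonneg : 0 ≤ ss.view → ss.phase ≠ .viewChange → ss.exec = none → ss.commitTimer ≠ none
  exec : ss.phase = .fpCommitted ∨ ss.phase = .rpCommitted → ss.exec ≠ none ∧ ss.commitTimer = none
  viewChange : ss.phase = .viewChange → ss.commitTimer = none ∧ (ss.exec = none →
    ss.vcTimer ≠ none ∨ ss.queryTimer ≠ none ∨ Msg.queryExec s i ∈ sent)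
  vcTimer : ss.vcTimer ≠ none → ss.phase = .viewChange

theorem TimerInv.step {i : Replica f} {now : ℝ} {st : LocalState f Req} {s : Slot f}
    {ss' : SlotState f Req} {M : Set (Msg f Req)} (h : SlotStep P i now st s ss' M)
    (hfresh : s.co = i → s.seq = st.nextSeq → st.slots s = SlotState.initial f Req)
    (hb : SlotBasic (st.slots s) st.rcvd) (hs : ShapeInv s (st.slots s) st.rcvd)
    (ht : TimerInv i s (st.slots s) st.sent) : TimerInv i s ss' (st.sent ∪ M) := by
  have hb1 := hb.view_ge
  have hb2 := hb.vc
  have hs1 := hs.phase_of_nonneg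
  have hs2 := hs.no_p
  have hs3 := hs.hasReq
  cases h
  case propose r hco hseq =>
    rw [hfresh hco hseq]
    constructor <;> simp [SlotState.initial]
  all_goals
    clear hfresh hb hs
    obtain ⟨h1, h2, h3, h4, h5⟩ := ht
    constructor
    case' commit_neg => try exact h1
    case' commit_nonneg => try exact h2
    case' exec => try exact h3
    case' vcTimer => try exact h5
    all_goals
      simp only [LocalState.enterSlot, Set.mem_union, Set.mem_singleton_iff, Set.union_empty] at *
      grind -ring -linarith

/-- `joinView` is enabled only for the greatest view of this kind, so its existence is needed before
the rule can be said to fire. -/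
theorem LocalState.Reached.exists_isGreatest {st : LocalState f Req} (hfin : st.rcvd.Finite)
    {s : Slot f} {v : ℤ} (h : st.Reached s v (f + 1)) :
    ∃ w, v ≤ w ∧ IsGreatest {w | st.Reached s w (f + 1)} w := by
  have hfin' : {vc | Msg.viewChange vc ∈ st.rcvd}.Finite :=
    hfin.preimage fun a _ b _ h => Msg.viewChange.inj h
  obtain ⟨B, hB⟩ := (hfin'.image ViewChange.view).bddAbove
  have hbd : BddAbove {w | st.Reached s w (f + 1)} := by
    refine ⟨B, ?_⟩
    rintro w ⟨K, hK, hall⟩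
    obtain ⟨k, hk⟩ := Finset.card_pos.1 (show 0 < K.card by omega)
    obtain ⟨vc, h1, -, -, -, h2⟩ := hall k hk
    exact h2.trans (hB ⟨vc, h1, rfl⟩)
  exact ⟨_, le_csSup hbd h, Int.csSup_mem ⟨v, h⟩ hbd, fun _ hw => le_csSup hbd hw⟩

namespace Execution

variable (E : Execution P faulty)

theorem exec_succ {n : ℕ} {i : Replica f} {s : Slot f} {o : Outcome f Req}
    (h : ((E.cfg n i).slots s).exec = some o) : ((E.cfg (n + 1) i).slots s).exec = some o := by
  rcases E.slot_step n i s with ⟨h1, -⟩ | ⟨ss', M, -, -, hs, h1, -, -⟩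
  · rwa [h1]
  · rw [h1]
    cases hs <;> first | exact h | simp_all

theorem exec_mono {n n' : ℕ} (hn : n ≤ n') {i : Replica f} {s : Slot f} {o : Outcome f Req}
    (h : ((E.cfg n i).slots s).exec = some o) : ((E.cfg n' i).slots s).exec = some o := by
  induction hn with
  | refl => exact h
  | step _ ih => exact E.exec_succ ih

/-- The replicas join the highest view that `f + 1` replicas have reached. -/
theorem le_view_of_reached {T : ℝ} (h0 : E.time 0 ≤ T) {i : Replica f} (hi : i ∉ faulty)
    {s : Slot f} {v : ℤ} (h : (E.cfg (E.idx T) i).Reached s v (f + 1)) :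
    v ≤ ((E.cfg (E.idx T) i).slots s).view := by
  obtain ⟨w, hvw, hw⟩ := h.exists_isGreatest (E.rcvd_finite _ i)
  by_contra! hlt
  exact E.quiet h0 hi _ (.joinView s w hw (hlt.trans_le hvw))

variable (hrot : P.IsRotation) (hfaulty : faulty.card ≤ f)

include hrot hfaulty

theorem timerInv (n : ℕ) (i : Replica f) (s : Slot f) :
    TimerInv i s ((E.cfg n i).slots s) (E.cfg n i).sent := by
  induction n with
  | zero => rw [cfg_zero]; constructor <;> simp [LocalState.initial, SlotState.initial]
  | succ n ih =>
    rcases E.slot_step n i s with ⟨h1, h3, h4, h2⟩ | ⟨ss', M, -, hi, hs, h1, h3, h2⟩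
    · rw [h1]
      obtain ⟨h1, h2, h3', h4, h5⟩ := ih
      exact ⟨h1, h2, h3', fun h => ⟨(h4 h).1, fun h' => ((h4 h).2 h').imp_right
        fun h => h.imp_right fun h => h3 h⟩, h5⟩
    · rw [h1, h3]
      exact ih.step hs (E.fresh hfaulty hi) (E.slotBasic n i s) (E.shapeInv hrot hfaulty n i s)

/-- Within a view, a view change ends once and for all, and a slot stays committed. -/
theorem phase_mono {n n' : ℕ} (hn : n ≤ n') {i : Replica f} {s : Slot f}
    (h0 : 0 ≤ ((E.cfg n i).slots s).view)
    (hv : ((E.cfg n' i).slots s).view = ((E.cfg n i).slots s).view) :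
    (((E.cfg n i).slots s).phase ≠ .viewChange → ((E.cfg n' i).slots s).phase ≠ .viewChange) ∧
      (((E.cfg n i).slots s).phase = .rpCommitted →
        ((E.cfg n' i).slots s).phase = .rpCommitted) := by
  induction hn with
  | refl => exact ⟨id, id⟩
  | @step m hm ih =>
    rw [Nat.succ_eq_add_one] at hv ⊢
    have h1 := E.view_mono i s hm
    have h2 := E.view_succ m i s
    have hv' : ((E.cfg m i).slots s).view = ((E.cfg n i).slots s).view := by omega
    have hph := (E.shapeInv hrot hfaulty m i s).phase_of_nonneg
    refine ⟨fun h => ?_, fun h => ?_⟩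
    · have h3 := (ih hv').1 h
      rcases E.slot_step m i s with ⟨h4, -⟩ | ⟨ss', M, -, hi, hs, h4, -, -⟩
      · rwa [h4]
      · rw [h4] at hv ⊢
        cases hs <;> first | exact h3 | (dsimp only [LocalState.enterSlot] at hv; omega) | simp
    · have h3 := (ih hv').2 h
      rcases E.slot_step m i s with ⟨h4, -⟩ | ⟨ss', M, -, hi, hs, h4, -, -⟩
      · rwa [h4]
      · rw [h4] at hv ⊢
        cases hs
        case propose r hco hseq =>
          rw [E.fresh hfaulty hi hco hseq] at hv'
          simp only [SlotState.initial] at hv'; omega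
        all_goals
          first
            | exact h3
            | (dsimp only [LocalState.enterSlot] at hv; omega)
            | simp_all

omit hrot hfaulty in
/-- A running view-change timer was started when `2f + 1` replicas had reached the view. -/
theorem vcTimer_started {n : ℕ} {i : Replica f} {s : Slot f} {t : ℝ}
    (ht : ((E.cfg n i).slots s).vcTimer = some t) :
    ∃ m ≤ n, t = E.time m + P.vcTimeout ∧
      (E.cfg m i).Reached s ((E.cfg n i).slots s).view (2 * f + 1) := by
  induction n with
  | zero => rw [cfg_zero] at ht; simp [LocalState.initial, SlotState.initial] at ht
  | succ n ih =>
    rcases E.slot_step n i s with ⟨h1, -⟩ | ⟨ss', M, -, hi, hs, h1, -, -⟩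
    · rw [h1] at ht ⊢
      obtain ⟨m, hm, h⟩ := ih ht
      exact ⟨m, hm.trans n.le_succ, h⟩
    · rw [h1] at ht ⊢
      cases hs
      case startVcTimer hq => exact ⟨n, n.le_succ, (Option.some.inj ht).symm, hq⟩
      all_goals
        first
          | cases ht
          | obtain ⟨m, hm, h⟩ := ih ht
            exact ⟨m, hm.trans n.le_succ, h⟩

omit hrot in
/-- In a view that is installed, a running commit timer was started with a `NewView`. -/
theorem commitTimer_started {n : ℕ} {i : Replica f} {s : Slot f} {t : ℝ}
    (hv : 0 ≤ ((E.cfg n i).slots s).view)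
    (ht : ((E.cfg n i).slots s).commitTimer = some t) :
    ∃ m ≤ n, t = E.time m + 3 * P.delta ∧ ∃ nv : NewView f Req,
      Msg.newView nv ∈ (E.cfg m i).rcvd ∧ nv.Valid ∧ nv.slot = s ∧
        nv.view = ((E.cfg n i).slots s).view := by
  induction n with
  | zero => rw [cfg_zero] at ht; simp [LocalState.initial, SlotState.initial] at ht
  | succ n ih =>
    rcases E.slot_step n i s with ⟨h1, -⟩ | ⟨ss', M, -, hi, hs, h1, -, -⟩
    · rw [h1] at ht hv ⊢
      obtain ⟨m, hm, h⟩ := ih hv ht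
      exact ⟨m, hm.trans n.le_succ, h⟩
    · rw [h1] at ht hv ⊢
      cases hs
      case installView nv h2 h3 h4 h5 h6 =>
        exact ⟨n, n.le_succ, (Option.some.inj ht).symm, nv, h3, h4, h2, h6.symm⟩
      case propose r hco hseq =>
        rw [E.fresh hfaulty hi hco hseq] at hv
        simp [SlotState.initial] at hv
      case acceptPropose h _ _ _ => simp only at hv; omega
      case startCommitTimer h _ _ _ => simp only at hv; omega
      all_goals
        first
          | cases ht
          | obtain ⟨m, hm, h⟩ := ih hv ht
            exact ⟨m, hm.trans n.le_succ, h⟩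

end Execution

/-! ### View changes -/

/-- Shows that the coordinator is never blocked by the selection rule: among finitely many
`ViewChange`s there is a certificate of highest view, or only fast-path ones, or none at all. -/
theorem exists_selects (vcs : Replica f → Option (ViewChange f Req)) :
    ∃ val, Selects vcs val := by
  by_cases h : ∃ k vc val view K, vcs k = some vc ∧ vc.cert = some (.rpc val view K)
  · let S : Set ℤ := {view | ∃ k vc val K, vcs k = some vc ∧ vc.cert = some (.rpc val view K)}
    -- There is at most one view per replica, hence `S` is finite. The `0` is a filler for replicas
    -- without such a certificate.
    let g : Replica f → ℤ := fun k => match (vcs k).bind ViewChange.cert with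
      | some (.rpc _ view _) => view
      | _ => 0
    have hfin : S.Finite := by
      refine (Set.finite_range g).subset ?_
      rintro view ⟨k, vc, val, K, h1, h2⟩
      exact ⟨k, by simp [g, h1, h2]⟩
    have hne : S.Nonempty := by
      obtain ⟨k, vc, val, view, K, h⟩ := h
      exact ⟨view, k, vc, val, K, h⟩
    obtain ⟨view, ⟨k, vc, val, K, h1, h2⟩, hmax⟩ := S.exists_max_image id hfin hne
    exact ⟨val, .inl ⟨k, vc, view, K, h1, h2, fun k' vc' val' view' K' h3 h4 =>
      hmax view' ⟨k', vc', val', K', h3, h4⟩⟩⟩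
  · push Not at h
    by_cases h' : ∃ k vc dp dv, vcs k = some vc ∧ vc.cert = some (.fpc dp dv)
    · obtain ⟨k, vc, dp, dv, h1, h2⟩ := h'
      exact ⟨some (dp, dv), .inr (.inl ⟨fun k vc val view K => h k vc val view K,
        k, vc, dp, dv, h1, h2, rfl⟩)⟩
    · push Not at h'
      refine ⟨none, .inr (.inr ⟨fun k vc hk => ?_, rfl⟩)⟩
      rcases hc : vc.cert with _ | ct
      · rfl
      · cases ct with
        | fpc dp dv => exact (h' k vc dp dv hk hc).elim
        | rpc val view K => exact (h k vc val view K hk hc).elim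

/-- A coordinator that has received enough `ViewChange`s can send a `NewView`. -/
theorem exists_sendNewView {i : Replica f} {now : ℝ} {st : LocalState f Req} {s : Slot f} {v : ℤ}
    (hv : 0 ≤ v) (hi : i = viewCoordinator s v) (hph : (st.slots s).phase = .viewChange)
    (hview : (st.slots s).view = v) {K : Finset (Replica f)} (hK : 2 * f + 1 ≤ K.card)
    (hall : ∀ k ∈ K, ∃ vc, Msg.viewChange vc ∈ st.rcvd ∧ vc.Valid ∧ vc.slot = s ∧ vc.sender = k ∧
      vc.view = v)
    (honce : ∀ nv : NewView f Req, Msg.newView nv ∈ st.sent → ¬ (nv.slot = s ∧ nv.view = v)) :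
    ∃ st', Rule P i now st st' := by
  have : Nonempty (ViewChange f Req) := ⟨⟨0, s, i, none⟩⟩
  choose! g hg using hall
  let vcs : Replica f → Option (ViewChange f Req) := fun k => if k ∈ K then some (g k) else none
  have hvcs : ∀ k vc, vcs k = some vc → k ∈ K ∧ g k = vc := by
    intro k vc h
    by_cases hk : k ∈ K
    · simp only [vcs, if_pos hk, Option.some.injEq] at h
      exact ⟨hk, h⟩
    · simp [vcs, hk] at h
  obtain ⟨val, hval⟩ := exists_selects vcs
  refine ⟨_, .sendNewView ⟨v, s, i, val, vcs⟩ rfl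
    ⟨hv, hi, ⟨K, hK, fun k hk => by simp [vcs, hk]⟩, ?_, hval⟩ hph hview ?_ honce⟩
  · intro k vc h
    obtain ⟨hk, rfl⟩ := hvcs k vc h
    obtain ⟨-, h2, h3, h4, h5⟩ := hg k hk
    exact ⟨h4, h3, h5, h2⟩
  · intro k vc h
    obtain ⟨hk, rfl⟩ := hvcs k vc h
    exact (hg k hk).1

theorem correct_card (hfaulty : faulty.card ≤ f) :
    2 * f + 1 ≤ (Finset.univ.filter (· ∉ faulty) : Finset (Replica f)).card := by
  have h : (Finset.univ.filter (· ∉ faulty) : Finset (Replica f)) = faultyᶜ := by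
    ext; simp
  rw [h, Finset.card_compl, Fintype.card_fin]
  omega

theorem correct_inter_card (hfaulty : faulty.card ≤ f) {K : Finset (Replica f)}
    (hK : 2 * f + 1 ≤ K.card) : f + 1 ≤ (K.filter (· ∉ faulty)).card := by
  have c1 := Finset.card_filter_add_card_filter_not (s := K) (· ∉ faulty)
  have c2 : (K.filter fun a => ¬ a ∉ faulty) ⊆ faulty := by
    intro a ha
    simpa using (Finset.mem_filter.1 ha).2
  have c3 := Finset.card_le_card c2
  omega

namespace Execution

variable (E : Execution P faulty)

/-- A `NewView` is sent after `2f + 1` replicas have reached the view. -/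
theorem reached_of_newView {n : ℕ} {c : Replica f} {s : Slot f} {nv : NewView f Req}
    (h : Msg.newView nv ∈ (E.cfg n c).sent) (hs : nv.slot = s) :
    ∃ m < n, (E.cfg m c).Reached s nv.view (2 * f + 1) := by
  induction n with
  | zero => rw [cfg_zero] at h; simp [LocalState.initial] at h
  | succ n ih =>
    by_cases hold : Msg.newView nv ∈ (E.cfg n c).sent
    · obtain ⟨m, hm, h⟩ := ih hold
      exact ⟨m, hm.trans n.lt_succ_self, h⟩
    · rcases E.slot_step n c s with ⟨-, -, h1, -⟩ | ⟨ss', M, -, -, hst, -, h1, -⟩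
      · exact ((h1 _ h).resolve_left hold (by simp [Msg.slot?, hs])).elim
      · rw [h1] at h
        replace h := h.resolve_left hold
        refine ⟨n, n.lt_succ_self, ?_⟩
        cases hst
        case sendNewView nv' h2 h3 h4 h5 h6 h7 h8 =>
          obtain rfl : nv = nv' := Msg.newView.inj h
          obtain ⟨-, -, ⟨K, hK, hne⟩, hall, -⟩ := h4
          refine ⟨K, hK, fun k hk => ?_⟩
          obtain ⟨vc, hvc⟩ := Option.ne_none_iff_exists'.1 (hne k hk)
          obtain ⟨a1, a2, a3, a4⟩ := hall k vc hvc
          exact ⟨vc, h7 k vc hvc, a4, a2.trans hs, a1, a3.ge⟩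
        all_goals simp [LocalState.enterMsgs] at h

theorem sent_of_newView {n : ℕ} {i c : Replica f} {nv : NewView f Req}
    (h : Msg.newView nv ∈ (E.cfg n i).rcvd) (hv : nv.Valid)
    (hc : viewCoordinator nv.slot nv.view = c) (hcf : c ∉ faulty) :
    Msg.newView nv ∈ (E.cfg n c).sent :=
  E.sent_of_rcvd h (by simp [Msg.sender?, hv.2.1, hc]) hcf

variable (hrot : P.IsRotation) (hfaulty : faulty.card ≤ f)

include hfaulty hrot

theorem viewChange_valid {n : ℕ} {i : Replica f} {vc : ViewChange f Req}
    (h : Msg.viewChange vc ∈ (E.cfg n i).sent) : vc.Valid :=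
  (E.certInv hrot hfaulty n i vc.slot).vc_valid vc h rfl

/-- One of the `f + 1` senders is correct and announces only views that it has reached, so faulty
replicas cannot drive the views up by themselves. -/
theorem view_le_of_reached {n : ℕ} {i : Replica f} {s : Slot f} {w : ℤ}
    (h : (E.cfg n i).Reached s w (f + 1)) :
    ∃ k ∉ faulty, w ≤ ((E.cfg n k).slots s).view := by
  obtain ⟨K, hK, hall⟩ := h
  obtain ⟨k, hk, hkf⟩ := exists_correct_of_card hfaulty hK
  obtain ⟨vc, h1, -, h2, h3, h4⟩ := hall k hk
  have h5 := E.sent_of_rcvd h1 (by simp [Msg.sender?, h3]) hkf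
  exact ⟨k, hkf, h4.trans ((E.msgInv hrot hfaulty n k s).vc_spec vc h5 h2).2.2⟩

omit hrot in
/-- When a correct replica knows that `2f + 1` replicas have reached a view, all correct replicas
join. -/
theorem all_joined {G : ℝ} (hG : E.Delivers G) {n : ℕ} {j : Replica f} {s : Slot f} {v : ℤ}
    (h : (E.cfg n j).Reached s v (2 * f + 1)) {T : ℝ} (hT : E.time n ≤ T) (hGT : G ≤ T) :
    ∃ T₁, T ≤ T₁ ∧ T₁ < T + P.delta ∧ ∀ i ∉ faulty, v ≤ ((E.cfg (E.idx T₁) i).slots s).view := by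
  obtain ⟨T₁, h1, h2, h3⟩ := hG.2 T hGT
  refine ⟨T₁, h1, h2, fun i hi => E.le_view_of_reached (hG.1.trans (hGT.trans h1)) hi ?_⟩
  obtain ⟨K, hK, hall⟩ := h
  refine ⟨_, correct_inter_card hfaulty hK, fun k hk => ?_⟩
  obtain ⟨hk, hkf⟩ := Finset.mem_filter.1 hk
  obtain ⟨vc, a1, a2, a3, a4, a5⟩ := hall k hk
  refine ⟨vc, h3 k hkf i hi _ ?_ trivial, a2, a3, a4, a5⟩
  exact E.sent_mono k (E.le_idx hT) (E.sent_of_rcvd a1 (by simp [Msg.sender?, a4]) hkf)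

/-- The value of a view with a correct coordinator. -/
theorem value_of_newView {n n' : ℕ} {c i : Replica f} (hc : c ∉ faulty) {nv : NewView f Req}
    (hnv : Msg.newView nv ∈ (E.cfg n c).sent)
    (hview : ((E.cfg n' i).slots nv.slot).view = nv.view)
    (hph : ((E.cfg n' i).slots nv.slot).phase ≠ .viewChange) :
    ((E.cfg n' i).slots nv.slot).value = nv.val := by
  obtain ⟨h1, h2⟩ := (E.msgInv hrot hfaulty n c nv.slot).nv_spec nv hnv rfl
  obtain ⟨nv', h3, h4, h5, h6, h7⟩ :=
    (E.shapeInv hrot hfaulty n' i nv.slot).installed (hview ▸ h2.1) hph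
  have h8 := E.sent_of_newView h3 h4 (c := c)
    (by rw [h5, h6, hview, ← h2.2.1, h1]) hc
  have h9 := (E.msgInv hrot hfaulty (max n n') c nv.slot).nv_uniq nv nv'
    (E.sent_mono c (le_max_left _ _) hnv) (E.sent_mono c (le_max_right _ _) h8) rfl h5
    (h6.trans hview).symm
  rw [← h7, h9]

variable {G : ℝ} (hG : E.Delivers G) {s : Slot f} {v : ℤ} (hv : 0 ≤ v)

include hG hv

/-- A view with a correct coordinator is installed within `2Δ` after all correct replicas have
joined. -/
theorem all_installed {c : Replica f} (hcv : c = viewCoordinator s v) (hc : c ∉ faulty) {T B : ℝ}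
    (hGT : G ≤ T) (hB : T + 2 * P.delta ≤ B)
    (hview : ∀ T', T ≤ T' → T' < B → ∀ i ∉ faulty, ((E.cfg (E.idx T') i).slots s).view = v) :
    ∃ T', T ≤ T' ∧ T' < T + 2 * P.delta ∧
      ∀ i ∉ faulty, ((E.cfg (E.idx T') i).slots s).phase ≠ .viewChange := by
  obtain ⟨T₂, h1, h2, h3⟩ := hG.2 T hGT
  obtain ⟨T₃, h4, h5, h6⟩ := hG.2 T₂ (hGT.trans h1)
  have hd : 0 < P.delta := by linarith
  have h0 : E.time 0 ≤ T₂ := hG.1.trans (hGT.trans h1)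
  refine ⟨T₃, h1.trans h4, by linarith, fun i hi hph => ?_⟩
  -- After one delivery the coordinator has all `ViewChange`s. Either it is still in the view change
  -- and has sent a `NewView`, or it has installed one, which only it can have signed.
  have hnv : ∃ nv, Msg.newView nv ∈ (E.cfg (E.idx T₂) c).sent ∧ nv.slot = s ∧ nv.view = v := by
    have hvc := hview T₂ h1 (by linarith) c hc
    by_cases hph : ((E.cfg (E.idx T₂) c).slots s).phase = .viewChange
    · by_contra! hno
      obtain ⟨st', hst'⟩ := exists_sendNewView (P := P) (now := T₂) hv hcv hph hvc
        (correct_card hfaulty) (fun k hk => by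
          have hkf := (Finset.mem_filter.1 hk).2
          have hvk := hview T le_rfl (by linarith) k hkf
          obtain ⟨ct, hct⟩ := (E.msgInv hrot hfaulty (E.idx T) k s).vc_sent (hvk ▸ hv)
          exact ⟨_, h3 k hkf c hc _ hct trivial, E.viewChange_valid hrot hfaulty hct, rfl, rfl,
            hvk⟩)
        (fun nv h h' => hno nv h h'.1 h'.2)
      exact E.quiet h0 hc _ hst'
    · obtain ⟨nv, h7, h8, h9, h10, -⟩ :=
        (E.shapeInv hrot hfaulty (E.idx T₂) c s).installed (hvc ▸ hv) hph
      exact ⟨nv, E.sent_of_newView h7 h8 (by rw [h9, h10, hvc, hcv]) hc, h9, h10.trans hvc⟩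
  obtain ⟨nv, h7, rfl, rfl⟩ := hnv
  exact E.quiet (h0.trans h4) hi _ (.installView nv (h6 c hc i hi _ h7 trivial)
    ((E.msgInv hrot hfaulty _ c nv.slot).nv_spec nv h7 rfl).2 hph
    (hview T₃ (h1.trans h4) (by linarith) i hi))

/-- A view with a correct coordinator leads to a commit within `2Δ` after all correct replicas have
received the `NewView`. -/
theorem all_committed {c : Replica f} (hc : c ∉ faulty) {nv : NewView f Req} {n : ℕ}
    (hnv : Msg.newView nv ∈ (E.cfg n c).sent) (hs : nv.slot = s) (hnvv : nv.view = v) {T B : ℝ}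
    (hGT : G ≤ T) (hB : T + 2 * P.delta ≤ B)
    (hview : ∀ T', T ≤ T' → T' < B → ∀ i ∉ faulty, ((E.cfg (E.idx T') i).slots s).view = v)
    (hrcvd : ∀ i ∉ faulty, Msg.newView nv ∈ (E.cfg (E.idx T) i).rcvd) :
    ∃ T', T ≤ T' ∧ T' < T + 2 * P.delta ∧
      ∀ i ∉ faulty, ((E.cfg (E.idx T') i).slots s).phase = .rpCommitted := by
  subst hs hnvv
  -- The `Prepare`s are delivered by `T₂` and the `Commit`s by `T₃`.
  obtain ⟨T₂, h1, h2, h3⟩ := hG.2 T hGT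
  obtain ⟨T₃, h4, h5, h6⟩ := hG.2 T₂ (hGT.trans h1)
  have hd : 0 < P.delta := by linarith
  have h0 : E.time 0 ≤ T := hG.1.trans hGT
  have hph : ∀ T', T ≤ T' → T' < B → ∀ i ∉ faulty,
      ((E.cfg (E.idx T') i).slots nv.slot).phase ≠ .viewChange := by
    intro T' hT' hB' i hi hph
    exact E.quiet (h0.trans hT') hi _ (.installView nv
      (E.rcvd_mono i (E.idx_mono hT') (hrcvd i hi))
      ((E.msgInv hrot hfaulty _ c nv.slot).nv_spec nv hnv rfl).2 hph (hview T' hT' hB' i hi))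
  have hval : ∀ T', T ≤ T' → T' < B → ∀ i ∉ faulty,
      ((E.cfg (E.idx T') i).slots nv.slot).value = nv.val := fun T' hT' hB' i hi =>
    E.value_of_newView hrot hfaulty hc hnv (hview T' hT' hB' i hi) (hph T' hT' hB' i hi)
  have hph' : ∀ T', T ≤ T' → T' < B → ∀ i ∉ faulty,
      ((E.cfg (E.idx T') i).slots nv.slot).phase = .rpVerified ∨
      ((E.cfg (E.idx T') i).slots nv.slot).phase = .rpPrepared ∨
      ((E.cfg (E.idx T') i).slots nv.slot).phase = .rpCommitted := fun T' hT' hB' i hi =>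
    ((E.shapeInv hrot hfaulty _ i nv.slot).phase_of_nonneg
      ((hview T' hT' hB' i hi).symm ▸ hv)).resolve_left (hph T' hT' hB' i hi)
  have hprep : ∀ i ∉ faulty, ((E.cfg (E.idx T₂) i).slots nv.slot).phase = .rpPrepared ∨
      ((E.cfg (E.idx T₂) i).slots nv.slot).phase = .rpCommitted := by
    intro i hi
    refine (hph' T₂ h1 (by linarith) i hi).resolve_left fun hp => ?_
    refine E.quiet (h0.trans h1) hi _ (.rpPrepare nv.slot hp
      ⟨_, correct_card hfaulty, fun k hk => ?_⟩)
    have hkf := (Finset.mem_filter.1 hk).2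
    have h7 := (E.msgInv hrot hfaulty _ k nv.slot).pr_sent (hph' T le_rfl (by linarith) k hkf)
    rw [hval T le_rfl (by linarith) k hkf, hview T le_rfl (by linarith) k hkf] at h7
    rw [hval T₂ h1 (by linarith) i hi, hview T₂ h1 (by linarith) i hi]
    exact h3 k hkf i hi _ h7 trivial
  refine ⟨T₃, h1.trans h4, by linarith, fun i hi => ?_⟩
  have hT₃ := h1.trans h4
  rcases hph' T₃ hT₃ (by linarith) i hi with hp | hp | hp
  · exfalso
    refine E.quiet (h0.trans hT₃) hi _ (.rpPrepare nv.slot hp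
      ⟨_, correct_card hfaulty, fun k hk => ?_⟩)
    have hkf := (Finset.mem_filter.1 hk).2
    have h7 := (E.msgInv hrot hfaulty _ k nv.slot).pr_sent (hph' T le_rfl (by linarith) k hkf)
    rw [hval T le_rfl (by linarith) k hkf, hview T le_rfl (by linarith) k hkf] at h7
    rw [hval T₃ hT₃ (by linarith) i hi, hview T₃ hT₃ (by linarith) i hi]
    exact E.rcvd_mono i (E.idx_mono h4) (h3 k hkf i hi _ h7 trivial)
  · exfalso
    refine E.quiet (h0.trans hT₃) hi _ (.rpCommit nv.slot hp
      ⟨_, correct_card hfaulty, fun k hk => ?_⟩)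
    have hkf := (Finset.mem_filter.1 hk).2
    have h7 := (E.msgInv hrot hfaulty _ k nv.slot).co_sent (hprep k hkf)
    rw [hval T₂ h1 (by linarith) k hkf, hview T₂ h1 (by linarith) k hkf] at h7
    rw [hval T₃ hT₃ (by linarith) i hi, hview T₃ hT₃ (by linarith) i hi]
    exact h6 k hkf i hi _ h7 trivial
  · exact hp

/-- In the synchronous phase, no correct replica moves beyond a view with a correct coordinator. -/
theorem view_le (hvc : 3 * P.delta ≤ P.vcTimeout)
    (hc : viewCoordinator s v ∉ faulty)
    (hlt : ∀ i ∉ faulty, ((E.cfg (E.idx G) i).slots s).view < v) (n : ℕ) :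
    ∀ i ∉ faulty, ((E.cfg n i).slots s).view ≤ v := by
  by_contra hex
  -- Consider the first step in which a correct replica passes `v`. It cannot be `joinView`, since
  -- that needs a correct replica already there; so a timer of view `v` has expired.
  have hex' : ∃ n, ¬ ∀ i ∉ faulty, ((E.cfg n i).slots s).view ≤ v := ⟨n, hex⟩
  obtain ⟨m, hm⟩ : ∃ m, Nat.find hex' = m + 1 := by
    refine Nat.exists_eq_succ_of_ne_zero fun h0 => Nat.find_spec hex' ?_
    rw [h0]
    intro i _
    rw [cfg_zero]
    simp only [LocalState.initial, SlotState.initial]; omega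
  have hle : ∀ n ≤ m, ∀ i ∉ faulty, ((E.cfg n i).slots s).view ≤ v := fun n hn => by
    simpa using Nat.find_min hex' (show n < _ by omega)
  have hspec := Nat.find_spec hex'
  rw [hm] at hspec
  push Not at hspec
  obtain ⟨i, hi, hiv⟩ := hspec
  -- the time at which `2f + 1` replicas are known to have reached view `v`
  by_cases hR : ∃ m₀, ∃ j ∉ faulty, (E.cfg m₀ j).Reached s v (2 * f + 1)
  swap
  -- Without this knowledge no timer of view `v` was ever started: the view-change timer requires it
  -- directly, and the commit timer requires a `NewView`, whose correct coordinator must have it.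
  · push Not at hR
    rcases E.slot_step m i s with ⟨h1, -⟩ | ⟨ss', M, -, -, hs, h1, -, -⟩
    · rw [h1] at hiv; have := hle m le_rfl i hi; omega
    · rw [h1] at hiv
      have hmi := hle m le_rfl i hi
      cases hs
      case commitTimeout t ht hnow =>
        have hmv : ((E.cfg m i).slots s).view = v := by
          simp only [LocalState.enterSlot] at hiv; omega
        obtain ⟨m₁, hm₁, -, nv, h2, h3, h4, h5⟩ :=
          E.commitTimer_started hfaulty (hmv ▸ hv) ht
        obtain ⟨m₂, -, h6⟩ := E.reached_of_newView
          (E.sent_of_newView h2 h3 (by rw [h4, h5, hmv]) hc) h4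
        rw [h5, hmv] at h6
        exact hR _ _ hc h6
      case vcTimeout t ht hnow =>
        have hmv : ((E.cfg m i).slots s).view = v := by
          simp only [LocalState.enterSlot] at hiv; omega
        obtain ⟨m₁, hm₁, -, h2⟩ := E.vcTimer_started ht
        exact hR _ i hi (hmv ▸ h2)
      case joinView w hw _ =>
        obtain ⟨k, hk, h2⟩ := E.view_le_of_reached hrot hfaulty hw
        have := hle m le_rfl k hk
        simp only [LocalState.enterSlot] at hiv; omega
      all_goals (try dsimp at hiv); omega
  obtain ⟨j, hj, hreach⟩ := Nat.find_spec hR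
  have hmin : ∀ m', ∀ j ∉ faulty, (E.cfg m' j).Reached s v (2 * f + 1) → Nat.find hR ≤ m' :=
    fun m' j hj h => Nat.find_min' hR ⟨j, hj, h⟩
  generalize Nat.find hR = m₀ at hreach hmin
  -- At time `G` all correct replicas are below `v`, so nobody can know of `2f + 1` replicas there.
  have hG0 : G ≤ E.time m₀ := by
    by_contra! hlt'
    obtain ⟨k, hk, h2⟩ := E.view_le_of_reached hrot hfaulty
      (hreach.mono subset_rfl le_rfl (by omega))
    have h3 := E.view_mono k s (E.le_idx hlt'.le)
    have := hlt k hk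
    omega
  obtain ⟨T₁, hT1, hT1', hjoin⟩ := E.all_joined hfaulty hG hreach le_rfl hG0
  -- From below by joining, from above by minimality of the violating step.
  have hview : ∀ T', T₁ ≤ T' → T' < E.time m → ∀ i ∉ faulty,
      ((E.cfg (E.idx T') i).slots s).view = v := by
    intro T' h1 h2 i hi
    have h3 := E.view_mono i s (E.idx_mono h1)
    have h4 := hle _ (E.idx_lt (hG.1.trans (hG0.trans (hT1.trans h1))) h2).le i hi
    have h5 := hjoin i hi
    omega
  rcases E.slot_step m i s with ⟨h1, -⟩ | ⟨ss', M, -, -, hs, h1, -, -⟩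
  · rw [h1] at hiv; have := hle m le_rfl i hi; omega
  · rw [h1] at hiv
    have hmi := hle m le_rfl i hi
    cases hs
    -- Let `mc` be the index where the `NewView` first appears, not before `m₀`. Before `Δ` has
    -- passed since then, all correct replicas have joined and received it; before `2Δ` more have
    -- passed, they have committed. The timer was started no earlier and runs for `3Δ`, so
    -- committing has stopped it.
    case commitTimeout t ht hnow =>
      have hmv : ((E.cfg m i).slots s).view = v := by
        simp only [LocalState.enterSlot] at hiv; omega
      obtain ⟨m₁, hm₁, rfl, nv, h2, h3, h4, h5⟩ :=
        E.commitTimer_started hfaulty (hmv ▸ hv) ht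
      have h6 := E.sent_of_newView h2 h3 (by rw [h4, h5, hmv]) hc
      have hex : ∃ m', Msg.newView nv ∈ (E.cfg m' (viewCoordinator s v)).sent := ⟨_, h6⟩
      have h7 := Nat.find_min' hex h6
      have h8 := Nat.find_spec hex
      generalize Nat.find hex = mc at h7 h8
      obtain ⟨m₂, hm₂, h9⟩ := E.reached_of_newView h8 h4
      rw [h5, hmv] at h9
      have h10 := hmin _ _ hc h9
      have t1 := E.time_mono (show m₀ ≤ mc by omega)
      have t2 := E.time_mono h7
      obtain ⟨T₂, h11, h12, h13⟩ := hG.2 (E.time mc) (hG0.trans t1)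
      have hmax : max T₁ T₂ < E.time mc + P.delta := max_lt (by linarith) h12
      obtain ⟨T₃, h14, h15, h16⟩ := E.all_committed hrot hfaulty hG hv hc h8 h4 (h5.trans hmv)
        (T := max T₁ T₂) (B := E.time m) (hG0.trans (hT1.trans (le_max_left _ _)))
        (by linarith) (fun T' a b => hview T' ((le_max_left _ _).trans a) b)
        (fun k hk => E.rcvd_mono k (E.idx_mono (le_max_right _ _))
          (h13 _ hc k hk _ (E.sent_mono _ (E.le_idx le_rfl) h8) trivial))
      have h17 := (le_max_left T₁ T₂).trans h14
      have h18 := hview T₃ h17 (by linarith) i hi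
      have h19 := (E.phase_mono hrot hfaulty
        (E.idx_lt (hG.1.trans (hG0.trans (hT1.trans h17))) (show T₃ < E.time m by linarith)).le
        (h18 ▸ hv) (hmv.trans h18.symm)).2 (h16 i hi)
      have h20 := ((E.timerInv hrot hfaulty m i s).exec (.inr h19)).2
      rw [h20] at ht; cases ht
    -- This timer starts no earlier than `m₀`. Joining takes less than `Δ` from then and installing
    -- less than `2Δ` more, which is why `3Δ ≤ P.vcTimeout` suffices.
    case vcTimeout t ht hnow =>
      have hmv : ((E.cfg m i).slots s).view = v := by
        simp only [LocalState.enterSlot] at hiv; omega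
      obtain ⟨m₁, hm₁, rfl, h2⟩ := E.vcTimer_started ht
      have t1 := E.time_mono (hmin m₁ i hi (hmv ▸ h2))
      obtain ⟨T₃, h14, h15, h16⟩ := E.all_installed hrot hfaulty hG hv rfl hc (hG0.trans hT1)
        (B := E.time m) (by linarith) hview
      have h18 := hview T₃ h14 (by linarith) i hi
      have h19 := (E.phase_mono hrot hfaulty
        (E.idx_lt (hG.1.trans (hG0.trans (hT1.trans h14))) (show T₃ < E.time m by linarith)).le
        (h18 ▸ hv) (hmv.trans h18.symm)).1 (h16 i hi)
      exact h19 ((E.timerInv hrot hfaulty m i s).vcTimer (by simp [ht]))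
    case joinView w hw _ =>
      obtain ⟨k, hk, h2⟩ := E.view_le_of_reached hrot hfaulty hw
      have := hle m le_rfl k hk
      simp only [LocalState.enterSlot] at hiv; omega
    all_goals (try dsimp at hiv); omega

end Execution

/-! ### Every proposed slot is filled -/

namespace Execution

variable (E : Execution P faulty)

theorem eventually_const {g : ℕ → ℤ} (hg : Monotone g) {B : ℤ} (hB : ∀ n, g n ≤ B) :
    ∃ N, ∀ n ≥ N, g n = g N := by
  obtain ⟨N, hN⟩ := Int.csSup_mem (s := Set.range g) ⟨_, 0, rfl⟩
    ⟨B, by rintro _ ⟨n, rfl⟩; exact hB n⟩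
  refine ⟨N, fun n hn => le_antisymm ?_ (hg hn)⟩
  rw [hN]
  exact le_csSup ⟨B, by rintro _ ⟨n, rfl⟩; exact hB n⟩ ⟨n, rfl⟩

variable (hrot : P.IsRotation) (hfaulty : faulty.card ≤ f)

include hrot hfaulty

section Stuck

variable {i : Replica f} (hi : i ∉ faulty) {s : Slot f} {N : ℕ} {w : ℤ}
  (hview : ∀ n ≥ N, ((E.cfg n i).slots s).view = w)
  (hexec : ∀ n, ((E.cfg n i).slots s).exec = none)

include hi hview hexec

/-- While the view is constant and no result is known, nothing stops or restarts a running commit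
timer: accepting a proposal keeps it, and a view is installed only when it is off. So it would
expire and change the view. -/
theorem stuck_commitTimer {n : ℕ} (hn : N ≤ n) : ((E.cfg n i).slots s).commitTimer = none := by
  by_contra hne
  obtain ⟨t, ht⟩ := Option.ne_none_iff_exists'.1 hne
  have key : ∀ m ≥ n, ((E.cfg m i).slots s).commitTimer = some t := by
    intro m hm
    induction hm with
    | refl => exact ht
    | @step m hm ih =>
      rw [Nat.succ_eq_add_one]
      have h1 := hview m (hn.trans hm)
      have h2 := hview (m + 1) ((hn.trans hm).trans m.le_succ)
      have h3 := hexec (m + 1)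
      have h4 := (E.timerInv hrot hfaulty m i s).viewChange
      rcases E.slot_step m i s with ⟨h5, -⟩ | ⟨ss', M, -, -, hs, h5, -, -⟩
      · rwa [h5]
      · rw [h5] at h2 h3 ⊢
        cases hs
        case propose r hco hseq =>
          rw [E.fresh hfaulty hi hco hseq] at ih
          simp [SlotState.initial] at ih
        case acceptPropose => simp [ih]
        case installView nv _ _ _ hph _ => rw [(h4 hph).1] at ih; cases ih
        all_goals
          first
            | exact ih
            | (simp at h3; done)
            | (dsimp [LocalState.enterSlot] at h2; omega)
            | simp_all
  have h0 : E.time 0 ≤ max t (E.time n) := (E.time_mono n.zero_le).trans (le_max_right _ _)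
  exact E.quiet h0 hi _ (.commitTimeout s t (key _ (E.le_idx (le_max_right _ _)))
    (le_max_left _ _))

/-- In an installed view without a result the commit timer runs, which has just been excluded. -/
theorem stuck_phase (hw : 0 ≤ w) {n : ℕ} (hn : N ≤ n) :
    ((E.cfg n i).slots s).phase = .viewChange := by
  by_contra h
  exact (E.timerInv hrot hfaulty n i s).commit_nonneg (hview n hn ▸ hw) h (hexec n)
    (E.stuck_commitTimer hrot hfaulty hi hview hexec hn)

theorem stuck_vcTimer (hw : 0 ≤ w) {n : ℕ} (hn : N ≤ n) :
    ((E.cfg n i).slots s).vcTimer = none := by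
  by_contra hne
  obtain ⟨t, ht⟩ := Option.ne_none_iff_exists'.1 hne
  have key : ∀ m ≥ n, ((E.cfg m i).slots s).vcTimer = some t := by
    intro m hm
    induction hm with
    | refl => exact ht
    | @step m hm ih =>
      rw [Nat.succ_eq_add_one]
      have h1 := hview m (hn.trans hm)
      have h2 := hview (m + 1) ((hn.trans hm).trans m.le_succ)
      have h3 := E.stuck_phase hrot hfaulty hi hview hexec hw ((hn.trans hm).trans m.le_succ)
      rcases E.slot_step m i s with ⟨h5, -⟩ | ⟨ss', M, -, -, hs, h5, -, -⟩
      · rwa [h5]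
      · rw [h5] at h2 h3 ⊢
        cases hs
        all_goals
          first
            | exact ih
            | (simp at h3; done)
            | (dsimp [LocalState.enterSlot] at h2; omega)
            | simp_all
  have h0 : E.time 0 ≤ max t (E.time n) := (E.time_mono n.zero_le).trans (le_max_right _ _)
  exact E.quiet h0 hi _ (.vcTimeout s t (key _ (E.le_idx (le_max_right _ _))) (le_max_left _ _))

/-- A replica that gets stuck in a view change asks for the result. -/
theorem stuck_query (hw : 0 ≤ w) : ∃ n, Msg.queryExec s i ∈ (E.cfg n i).sent := by
  by_contra! hno
  have hq : ∀ n ≥ N, ((E.cfg n i).slots s).queryTimer ≠ none := fun n hn =>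
    ((((E.timerInv hrot hfaulty n i s).viewChange
      (E.stuck_phase hrot hfaulty hi hview hexec hw hn)).2 (hexec n)).resolve_left
        (not_not.2 (E.stuck_vcTimer hrot hfaulty hi hview hexec hw hn))).resolve_right (hno n)
  obtain ⟨t, ht⟩ := Option.ne_none_iff_exists'.1 (hq N le_rfl)
  have key : ∀ m ≥ N, ((E.cfg m i).slots s).queryTimer = some t := by
    intro m hm
    induction hm with
    | refl => exact ht
    | @step m hm ih =>
      rw [Nat.succ_eq_add_one]
      have h1 := hview m hm
      have h2 := hview (m + 1) (Nat.le_trans hm m.le_succ)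
      have h3 := hq (m + 1) (Nat.le_trans hm m.le_succ)
      rcases E.slot_step m i s with ⟨h5, -⟩ | ⟨ss', M, -, -, hs, h5, -, -⟩
      · rwa [h5]
      · rw [h5] at h2 h3 ⊢
        cases hs
        all_goals
          first
            | exact ih
            | (simp at h3; done)
            | (dsimp [LocalState.enterSlot] at h2; omega)
  have h0 : E.time 0 ≤ max t (E.time N) := (E.time_mono N.zero_le).trans (le_max_right _ _)
  exact E.quiet h0 hi _ (.queryTimeout s t (key _ (E.le_idx (le_max_right _ _))) (le_max_left _ _))

end Stuck

variable {G : ℝ} (hG : E.Delivers G) (hvc : 3 * P.delta ≤ P.vcTimeout)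

include hG hvc

/-- In every slot of a correct coordinator, view changes come to an end. -/
theorem views_eventually_const {s : Slot f} (hs : s.co ∉ faulty) :
    ∃ N, ∃ w : Replica f → ℤ, ∀ n ≥ N, ∀ i ∉ faulty, ((E.cfg n i).slots s).view = w i := by
  obtain ⟨B, hB⟩ := (Set.finite_range fun i => ((E.cfg (E.idx G) i).slots s).view).bddAbove
  -- A multiple of `N` leads the rotation of coordinators back to `s.co`, which is correct. The
  -- factor `B.toNat + 1` places this view above all views at time `G`.
  have hco : viewCoordinator s (((3 * f + 1) * (B.toNat + 1) : ℕ) : ℤ) = s.co := by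
    apply Fin.ext
    simp only [viewCoordinator, Int.toNat_natCast, Nat.add_mul_mod_self_left]
    exact Nat.mod_eq_of_lt s.co.2
  have hle := E.view_le hrot hfaulty hG (s := s) (Int.natCast_nonneg _) hvc (by rwa [hco])
    (fun i _ => by
      have h1 : ((E.cfg (E.idx G) i).slots s).view ≤ B := hB ⟨i, rfl⟩
      have h2 : B.toNat + 1 ≤ (3 * f + 1) * (B.toNat + 1) := Nat.le_mul_of_pos_left _ (by omega)
      omega)
  have h1 : ∀ i ∉ faulty, ∃ N, ∀ n ≥ N, ((E.cfg n i).slots s).view = ((E.cfg N i).slots s).view :=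
    fun i hi => eventually_const (fun _ _ h => E.view_mono i s h) (fun n => hle n i hi)
  choose! N hN using h1
  exact ⟨Finset.univ.sup N, fun i => ((E.cfg (N i) i).slots s).view, fun n hn i hi =>
    hN i hi n ((Finset.le_sup (Finset.mem_univ i)).trans hn)⟩

/-- A correct coordinator learns the result of each of its slots. -/
theorem exists_exec (hdelta : 0 < P.delta) {s : Slot f} (hs : s.co ∉ faulty) {n₀ : ℕ}
    (hseq : s.seq < (E.cfg n₀ s.co).nextSeq) :
    ∃ n, ((E.cfg n s.co).slots s).exec ≠ none := by
  by_contra! hnone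
  obtain ⟨N, w, hw⟩ := E.views_eventually_const hrot hfaulty hG hvc hs
  have hstart := E.own_started n₀ s.co s.seq hseq
  have hge : ∀ i ∉ faulty, -1 ≤ w i := fun i hi =>
    (hw N le_rfl i hi) ▸ (E.slotBasic N i s).view_ge
  have hviewco : ∀ n ≥ N, ((E.cfg n s.co).slots s).view = w s.co := fun n hn => hw n hn _ hs
  -- nobody who has accepted a proposal gets stuck in view `-1`
  have hneg : ∀ i ∉ faulty, (∀ n, ((E.cfg n i).slots s).exec = none) → ∀ n ≥ N, w i = -1 →
      ((E.cfg n i).slots s).p = none := by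
    intro i hi hex n hn hwi
    by_contra hp
    exact (E.timerInv hrot hfaulty n i s).commit_neg ((hw n hn i hi).trans hwi) hp (hex n)
      (E.stuck_commitTimer hrot hfaulty hi (fun n hn => hw n hn i hi) hex hn)
  have hstart' : ∀ n ≥ n₀, ((E.cfg n s.co).slots s).p ≠ none ∨
      0 ≤ ((E.cfg n s.co).slots s).view := by
    intro n hn
    induction hn with
    | refl => exact hstart
    | step _ ih => exact E.started_succ ih
  have hwco : 0 ≤ w s.co := by
    by_contra! hlt
    have h1 := hge _ hs
    rcases hstart' (max n₀ N) (le_max_left _ _) with h2 | h2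
    · exact h2 (hneg _ hs hnone _ (le_max_right _ _) (by omega))
    · rw [hviewco _ (le_max_right _ _)] at h2; omega
  -- The coordinator has started its slot, so it is not stuck in view `-1`; it is stuck in a view
  -- change and therefore asks for the result.
  obtain ⟨n₁, hq⟩ := E.stuck_query hrot hfaulty hs hviewco hnone hwco
  let W : Finset (Replica f) := Finset.univ.filter fun i =>
    i ∉ faulty ∧ ∀ n, ((E.cfg n i).slots s).exec = none
  let X : Finset (Replica f) := Finset.univ.filter fun i =>
    i ∉ faulty ∧ ∃ n, ((E.cfg n i).slots s).exec ≠ none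
  have hcard : 2 * f + 1 ≤ W.card + X.card := by
    refine (correct_card hfaulty).trans
      (le_trans (Finset.card_le_card ?_) (Finset.card_union_le _ _))
    intro i hi
    have hi' := (Finset.mem_filter.1 hi).2
    simp only [W, X, Finset.mem_union, Finset.mem_filter, Finset.mem_univ, true_and]
    by_cases h : ∀ n, ((E.cfg n i).slots s).exec = none
    · exact .inl ⟨hi', h⟩
    · push Not at h; exact .inr ⟨hi', h⟩
  -- few correct replicas know the result
  have hX : X.card ≤ f := by
    by_contra! hX
    have hX' : ∀ i ∈ X, i ∉ faulty ∧ ∃ o, ∃ n, ((E.cfg n i).slots s).exec = some o := by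
      intro i hi
      obtain ⟨h1, n, h2⟩ := (Finset.mem_filter.1 hi).2
      obtain ⟨o, ho⟩ := Option.ne_none_iff_exists'.1 h2
      exact ⟨h1, o, n, ho⟩
    obtain ⟨j, hj⟩ := Finset.card_pos.1 (show 0 < X.card by omega)
    obtain ⟨hjf, o, nj, ho⟩ := hX' j hj
    have hX'' : ∀ i ∈ X, ∃ n, ((E.cfg n i).slots s).exec = some o := by
      intro i hi
      obtain ⟨h1, o', n, h2⟩ := hX' i hi
      exact ⟨n, by rw [h2, E.exec_agree hrot hfaulty h1 hjf h2 ho]⟩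
    choose! nx hnx using hX''
    -- The query reaches the knowing replicas by `T₁`, and their answers are back by `T₂`.
    obtain ⟨T₁, h1, h2, h3⟩ := hG.2 (max G (max (E.time n₁) (E.time (X.sup nx))))
      (le_max_left _ _)
    obtain ⟨T₂, h4, h5, h6⟩ := hG.2 T₁ ((le_max_left _ _).trans h1)
    have hG1 : E.time 0 ≤ T₁ := hG.1.trans ((le_max_left _ _).trans h1)
    refine E.quiet (hG1.trans h4) hs _ (.learn s o (hnone _) ⟨X, hX, fun k hk => ?_⟩)
    have hkf := (hX' k hk).1
    refine h6 k hkf _ hs _ ?_ rfl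
    by_contra hns
    refine E.quiet hG1 hkf _ (.answerQuery s s.co o (h3 _ hs k hkf _ ?_ trivial) ?_ hns)
    · exact E.sent_mono _ (E.le_idx ((le_max_left _ _).trans (le_max_right _ _))) hq
    · refine E.exec_mono ?_ (hnx k hk)
      refine (Finset.le_sup hk).trans (E.le_idx (le_trans ?_ h1))
      exact (le_max_right _ _).trans (le_max_right _ _)
  -- A lowest final view is chosen so that the other members of `W`, at least `f + 1` in all, count
  -- as having reached it.
  obtain ⟨i, hiW, hmin⟩ := W.exists_min_image w (Finset.card_pos.1 (by omega))
  obtain ⟨hi, hexi⟩ := (Finset.mem_filter.1 hiW).2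
  have hviewi : ∀ n ≥ N, ((E.cfg n i).slots s).view = w i := fun n hn => hw n hn i hi
  rcases (show w i = -1 ∨ 0 ≤ w i by have := hge i hi; omega) with hwi | hwi
  · -- stuck in view `-1`
    have hacc : (E.cfg (max n₀ N) s.co).Accepts s :=
      .inr (.inr (hstart' _ (le_max_left _ _)))
    obtain ⟨T, hT1, hT2⟩ : ∃ T, E.time (max n₀ N) + 3 * P.delta ≤ T ∧ G + 3 * P.delta ≤ T :=
      ⟨_, le_max_left _ _, le_max_right _ _⟩
    have hT0 : E.time 0 ≤ T := by have := hG.1; linarith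
    have hNT : N ≤ E.idx T := (le_max_right n₀ N).trans (E.le_idx (by linarith))
    have hp := hneg i hi hexi _ hNT hwi
    have hv := (hviewi _ hNT).trans hwi
    -- `f + 1` `DepVerify`s would start the commit timer, `f + 1` `ViewChange`s would pull the
    -- replica out of view `-1`, and the other two reasons contradict its state directly.
    rcases E.accepts_spread hrot hfaulty hdelta hG hs hacc hi hT1 hT2 with h1 | h1 | h1 | h1
    · exact E.quiet hT0 hi _ (.startCommitTimer s h1 hv hp
        (E.stuck_commitTimer hrot hfaulty hi hviewi hexi hNT) (hexi _))
    · have := E.le_view_of_reached hT0 hi h1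
      omega
    · exact h1 hp
    · omega
  · -- stuck in a view change
    obtain ⟨T₁, h1, h2, h3⟩ := hG.2 (max G (E.time N)) (le_max_left _ _)
    obtain ⟨T₂, h4, h5, h6⟩ := hG.2 T₁ ((le_max_left _ _).trans h1)
    have hG1 : E.time 0 ≤ T₁ := hG.1.trans ((le_max_left _ _).trans h1)
    have hN0 : N ≤ E.idx (max G (E.time N)) := E.le_idx (le_max_right _ _)
    have hN2 : N ≤ E.idx T₂ := E.le_idx ((le_max_right _ _).trans (h1.trans h4))
    -- The members of `W` pull along all other correct replicas, including those that already know
    -- the result.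
    have hjoin : ∀ k ∉ faulty, w i ≤ ((E.cfg (E.idx T₁) k).slots s).view := by
      intro k hk
      refine E.le_view_of_reached hG1 hk ⟨W, by omega, fun l hl => ?_⟩
      have hlf := (Finset.mem_filter.1 hl).2.1
      have hwl := hmin l hl
      have hvl := hw _ hN0 l hlf
      obtain ⟨ct, hct⟩ := (E.msgInv hrot hfaulty _ l s).vc_sent (hvl ▸ hwi.trans hwl)
      exact ⟨_, h3 l hlf k hk _ hct trivial, E.viewChange_valid hrot hfaulty hct, rfl, rfl,
        hvl ▸ hwl⟩
    refine E.quiet (hG1.trans h4) hi _ (.startVcTimer s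
      (E.stuck_phase hrot hfaulty hi hviewi hexi hwi hN2)
      (E.stuck_vcTimer hrot hfaulty hi hviewi hexi hwi hN2)
      ⟨_, correct_card hfaulty, fun k hk => ?_⟩)
    have hkf := (Finset.mem_filter.1 hk).2
    rw [hviewi _ hN2]
    have hvk := hjoin k hkf
    obtain ⟨ct, hct⟩ := (E.msgInv hrot hfaulty _ k s).vc_sent (hwi.trans hvk)
    exact ⟨_, h6 k hkf i hi _ hct trivial, E.viewChange_valid hrot hfaulty hct, rfl, rfl, hvk⟩

end Execution

/-! ### Repeated proposals -/

/-- A rule leaves the bookkeeping of proposals unchanged, or proposes a new request, or proposes a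
request again. -/
theorem Rule.propose_cases {i : Replica f} {now : ℝ} {st st' : LocalState f Req}
    (h : Rule P i now st st') :
    (st'.own = st.own ∧ st'.attempts = st.attempts ∧ st'.reproposed = st.reproposed ∧
      st'.nextSeq = st.nextSeq) ∨
    (∃ r, st.attempts r = 0 ∧ st' = st.propose P i now r) ∨
    ∃ n r, st.own n = some r ∧
      st' = { st with reproposed := insert n st.reproposed }.propose P i now r := by
  cases h with
  | propose r _ _ h => exact .inr (.inl ⟨r, h, rfl⟩)
  | repropose n r h => exact .inr (.inr ⟨n, r, h, rfl⟩)
  | _ => exact .inl ⟨rfl, rfl, rfl, rfl⟩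

/-- The bookkeeping of proposals. -/
structure OwnInv (i : Replica f) (st : LocalState f Req) : Prop where
  own_lt : ∀ q r, st.own q = some r → q < st.nextSeq
  reproposed_lt : ∀ q ∈ st.reproposed, q < st.nextSeq
  own_sent : ∀ q r, st.own q = some r → ∃ dp : DepPropose f Req,
    Msg.depPropose dp true ∈ st.sent ∧ dp.slot = ⟨i, q⟩ ∧ dp.req = r
  attempts : ∀ r, 0 < st.attempts r → ∃ q, st.own q = some r ∧ q ∉ st.reproposed

/-- The set `R` serves both rules: it is unchanged for a new request, and one slot larger for a
repeated one. -/
theorem OwnInv.propose {i : Replica f} {now : ℝ} {st : LocalState f Req} (r : Req)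
    (h : OwnInv i st) (h' : ∀ r', 0 < st.attempts r' → r' ≠ r →
      ∃ q, st.own q = some r' ∧ q ∉ st.reproposed) {R : Set ℕ} (hR : ∀ q ∈ R, q < st.nextSeq)
    (hR' : ∀ q r', r' ≠ r → st.own q = some r' → q ∉ st.reproposed → q ∉ R) :
    OwnInv i ({ st with reproposed := R }.propose P i now r) := by
  constructor
  · intro q r' hq
    dsimp [LocalState.propose, LocalState.setSlot, LocalState.emit] at hq ⊢
    by_cases hqn : q = st.nextSeq
    · omega
    · rw [Function.update_of_ne hqn] at hq
      have := h.own_lt q r' hq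
      omega
  · intro q hq
    exact (hR q hq).trans (Nat.lt_succ_self _)
  · intro q r' hq
    dsimp [LocalState.propose, LocalState.setSlot, LocalState.emit] at hq ⊢
    by_cases hqn : q = st.nextSeq
    · subst hqn
      rw [Function.update_self] at hq
      exact ⟨_, .inr rfl, rfl, Option.some.inj hq⟩
    · rw [Function.update_of_ne hqn] at hq
      obtain ⟨dp, h1, h2⟩ := h.own_sent q r' hq
      exact ⟨dp, .inl h1, h2⟩
  · intro r' hr'
    dsimp [LocalState.propose, LocalState.setSlot, LocalState.emit] at hr' ⊢
    by_cases hrr : r' = r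
    · subst hrr
      exact ⟨st.nextSeq, by simp, fun hm => (hR _ hm).false⟩
    · rw [Function.update_of_ne hrr] at hr'
      obtain ⟨q, h1, h2⟩ := h' r' hr' hrr
      have := h.own_lt q r' h1
      exact ⟨q, by rw [Function.update_of_ne (by omega)]; exact h1, hR' q r' hrr h1 h2⟩

namespace Execution

variable (E : Execution P faulty)

theorem ownInv (n : ℕ) (i : Replica f) : OwnInv i (E.cfg n i) := by
  induction n with
  | zero => rw [cfg_zero]; constructor <;> simp [LocalState.initial]
  | succ n ih =>
    have hsub := E.sent_succ n i
    have hkeep : (E.cfg (n + 1) i).own = (E.cfg n i).own →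
        (E.cfg (n + 1) i).attempts = (E.cfg n i).attempts →
        (E.cfg (n + 1) i).reproposed = (E.cfg n i).reproposed →
        (E.cfg (n + 1) i).nextSeq = (E.cfg n i).nextSeq → OwnInv i (E.cfg (n + 1) i) := by
      intro h1 h2 h3 h4
      constructor
      · rw [h1, h4]; exact ih.own_lt
      · rw [h3, h4]; exact ih.reproposed_lt
      · rw [h1]; exact fun q r hq => (ih.own_sent q r hq).imp fun dp h => ⟨hsub h.1, h.2⟩
      · rw [h1, h2, h3]; exact ih.attempts
    rcases (E.step n).replica i with h | ⟨ht, hi, h⟩ | ⟨m, -, h⟩ | ⟨s', dp, D, -, h⟩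
    · rwa [h]
    · rcases h.propose_cases with ⟨h1, h2, h3, h4⟩ | ⟨r, -, h1⟩ | ⟨q, r, h1, h2⟩
      · exact hkeep h1 h2 h3 h4
      · rw [h1]
        exact ih.propose r (fun r' h _ => ih.attempts r' h) ih.reproposed_lt (fun _ _ _ _ h => h)
      · rw [h2]
        refine ih.propose r (fun r' h _ => ih.attempts r' h) ?_ ?_
        · rintro q' (rfl | hq')
          · exact ih.own_lt _ _ h1
          · exact ih.reproposed_lt _ hq'
        · rintro q' r' hne hq' hn (rfl | hm)
          · rw [h1] at hq'; exact hne (Option.some.inj hq').symm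
          · exact hn hm
    · exact hkeep (by rw [h]) (by rw [h]) (by rw [h]) (by rw [h])
    · exact hkeep (by rw [h]; rfl) (by rw [h]; rfl) (by rw [h]; rfl) (by rw [h]; rfl)

/-- The correct coordinator of `dp.slot` makes the proposal `dp` in step `m`. -/
structure Proposes (m : ℕ) (dp : DepPropose f Req) : Prop where
  co : dp.slot.co ∉ faulty
  seq : dp.slot.seq = (E.cfg m dp.slot.co).nextSeq
  time : E.time (m + 1) = E.time m
  deps : dp.deps = (E.cfg m dp.slot.co).conflicts P dp.req
  sent : Msg.depPropose dp true ∈ (E.cfg (m + 1) dp.slot.co).sent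

/-- How a step changes the number of times a request has been proposed. -/
theorem attempts_succ (n : ℕ) (i : Replica f) (r : Req) :
    ((E.cfg (n + 1) i).attempts r = (E.cfg n i).attempts r ∧
      ∀ q, (E.cfg n i).own q = some r → q ∉ (E.cfg n i).reproposed →
        q ∉ (E.cfg (n + 1) i).reproposed) ∨
    ((E.cfg (n + 1) i).attempts r = (E.cfg n i).attempts r + 1 ∧
      ∃ dp : DepPropose f Req, E.Proposes n dp ∧ dp.slot.co = i ∧ dp.req = r ∧
        dp.quorum = P.rotation i ((E.cfg n i).attempts r)) := by
  rcases (E.step n).replica i with h | ⟨ht, hi, h⟩ | ⟨m, -, h⟩ | ⟨s', dp, D, -, h⟩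
  · left; rw [h]; exact ⟨rfl, fun _ _ h => h⟩
  · rcases h.propose_cases with ⟨h1, h2, h3, h4⟩ | ⟨r', -, h1⟩ | ⟨q, r', h1, h2⟩
    · left; rw [h2, h3]; exact ⟨rfl, fun _ _ h => h⟩
    · by_cases hr : r = r'
      · subst hr
        right
        refine ⟨by rw [h1]; simp [LocalState.propose, LocalState.setSlot, LocalState.emit],
          ⟨⟨i, (E.cfg n i).nextSeq⟩, r, (E.cfg n i).conflicts P r,
            P.rotation i ((E.cfg n i).attempts r)⟩,
          ⟨hi, rfl, ht, rfl, ?_⟩, rfl, rfl, rfl⟩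
        dsimp only
        rw [h1]
        exact .inr rfl
      · left
        rw [h1]
        exact ⟨Function.update_of_ne hr _ _, fun _ _ h => h⟩
    · by_cases hr : r = r'
      · subst hr
        right
        refine ⟨by rw [h2]; simp [LocalState.propose, LocalState.setSlot, LocalState.emit],
          ⟨⟨i, (E.cfg n i).nextSeq⟩, r, (E.cfg n i).conflicts P r,
            P.rotation i ((E.cfg n i).attempts r)⟩,
          ⟨hi, rfl, ht, rfl, ?_⟩, rfl, rfl, rfl⟩
        dsimp only
        rw [h2]
        exact .inr rfl
      · left
        rw [h2]
        refine ⟨Function.update_of_ne hr _ _, ?_⟩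
        rintro q' hq' hn (rfl | hm)
        · rw [h1] at hq'; exact hr (Option.some.inj hq').symm
        · exact hn hm
  · left; rw [h]; exact ⟨rfl, fun _ _ h => h⟩
  · left; rw [h]; exact ⟨rfl, fun _ _ h => h⟩

theorem attempts_mono (i : Replica f) (r : Req) : Monotone fun n => (E.cfg n i).attempts r :=
  monotone_nat_of_le_succ fun n => by
    rcases E.attempts_succ n i r with ⟨h, -⟩ | ⟨h, -⟩ <;> omega

theorem own_succ {n : ℕ} {i : Replica f} {q : ℕ} {r : Req} (h : (E.cfg n i).own q = some r) :
    (E.cfg (n + 1) i).own q = some r := by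
  have hlt := (E.ownInv n i).own_lt q r h
  have hpr : ∀ (st : LocalState f Req) r', q < st.nextSeq → st.own q = some r →
      (st.propose P i (E.time n) r').own q = some r := by
    intro st r' h1 h2
    dsimp [LocalState.propose, LocalState.setSlot, LocalState.emit]
    rw [Function.update_of_ne (by omega)]; exact h2
  rcases (E.step n).replica i with h' | ⟨ht, hi, h'⟩ | ⟨m, -, h'⟩ | ⟨s', dp, D, -, h'⟩
  · rwa [h']
  · rcases h'.propose_cases with ⟨h1, h2, h3, h4⟩ | ⟨r', -, h1⟩ | ⟨q, r', h1, h2⟩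
    · rwa [h1]
    · rw [h1]; exact hpr _ _ hlt h
    · rw [h2]; exact hpr _ _ hlt h
  · rwa [h']
  · rw [h']; exact h

theorem own_mono {n n' : ℕ} (hn : n ≤ n') {i : Replica f} {q : ℕ} {r : Req}
    (h : (E.cfg n i).own q = some r) : (E.cfg n' i).own q = some r := by
  induction hn with
  | refl => exact h
  | step _ ih => exact E.own_succ ih

/-- A slot is marked as proposed again only when its request is proposed again. -/
theorem attempts_lt {n n' : ℕ} (hn : n ≤ n') {i : Replica f} {q : ℕ} {r : Req}
    (h : (E.cfg n i).own q = some r) (hq : q ∉ (E.cfg n i).reproposed)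
    (hq' : q ∈ (E.cfg n' i).reproposed) :
    (E.cfg n i).attempts r < (E.cfg n' i).attempts r := by
  induction hn with
  | refl => exact (hq hq').elim
  | @step m hm ih =>
    rw [Nat.succ_eq_add_one] at hq' ⊢
    by_cases hqm : q ∈ (E.cfg m i).reproposed
    · exact (ih hqm).trans_le (E.attempts_mono i r m.le_succ)
    · rcases E.attempts_succ m i r with ⟨-, h1⟩ | ⟨h1, -⟩
      · exact (h1 q (E.own_mono hm h) hqm hq').elim
      · have : (E.cfg n i).attempts r ≤ (E.cfg m i).attempts r := E.attempts_mono i r hm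
        omega

variable (hrot : P.IsRotation) (hfaulty : faulty.card ≤ f)

include hrot hfaulty

/-- What is decided in a slot of a correct coordinator, unless the no-op, was proposed by it. -/
theorem proposed_of_exec {n : ℕ} {i : Replica f} (hi : i ∉ faulty) {s : Slot f}
    (hs : s.co ∉ faulty) {dp : DepPropose f Req} {D : Set (Slot f)}
    (h : ((E.cfg n i).slots s).exec = some (some (dp, D))) :
    dp.slot = s ∧ ∃ n', Msg.depPropose dp true ∈ (E.cfg n' s.co).sent := by
  obtain ⟨N, k, hk, h1, h2⟩ := E.committed_of_exec hrot hfaulty hi h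
  obtain ⟨dp', h3, h4⟩ := Option.map_eq_some_iff.1 h2
  obtain ⟨rfl, -⟩ := Prod.mk.inj h4
  have hshape := E.shapeInv hrot hfaulty N k s
  have hslot : dp'.slot = s := by
    rcases h1 with h1 | h1
    · exact (hshape.p_spec (hshape.fast (.inr h1)).1 _ h3).1
    · exact (hshape.value_verified (E.slotBasic N k s) (.inr (.inr h1))
        (by simp only [SlotState.value, h3]; rfl)).1
  refine ⟨hslot, N, ?_⟩
  have := ((E.slotAuth N k).2 s).p dp' h3
  rw [hslot] at this
  exact this.resolve_left hs

variable {G : ℝ} (hG : E.Delivers G) (hvc : 3 * P.delta ≤ P.vcTimeout) (hdelta : 0 < P.delta)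

include hG hvc hdelta

/-- A request that does not commit is proposed over and over again. -/
theorem attempts_unbounded {i : Replica f} (hi : i ∉ faulty) {r : Req} (hr : ¬ E.Commits r)
    {n : ℕ} (hn : 0 < (E.cfg n i).attempts r) (k : ℕ) :
    ∃ n, k < (E.cfg n i).attempts r := by
  induction k with
  | zero => exact ⟨n, hn⟩
  | succ k ih =>
    obtain ⟨n, hn⟩ := ih
    obtain ⟨q, hq, hqn⟩ := (E.ownInv n i).attempts r (by omega)
    obtain ⟨n₁, h1⟩ := E.exists_exec hrot hfaulty hG hvc hdelta (s := ⟨i, q⟩) hi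
      ((E.ownInv n i).own_lt q r hq)
    obtain ⟨o, ho⟩ := Option.ne_none_iff_exists'.1 h1
    rcases o with _ | ⟨dp, D⟩
    -- The slot was filled with a no-op, so `repropose` would be enabled until the slot is marked,
    -- and marking it costs a further attempt.
    · set T := max (E.time n) (E.time n₁)
      have h0 : E.time 0 ≤ T := (E.time_mono n.zero_le).trans (le_max_left _ _)
      have hnT : n ≤ E.idx T := E.le_idx (le_max_left _ _)
      refine ⟨E.idx T, ?_⟩
      have hmem : q ∈ (E.cfg (E.idx T) i).reproposed := by
        by_contra hno
        exact E.quiet h0 hi _ (.repropose q r (E.own_mono hnT hq)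
          (E.exec_mono (E.le_idx (le_max_right _ _)) ho) hno)
      have := E.attempts_lt hnT hq hqn hmem
      omega
    -- A result other than the no-op is the coordinator's own proposal for the slot, that is, `r`.
    · exfalso
      obtain ⟨h2, n₂, h3⟩ := E.proposed_of_exec hrot hfaulty hi (s := ⟨i, q⟩) hi ho
      obtain ⟨dp', h4, h5, h6⟩ := (E.ownInv n i).own_sent q r hq
      have h7 := E.propose_unique hfaulty (E.sent_mono i (le_max_right n n₂) h3)
        (E.sent_mono i (le_max_left n n₂) h4) (h2.trans h5.symm)
      have h8 := E.commits_of_exec hrot hfaulty hi ho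
      rw [h7, h6] at h8
      exact hr h8

/-- A request that does not commit is proposed in the synchronous phase with a quorum of correct
replicas. -/
theorem exists_good_proposal {i : Replica f} (hi : i ∉ faulty) {r : Req} (hr : ¬ E.Commits r)
    {n : ℕ} (hn : 0 < (E.cfg n i).attempts r) :
    ∃ m, G ≤ E.time m ∧ ∃ dp, E.Proposes m dp ∧ dp.req = r ∧
      IsQuorum dp.slot.co dp.quorum ∧ ∀ j ∈ dp.quorum, j ∉ faulty := by
  -- There are at least `2f + 1` correct replicas, so `2f` remain besides `i`.
  obtain ⟨Q, hQ, hQc⟩ := Finset.exists_subset_card_eq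
    (s := (Finset.univ.filter (· ∉ faulty) : Finset (Replica f)).erase i) (n := 2 * f) (by
      rw [Finset.card_erase_of_mem (by simpa using hi)]
      have := correct_card (f := f) hfaulty
      omega)
  have hQq : IsQuorum i Q := ⟨hQc, fun h => (Finset.mem_erase.1 (hQ h)).1 rfl⟩
  -- `k` is at least the number of attempts made just after `G`. Attempts are counted from `0`, so
  -- the step that raises the count from `k` to `k + 1` uses quorum `k` and comes later.
  obtain ⟨k, hk, hkQ⟩ := hrot.2 i Q hQq ((E.cfg (E.idx G + 1) i).attempts r)
  have hex := E.attempts_unbounded hrot hfaulty hG hvc hdelta hi hr hn k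
  have hspec := Nat.find_spec hex
  have hmin : ∀ m < Nat.find hex, (E.cfg m i).attempts r ≤ k := fun m hm =>
    not_lt.1 (Nat.find_min hex hm)
  obtain ⟨m, hm⟩ : ∃ m, Nat.find hex = m + 1 := by
    refine Nat.exists_eq_succ_of_ne_zero fun h0 => ?_
    rw [h0, cfg_zero] at hspec
    simp [LocalState.initial] at hspec
  rw [hm] at hspec hmin
  have hmk := hmin m m.lt_succ_self
  have hGm : E.idx G + 1 ≤ m := by
    by_contra! hlt
    have : (E.cfg (m + 1) i).attempts r ≤ (E.cfg (E.idx G + 1) i).attempts r :=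
      E.attempts_mono i r (by omega)
    omega
  refine ⟨m, (E.lt_time_idx_succ G).le.trans (E.time_mono hGm), ?_⟩
  rcases E.attempts_succ m i r with ⟨h1, -⟩ | ⟨h1, dp, h2, h3, h4, h5⟩
  · omega
  · rw [show (E.cfg m i).attempts r = k by omega, hkQ] at h5
    refine ⟨dp, h2, h4, h3 ▸ h5 ▸ hQq, fun j hj => ?_⟩
    rw [h5] at hj
    simpa using (Finset.mem_erase.1 (hQ hj)).2

end Execution

/-! ### Proposals with correct quorums -/

namespace Execution

variable (E : Execution P faulty)

/-- A replica sends a `DepVerify` with dependencies that it has accepted. -/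
theorem accepts_depVerify {n : ℕ} {k : Replica f} {dv : DepVerify f Req}
    (h : Msg.depVerify dv ∈ (E.cfg n k).sent) : (E.cfg n k).AcceptsAll dv.deps := by
  induction n with
  | zero => rw [cfg_zero] at h; simp [LocalState.initial] at h
  | succ n ih =>
    suffices (E.cfg n k).AcceptsAll dv.deps from
      fun l q hq => E.accepts_mono n.le_succ (this l q hq)
    by_cases hold : Msg.depVerify dv ∈ (E.cfg n k).sent
    · exact ih hold
    · rcases E.slot_step n k dv.slot with ⟨-, -, h1, -⟩ | ⟨ss', M, -, -, hs, -, h1, -⟩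
      · exact ((h1 _ h).resolve_left hold rfl).elim
      · rw [h1] at h
        replace h := h.resolve_left hold
        cases hs
        case acceptRequest =>
          obtain ⟨-, h⟩ := h
          rw [Msg.depVerify.inj h]
          exact E.accepts_conflicts
        all_goals simp [LocalState.enterMsgs] at h

variable (hrot : P.IsRotation) (hfaulty : faulty.card ≤ f) {m : ℕ} {dp : DepPropose f Req}
  (hp : E.Proposes m dp)

include hrot hfaulty hp

/-- No view change happens before the commit timers expire. -/
theorem view_of_proposes {n : ℕ} (hmn : m ≤ n) (hn : E.time n < E.time m + 9 * P.delta) :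
    ∀ k ∉ faulty, ((E.cfg n k).slots dp.slot).view = -1 ∧
      ∀ t, ((E.cfg n k).slots dp.slot).commitTimer = some t → E.time m + 9 * P.delta ≤ t := by
  induction hmn with
  | refl =>
    intro k hk
    -- The slot is untouched at every correct replica when it is proposed, so every commit timer for
    -- it starts at this time or later.
    rw [(E.freshInv hfaulty m).init k hk dp.slot hp.co hp.seq.ge]
    simp [SlotState.initial]
  | @step n hmn ih =>
    rw [Nat.succ_eq_add_one] at hn ⊢
    have hn' : E.time n < E.time m + 9 * P.delta := (E.time_mono n.le_succ).trans_lt hn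
    have hmn' := E.time_mono hmn
    intro k hk
    obtain ⟨h1, h2⟩ := ih hn' k hk
    have hvc := (E.slotBasic n k dp.slot).vc
    rcases E.slot_step n k dp.slot with ⟨h3, -⟩ | ⟨ss', M, -, -, hs, h3, -, -⟩
    · rw [h3]; exact ⟨h1, h2⟩
    · rw [h3]
      cases hs
      case propose => exact ⟨h1, fun t ht => by have := Option.some.inj ht; linarith⟩
      case acceptPropose =>
        refine ⟨h1, fun t ht => ?_⟩
        replace ht := Option.some.inj ht
        rcases hc : ((E.cfg n k).slots dp.slot).commitTimer with _ | t'
        · rw [hc] at ht; dsimp at ht; linarith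
        · rw [hc] at ht; dsimp at ht; exact ht ▸ h2 _ hc
      case startCommitTimer =>
        exact ⟨h1, fun t ht => by have := Option.some.inj ht; linarith⟩
      case commitTimeout t ht hnow => have := h2 t ht; linarith
      case vcTimeout t ht hnow =>
        have := (hvc ((E.timerInv hrot hfaulty n k dp.slot).vcTimer (by simp [ht]))).1
        omega
      case joinView w hw hlt =>
        obtain ⟨l, hl, h4⟩ := E.view_le_of_reached hrot hfaulty hw
        have := (ih hn' l hl).1
        omega
      case installView hph _ => have := (hvc hph).1; omega
      all_goals
        first
          | exact ⟨h1, h2⟩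
          | exact ⟨h1, fun t ht => by cases ht⟩

variable {G : ℝ} (hG : E.Delivers G) (hmG : G ≤ E.time m) (hdelta : 0 < P.delta)

include hG hmG

theorem view_of_proposes_at {T : ℝ} (h1 : E.time m ≤ T) (h2 : T < E.time m + 9 * P.delta)
    {k : Replica f} (hk : k ∉ faulty) : ((E.cfg (E.idx T) k).slots dp.slot).view = -1 :=
  (E.view_of_proposes hrot hfaulty hp (E.le_idx h1)
    ((E.time_idx_le (hG.1.trans (hmG.trans h1))).trans_lt h2) k hk).1

include hdelta

/-- After `3Δ`, all correct replicas have accepted the proposal. -/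
theorem p_of_proposes (hF : IsQuorum dp.slot.co dp.quorum) {T : ℝ}
    (h1 : E.time m + 3 * P.delta ≤ T) (h2 : T < E.time m + 9 * P.delta)
    {k : Replica f} (hk : k ∉ faulty) : ((E.cfg (E.idx T) k).slots dp.slot).p = some dp := by
  have hv := E.view_of_proposes_at hrot hfaulty hp hG hmG (by linarith) h2 hk
  have h0 : E.time 0 ≤ T := by have := hG.1; linarith
  rcases hpk : ((E.cfg (E.idx T) k).slots dp.slot).p with _ | dp'
  · exfalso
    refine E.quiet h0 hk _ (.acceptPropose dp true
      (hG.rcvd hp.co hk hp.sent trivial (by rw [hp.time]; linarith) (by linarith))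
      hF hv hpk ?_ ?_)
    · intro l q hq
      rw [hp.deps] at hq
      exact E.accepts_spread hrot hfaulty hdelta hG hp.co (E.accepts_conflicts l q hq) hk h1
        (by linarith)
    · intro q hq
      exact E.accepts_spread hrot hfaulty hdelta hG (n := m) hp.co
        (.inr (.inr (E.own_started m dp.slot.co q (by have := hp.seq; omega)))) hk h1
        (by linarith)
  · obtain ⟨h3, -⟩ := (E.shapeInv hrot hfaulty (E.idx T) k dp.slot).p_spec hv dp' hpk
    have h4 := ((E.slotAuth (E.idx T) k).2 dp.slot).p dp' hpk
    rw [h3] at h4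
    rw [E.propose_unique hfaulty
      (E.sent_mono _ (le_max_left (E.idx T) (m + 1)) (h4.resolve_left hp.co))
      (E.sent_mono _ (le_max_right _ _) hp.sent) h3]

variable (hs : P.signed dp.req) (hF : IsQuorum dp.slot.co dp.quorum)

include hs hF

theorem hasReq_of_proposes {T : ℝ}
    (h1 : E.time m + 3 * P.delta ≤ T) (h2 : T < E.time m + 9 * P.delta)
    {k : Replica f} (hk : k ∉ faulty) :
    ((E.cfg (E.idx T) k).slots dp.slot).hasReq = true := by
  have h0 : E.time 0 ≤ T := by have := hG.1; linarith
  by_contra hr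
  exact E.quiet h0 hk _ (.acceptRequest dp
    (hG.rcvd hp.co hk hp.sent trivial (by rw [hp.time]; linarith) (by linarith)) hs
    (E.view_of_proposes_at hrot hfaulty hp hG hmG (by linarith) h2 hk)
    (E.p_of_proposes hrot hfaulty hp hG hmG hdelta hF h1 h2 hk) (by simpa using hr))

variable (hQ : ∀ j ∈ dp.quorum, j ∉ faulty)

include hQ

/-- After `6Δ`, all correct replicas have collected the same `DepVerify`s. -/
theorem v_of_proposes : ∃ V : Verifies f Req, (∀ j ∈ dp.quorum, V j ≠ none) ∧
    ∀ T, E.time m + 6 * P.delta ≤ T → T < E.time m + 9 * P.delta → ∀ k ∉ faulty,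
      ((E.cfg (E.idx T) k).slots dp.slot).v = V := by
  -- At `3Δ` all members of the quorum have accepted the proposal together with its request, so
  -- their `DepVerify`s have been sent.
  have hsent : ∀ j ∈ dp.quorum, ∃ D, Msg.depVerify ⟨dp.slot, j, dp, D⟩ ∈
      (E.cfg (E.idx (E.time m + 3 * P.delta)) j).sent := by
    intro j hj
    have hjf := hQ j hj
    exact (E.msgInv hrot hfaulty _ j dp.slot).dv_sent
      (E.view_of_proposes_at hrot hfaulty hp hG hmG (by linarith) (by linarith) hjf)
      (E.hasReq_of_proposes hrot hfaulty hp hG hmG hdelta hs hF le_rfl (by linarith) hjf)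
      (fun h => hF.2 (h ▸ hj)) dp
      (E.p_of_proposes hrot hfaulty hp hG hmG hdelta hF le_rfl (by linarith) hjf) hj
  choose! D hD using hsent
  refine ⟨fun j => if j ∈ dp.quorum then some ⟨dp.slot, j, dp, D j⟩ else none,
    fun j hj => by simp [hj], fun T h1 h2 k hk => ?_⟩
  have h0 : E.time 0 ≤ E.time m + 3 * P.delta := by have := hG.1; linarith
  have hv := E.view_of_proposes_at hrot hfaulty hp hG hmG (by linarith) h2 hk
  have hpk := E.p_of_proposes hrot hfaulty hp hG hmG hdelta hF (by linarith) h2 hk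
  have hspec := (E.shapeInv hrot hfaulty (E.idx T) k dp.slot).v_spec hv
  funext j
  rcases hvj : ((E.cfg (E.idx T) k).slots dp.slot).v j with _ | dv
  · by_cases hj : j ∈ dp.quorum
    · exfalso
      have hle := E.time_idx_le h0
      refine E.quiet (h0.trans (by linarith)) hk _ (.acceptVerify dp ⟨dp.slot, j, dp, D j⟩
        (hG.rcvd (hQ j hj) hk (hD j hj) trivial (by linarith) (by linarith)) rfl rfl hv hpk hj hvj
        fun l q hq => ?_)
      -- The sender had accepted these dependencies by `3Δ`; spreading them takes the second `3Δ`.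
      exact E.accepts_spread hrot hfaulty hdelta hG (hQ j hj)
        (E.accepts_depVerify (hD j hj) l q hq) hk (by linarith) (by linarith)
    · simp [hj]
  · obtain ⟨a1, a2, a3, a4, a5⟩ := hspec j dv hvj
    obtain rfl : dv.dp = dp := by rw [hpk] at a3; exact (Option.some.inj a3).symm
    have hjf := hQ j a4
    have h3 := E.sent_of_rcvd a5 (by simp [Msg.sender?, a2]) hjf
    have h4 := (E.msgInv hrot hfaulty
      (max (E.idx T) (E.idx (E.time m + 3 * P.delta))) j dv.dp.slot).dv_uniq dv _
      (E.sent_mono j (le_max_left _ _) h3) (E.sent_mono j (le_max_right _ _) (hD j a4)) a1 rfl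
    simp only [if_pos a4]
    rw [h4]

/-- A proposal with a quorum of correct replicas commits. -/
theorem commits_of_proposes : E.Commits dp.req := by
  obtain ⟨V, hV, hVeq⟩ := E.v_of_proposes hrot hfaulty hp hG hmG hdelta hs hF hQ
  -- Two further deliveries end before `8Δ`, within the `9Δ` during which the view is known to stay
  -- `-1`.
  obtain ⟨T, hT⟩ : ∃ T, T = E.time m + 6 * P.delta := ⟨_, rfl⟩
  obtain ⟨T₁, h1, h2, h3⟩ := hG.2 T (by linarith)
  obtain ⟨T₂, h4, h5, h6⟩ := hG.2 T₁ (by linarith)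
  have h0 : E.time 0 ≤ T := by have := hG.1; linarith
  have hview : ∀ T', T ≤ T' → T' ≤ T₂ → ∀ k ∉ faulty,
      ((E.cfg (E.idx T') k).slots dp.slot).view = -1 := fun T' a b k hk =>
    E.view_of_proposes_at hrot hfaulty hp hG hmG (by linarith) (by linarith) hk
  have hpk : ∀ T', T ≤ T' → T' ≤ T₂ → ∀ k ∉ faulty,
      ((E.cfg (E.idx T') k).slots dp.slot).p = some dp := fun T' a b k hk =>
    E.p_of_proposes hrot hfaulty hp hG hmG hdelta hF (by linarith) (by linarith) hk
  have hvk : ∀ T', T ≤ T' → T' ≤ T₂ → ∀ k ∉ faulty,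
      ((E.cfg (E.idx T') k).slots dp.slot).v = V := fun T' a b k hk =>
    hVeq T' (by linarith) (by linarith) k hk
  have hval : ∀ T', T ≤ T' → T' ≤ T₂ → ∀ k ∉ faulty,
      ((E.cfg (E.idx T') k).slots dp.slot).value = some (dp, V) := fun T' a b k hk => by
    simp only [SlotState.value, hpk T' a b k hk, hvk T' a b k hk]; rfl
  have hph : ∀ T', T ≤ T' → T' ≤ T₂ → ∀ k ∉ faulty,
      ((E.cfg (E.idx T') k).slots dp.slot).phase ≠ .init ∧
      ((E.cfg (E.idx T') k).slots dp.slot).phase ≠ .proposed ∧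
      ((E.cfg (E.idx T') k).slots dp.slot).phase ≠ .viewChange := by
    intro T' a b k hk
    have hv := hview T' a b k hk
    refine ⟨?_, fun h => ?_, fun h => ?_⟩
    · rw [← (E.shapeInv hrot hfaulty (E.idx T') k dp.slot).hasReq hv]
      exact E.hasReq_of_proposes hrot hfaulty hp hG hmG hdelta hs hF (by linarith)
        (by linarith) hk
    · have hall : ∀ j ∈ dp.quorum, ((E.cfg (E.idx T') k).slots dp.slot).v j ≠ none := by
        rw [hvk T' a b k hk]; exact hV
      by_cases hfast : FastMatch ((E.cfg (E.idx T') k).slots dp.slot).v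
      · exact E.quiet (h0.trans a) hk _ (.fpVerify dp.slot dp h (hpk T' a b k hk) hall hfast)
      · exact E.quiet (h0.trans a) hk _ (.rpVerify dp.slot dp h (hpk T' a b k hk) hall hfast)
    · have := ((E.slotBasic (E.idx T') k dp.slot).vc h).1
      omega
  have hconcl : ∀ T', T ≤ T' → T' ≤ T₂ →
      (((E.cfg (E.idx T') dp.slot.co).slots dp.slot).phase = .fpCommitted ∨
        ((E.cfg (E.idx T') dp.slot.co).slots dp.slot).phase = .rpCommitted) →
      E.Commits dp.req := fun T' a b h =>
    ⟨_, _, hp.co, _, dp, hpk T' a b _ hp.co, rfl, h⟩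
  have hTT₂ := h1.trans h4
  -- All correct replicas hold the same family `V`, so they all take the same path.
  by_cases hfast : FastMatch V
  · have hph' : ∀ T', T ≤ T' → T' ≤ T₂ → ∀ k ∉ faulty,
        ((E.cfg (E.idx T') k).slots dp.slot).phase = .fpVerified ∨
        ((E.cfg (E.idx T') k).slots dp.slot).phase = .fpCommitted := by
      intro T' a b k hk
      obtain ⟨b1, b2, b3⟩ := hph T' a b k hk
      have h7 := (E.shapeInv hrot hfaulty (E.idx T') k dp.slot).slow (hview T' a b k hk)
      rw [hvk T' a b k hk] at h7
      have h8 : ¬ _ := fun h => (h7 h).2 hfast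
      cases hphase : ((E.cfg (E.idx T') k).slots dp.slot).phase <;> simp_all
    rcases hph' T₁ h1 h4 _ hp.co with h | h
    · exfalso
      refine E.quiet (h0.trans h1) hp.co _ (.fpCommit dp.slot h
        ⟨_, correct_card hfaulty, fun k hk => ?_⟩)
      have hkf := (Finset.mem_filter.1 hk).2
      have h7 := (E.msgInv hrot hfaulty _ k dp.slot).dc_sent (hph' T le_rfl hTT₂ k hkf)
      rw [hval T le_rfl hTT₂ k hkf] at h7
      rw [hval T₁ h1 h4 _ hp.co]
      exact h3 k hkf _ hp.co _ h7 trivial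
    · exact hconcl T₁ h1 h4 (.inl h)
  · have hph' : ∀ T', T ≤ T' → T' ≤ T₂ → ∀ k ∉ faulty,
        ((E.cfg (E.idx T') k).slots dp.slot).phase = .rpVerified ∨
        ((E.cfg (E.idx T') k).slots dp.slot).phase = .rpPrepared ∨
        ((E.cfg (E.idx T') k).slots dp.slot).phase = .rpCommitted := by
      intro T' a b k hk
      obtain ⟨b1, b2, b3⟩ := hph T' a b k hk
      have h7 := (E.shapeInv hrot hfaulty (E.idx T') k dp.slot).fast
      rw [hvk T' a b k hk] at h7
      have h8 : ¬ _ := fun h => hfast (h7 h).2.2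
      cases hphase : ((E.cfg (E.idx T') k).slots dp.slot).phase <;> simp_all
    have hprep : ∀ T', T₁ ≤ T' → T' ≤ T₂ → ∀ k ∉ faulty,
        ((E.cfg (E.idx T') k).slots dp.slot).phase = .rpPrepared ∨
        ((E.cfg (E.idx T') k).slots dp.slot).phase = .rpCommitted := by
      intro T' a b i hi
      refine (hph' T' (h1.trans a) b i hi).resolve_left fun h => ?_
      refine E.quiet (h0.trans (h1.trans a)) hi _ (.rpPrepare dp.slot h
        ⟨_, correct_card hfaulty, fun k hk => ?_⟩)
      have hkf := (Finset.mem_filter.1 hk).2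
      have h7 := (E.msgInv hrot hfaulty _ k dp.slot).pr_sent (hph' T le_rfl hTT₂ k hkf)
      rw [hval T le_rfl hTT₂ k hkf, hview T le_rfl hTT₂ k hkf] at h7
      rw [hval T' (h1.trans a) b i hi, hview T' (h1.trans a) b i hi]
      exact E.rcvd_mono i (E.idx_mono a) (h3 k hkf i hi _ h7 trivial)
    rcases hprep T₂ h4 le_rfl _ hp.co with h | h
    · exfalso
      refine E.quiet (h0.trans hTT₂) hp.co _ (.rpCommit dp.slot h
        ⟨_, correct_card hfaulty, fun k hk => ?_⟩)
      have hkf := (Finset.mem_filter.1 hk).2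
      have h7 := (E.msgInv hrot hfaulty _ k dp.slot).co_sent (hprep T₁ le_rfl h4 k hkf)
      rw [hval T₁ h1 h4 k hkf, hview T₁ h1 h4 k hkf] at h7
      rw [hval T₂ hTT₂ le_rfl _ hp.co, hview T₂ hTT₂ le_rfl _ hp.co]
      exact h6 k hkf _ hp.co _ h7 trivial
    · exact hconcl T₂ hTT₂ le_rfl (.inr h)

end Execution

/-! ### From the client's request to a commit -/

namespace Execution

variable (E : Execution P faulty)

/-- A replica replies to a request only when it knows the request to be agreed on. -/
theorem exec_of_reply {n : ℕ} {k : Replica f} {r : Req} (h : Msg.reply r k ∈ (E.cfg n k).sent) :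
    ∃ n s dp D, ((E.cfg n k).slots s).exec = some (some (dp, D)) ∧ dp.req = r := by
  induction n with
  | zero => rw [cfg_zero] at h; simp [LocalState.initial] at h
  | succ n ih =>
    rcases (E.step n).replica k with h1 | ⟨ht, hi, h1⟩ | ⟨m, -, h1⟩ | ⟨s, dp, D, h2, h1⟩
    · rw [h1] at h; exact ih h
    · obtain ⟨s', ss', M, hs, he⟩ := h1.slotStep
      rw [he.sent] at h
      rcases h with h | h
      · exact ih h
      · rcases hs.msgs h with ⟨dp, b, h⟩ | ⟨h, -⟩
        · cases h
        · simp [Msg.slot?] at h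
    · rw [h1] at h; exact ih h
    · rw [h1] at h
      rcases h with h | h
      · exact ih h
      · exact ⟨n, s, dp, D, h2, (Msg.reply.inj h).1.symm⟩

/-- Agreement liveness. -/
theorem commits_of_issued (hrot : P.IsRotation) (hfaulty : faulty.card ≤ f)
    (hdelta : 0 < P.delta) (hvc : 3 * P.delta ≤ P.vcTimeout) {G : ℝ} (hG : E.Delivers G)
    {r : Req} (hr : E.Issued r) : E.Commits r := by
  obtain ⟨hs, t, τ, -, -, -, hall⟩ := hr
  by_contra hno
  have hexec : ∀ n, ∀ i ∉ faulty, ∀ s dp D,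
      ((E.cfg n i).slots s).exec = some (some (dp, D)) → dp.req ≠ r := by
    rintro n i hi s dp D h rfl
    exact hno (E.commits_of_exec hrot hfaulty hi h)
  -- One of `f + 1` replies would come from a correct replica, which replies only when it knows a
  -- result with this request; so the client contacts all replicas.
  have hans : ¬ E.Answered r (t + τ) := by
    rintro ⟨K, hK, h⟩
    obtain ⟨k, hk, hkf⟩ := exists_correct_of_card hfaulty hK
    obtain ⟨n, -, hn⟩ := h k hk hkf
    obtain ⟨n', s, dp, D, h1, h2⟩ := E.exec_of_reply hn
    exact hexec n' k hkf s dp D h1 h2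
  obtain ⟨j, -, hj⟩ := exists_correct_of_card (K := Finset.univ) hfaulty
    (by rw [Finset.card_univ, Fintype.card_fin]; omega)
  obtain ⟨n, -, hn⟩ := hall hans j hj
  -- By the end of that instant `j` must have proposed `r`, as neither a previous attempt nor a
  -- known result could block the rule.
  have hattempts : 0 < (E.cfg (E.idx (E.time n)) j).attempts r := by
    by_contra hzero
    exact E.quiet (E.time_mono n.zero_le) hj _ (.propose r (E.rcvd_mono j (E.le_idx le_rfl) hn) hs
      (by omega) (hexec _ j hj))
  obtain ⟨m, hm, dp, hp, rfl, hF, hQ⟩ :=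
    E.exists_good_proposal hrot hfaulty hG hvc hdelta hj hno hattempts
  exact hno (E.commits_of_proposes hrot hfaulty hp hG hm hdelta hs hF hQ)

end Execution

end

end Isos

theorem mainTheorem3 {Req : Type*} (f : ℕ) (P : Isos.Params f Req)
    (hdelta : 0 < P.delta)
    (hvc : P.vcTimeout = 3 * P.delta ∨ P.vcTimeout = 5 * P.delta)
    (hrot : P.IsRotation)
    (faulty : Finset (Isos.Replica f)) (hfaulty : faulty.card ≤ f)
    (E : Isos.Execution P faulty) (hrel : E.Reliable)
    (hsync : ∃ gst : ℝ, E.SynchronousFrom gst)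
    (r : Req) (hr : E.Issued r) :
    E.Commits r := by
  obtain ⟨gst, hgst⟩ := hsync
  obtain ⟨G, hG⟩ := E.exists_deliver hdelta hrel hgst
  exact E.commits_of_issued hrot hfaulty hdelta (by rcases hvc with h | h <;> linarith) hG hr
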